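/- Let $P$ be a stochastic matrix on a finite or countably infinite set $V$. Give each $v\in V$ an independent Poisson clock of rate $1$, let $X$ be the continuous-time Markov chain on $V$ that, whenever the clock of its current position $v$ rings, jumps from $v$ according to the row $P_{v\cdot}$ (its successive positions forming a discrete Markov chain with matrix $P$ independent of the clocks), and let $\mathcal F_t$ be the $\sigma$-algebra generated by the clock rings up to time $t$. The fragmentation process originating at $o\in V$ is $$m_t(o,v)=\mathbb P\big(X(t)=v \,\big|\, \mathcal F_t,\ X(0)=o\big),\qquad v\in V,\ t\ge 0 .$$ Let $0<\alpha<1$, $C_1>1$ and $C_0>0$. There exists $t_0=t_0(C_0,C_1,\alpha)$ such that the following holds for every such $V$ and $P$. Suppose that 1. $\sup_{u,v\in V} (P^k)_{uv}\le C_0k^{-1/2}$ for every integer $1\le k\le |V|^2$ (for every $k\ge 1$ if $V$ is infinite), and 2. $\mathbb E\big[\sum_{v\in V} m_t(o,v)^2\big]\le C_1t^{-\alpha}$ for every $o\in V$ and every $0<t\le |V|^2/3$ (every $t>0$ if $V$ is infinite). Then for every $o\in V$, every real $d\ge 2$ and every $t$ with $\max(t_0,d^{10/\alpha})\le t\le |V|^2/3$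 (no upper bound on $t$ if $V$ is infinite), $$\mathbb E\Big[\sum_{v\in V} m_t(o,v)^d\Big]\le t^{-\alpha d/10}.$$ -/

import Mathlib

open MeasureTheory ProbabilityTheory

namespace Fragmentation

noncomputable section

/-- The law of the discrete chain after `k` steps started at `u`: `stepLaw P k u v = (P ^ k) u v`.
A stochastic matrix on `V` is a family of rows `P u : PMF V`. -/
def stepLaw {V : Type*} (P : V → PMF V) : ℕ → V → PMF V
  | 0, u => PMF.pure u
  | k + 1, u => (P u).bind (stepLaw P k)

/-- Square root decay: `sup_{u,v} (P ^ k) u v ≤ C₀ k ^ (-1/2)` for all `1 ≤ k ≤ |V| ^ 2`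
(for all `k ≥ 1` if `V` is infinite). -/
def SqrtDecay {V : Type*} (P : V → PMF V) (C₀ : ℝ) : Prop :=
  ∀ k : ℕ, 1 ≤ k → (Finite V → k ≤ Nat.card V ^ 2) →
    ∀ u v : V, (stepLaw P k u v).toReal ≤ C₀ * (k : ℝ) ^ (-(1 / 2) : ℝ)

/-- The one-step kernel of the chain, as a function of the past `x 0, …, x n`. -/
def stepKernel {V : Type*} [Countable V] [MeasurableSpace V] [DiscreteMeasurableSpace V]
    (P : V → PMF V) (n : ℕ) : Kernel ((i : Finset.Iic n) → V) V :=
  (Kernel.ofFunOfCountable fun v => (P v).toMeasure).comap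
    (fun x => x ⟨n, Finset.mem_Iic.2 le_rfl⟩) (measurable_pi_apply _)

instance isMarkovKernel_stepKernel {V : Type*} [Countable V] [MeasurableSpace V] [DiscreteMeasurableSpace V]
    (P : V → PMF V) (n : ℕ) : IsMarkovKernel (stepKernel P n) := by
  have : IsMarkovKernel (Kernel.ofFunOfCountable fun v => (P v).toMeasure) :=
    ⟨fun v => PMF.toMeasure.isProbabilityMeasure (P v)⟩
  unfold stepKernel
  infer_instance

/-- The law on `ℕ → V` of the discrete-time Markov chain with transition matrix `P` from `o`. -/
def chainLaw {V : Type*} [Countable V] [MeasurableSpace V] [DiscreteMeasurableSpace V]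
    (P : V → PMF V) (o : V) : Measure (ℕ → V) :=
  Kernel.traj (X := fun _ => V) (stepKernel P) 0 (fun _ => o)

/-- The law of independent unit Poisson clocks on the vertices, each described by its gaps:
`ξ v k` is the waiting time between the `k`-th and the `(k+1)`-st ring at `v`; all the gaps are
independent exponential variables of rate one. -/
def clockLaw (V : Type*) : Measure (V → ℕ → ℝ) :=
  Measure.infinitePi fun _ => Measure.infinitePi fun _ => expMeasure 1

/-- Joint law of the clocks and of the (independent) discrete trajectory started at `o`. -/
def walkLaw {V : Type*} [Countable V] [MeasurableSpace V] [DiscreteMeasurableSpace V]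
    (P : V → PMF V) (o : V) : Measure ((V → ℕ → ℝ) × (ℕ → V)) :=
  (clockLaw V).prod (chainLaw P o)

/-- The time of the `(k+1)`-st ring of the clock at `v`. -/
def ringTime {V : Type*} (ξ : V → ℕ → ℝ) (v : V) (k : ℕ) : ℝ :=
  ∑ j ∈ Finset.range (k + 1), ξ v j

/-- The time at which the walk makes its `n`-th step (time `0` for `n = 0`): having arrived at
`p n`, it waits there for the next ring of the clock at `p n`. -/
def jumpTime {V : Type*} (ξ : V → ℕ → ℝ) (p : ℕ → V) : ℕ → ℝ
  | 0 => 0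
  | n + 1 => sInf {s : ℝ | jumpTime ξ p n < s ∧ ∃ k, ringTime ξ (p n) k = s}

/-- The continuous-time Markov chain `X(t)` driven by the clocks `ξ` along the trajectory `p`. -/
def position {V : Type*} (ξ : V → ℕ → ℝ) (p : ℕ → V) (t : ℝ) : V :=
  p (sSup {n : ℕ | jumpTime ξ p n ≤ t})

/-- The σ-algebra generated by the clock rings up to time `t`. -/
abbrev clockSigma (V : Type*) (t : ℝ) : MeasurableSpace ((V → ℕ → ℝ) × (ℕ → V)) :=
  MeasurableSpace.generateFrom
    {E | ∃ (v : V) (k : ℕ) (s : ℝ), s ≤ t ∧ E = {x | ringTime x.1 v k ≤ s}}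

/-- The fragmentation process originating at `o`:
`m_t(o, v) = ℙ(X(t) = v | clock rings up to time t, X(0) = o)`. -/
def mass {V : Type*} [Countable V] [MeasurableSpace V] [DiscreteMeasurableSpace V]
    (P : V → PMF V) (o : V) (t : ℝ) (v : V) : (V → ℕ → ℝ) × (ℕ → V) → ℝ :=
  (walkLaw P o)⟦{x | position x.1 x.2 t = v} | clockSigma V t⟧

/-- `𝔼[∑ v, m_t(o, v) ^ d]`, with values in `[0, ∞]`. -/
def moment {V : Type*} [Countable V] [MeasurableSpace V] [DiscreteMeasurableSpace V]
    (P : V → PMF V) (o : V) (t d : ℝ) : ENNReal :=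
  ∫⁻ x, ∑' v : V, ENNReal.ofReal (mass P o t v x) ^ d ∂(walkLaw P o)

end

end Fragmentation

/-! For an integer k, expanding the k-th power turns the moment into the probability that k walkers,
following independent trajectories but driven by the same clocks, all sit at one vertex at time t
(`lintegral_tsum_prod_quenched`). Were the step counts independent of the trajectories, square root
decay would bound this by a multiple of t^(-1/2) to the power k - 1. Sharing clocks correlates the
step counts with the trajectories only through collisions, and the second moment hypothesis makes
collisions rare.

This is quantified by uniformization. Fix the trajectories and run a Poisson process of rate k that
picks a uniform slot s at each ring; if walker s has the least label at its vertex, all walkers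
there step, otherwise nobody moves. Every occupied vertex then rings at rate one, so the step counts
have the right law (`indexLaw_eq_tsum`). That identity comes from the Markov property of the clocks
(`indexLaw_add`), a first order expansion for short times (`abs_indexLaw_sub_le`) and uniqueness for
the resulting finite linear ODE (`boxLaw_eq_exp`).

The number K j of choices of slot j is Poisson of mean t and does not involve the trajectories. The
step count of walker j minus K j is a martingale that moves only while j shares its vertex with a
smaller label. The expected number of such moments is at most of order k^2 t^(1-α), uniformly in the
starting points (`sum_stepMean_collide_le_of_horizon`), so Khasminskii's lemma
(`slotMean_iterate_le`) and a Cauchy-Schwarz type inequality (`trajSum_exp_le`) bound the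
exponential moments of the gap (`lintegral_trajSum_gapIncr_le`). With x = t^(α/20), all gaps stay
below R of order √t / x^6, up to a probability of order k exp(-x^3). The walker of least label has
no gap at all.

Hence, outside large deviation events, a meeting forces the trajectories to coincide at step counts
in a box of (2R+1)^(k-1) points around K. As K is independent of the trajectories, a union bound
gives ((2R+1) 2C₀/√t)^(k-1) (`lintegral_tsum_meet_le`), which is at most x^(-5(k-1)). For k ≥ 3 this
beats x^(-2(k+1)), and x^(-2d) = t^(-αd/10) is the target. A real d is rounded down to k; when k = 2
the second moment hypothesis suffices. -/

namespace Fragmentation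

noncomputable section

/-! ### A single Poisson clock, described by its gaps -/

instance isProbabilityMeasure_expMeasure_one : IsProbabilityMeasure (expMeasure 1) :=
  isProbabilityMeasure_expMeasure one_pos

/-- The law of the sequence of gaps of a unit Poisson clock. -/
def gapLaw : Measure (ℕ → ℝ) := Measure.infinitePi fun _ => expMeasure 1

instance isProbabilityMeasure_gapLaw : IsProbabilityMeasure gapLaw := by
  unfold gapLaw; infer_instance

/-- The sequence with head `e` and tail `η`. -/
def seqCons (e : ℝ) (η : ℕ → ℝ) : ℕ → ℝ
  | 0 => e
  | k + 1 => η k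

lemma measurable_seqCons : Measurable fun q : ℝ × (ℕ → ℝ) => seqCons q.1 q.2 := by
  refine measurable_pi_lambda _ fun k => ?_
  cases k with
  | zero => exact measurable_fst
  | succ k => exact (measurable_pi_apply k).comp measurable_snd

/-- Peeling off the first gap leaves an independent copy of the sequence; this drives the induction
on the number of rings below. -/
lemma gapLaw_eq_map_seqCons :
    ((expMeasure 1).prod gapLaw).map (fun q => seqCons q.1 q.2) = gapLaw := by
  refine Measure.eq_infinitePi _ fun s t ht => ?_
  classical
  set t' : ℕ → Set ℝ := fun i => if i ∈ s then t i else Set.univ with ht'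
  have mt' : ∀ i, MeasurableSet (t' i) := fun i => by
    simp only [ht']; split_ifs; exacts [ht i, .univ]
  obtain ⟨n, hn⟩ : ∃ n, s ⊆ Finset.range (n + 1) := by
    refine ⟨s.sup id, fun i hi => ?_⟩
    exact Finset.mem_range.2 (Nat.lt_succ_of_le (Finset.le_sup (f := id) hi))
  have h1 : Set.pi (s : Set ℕ) t = Set.pi (Finset.range (n + 1) : Set ℕ) t' := by
    ext x
    simp only [Set.mem_pi, ht']
    constructor
    · intro h i _
      split_ifs with hi
      · exact h i hi
      · trivial
    · intro h i hi
      have := h i (hn hi)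
      rwa [if_pos (by exact hi)] at this
  have h2 : ∏ i ∈ s, expMeasure 1 (t i) = ∏ i ∈ Finset.range (n + 1), expMeasure 1 (t' i) := by
    rw [← Finset.prod_subset hn]
    · exact Finset.prod_congr rfl fun i hi => by simp [ht', hi]
    · intro i _ hi
      simp [ht', hi]
  have h3 : (fun q : ℝ × (ℕ → ℝ) => seqCons q.1 q.2) ⁻¹' Set.pi (Finset.range (n + 1) : Set ℕ) t' =
      t' 0 ×ˢ Set.pi (Finset.range n : Set ℕ) fun i => t' (i + 1) := by
    ext ⟨e, η⟩
    simp only [Set.mem_preimage, Set.mem_pi, Set.mem_prod, Finset.coe_range, Set.mem_Iio]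
    constructor
    · intro h
      exact ⟨h 0 (by omega), fun i hi => h (i + 1) (by omega)⟩
    · rintro ⟨h0, h⟩ i hi
      cases i with
      | zero => exact h0
      | succ i => exact h i (by omega)
  rw [h1, h2, Measure.map_apply measurable_seqCons
    (MeasurableSet.pi (Finset.countable_toSet _) fun i _ => mt' i), h3, Measure.prod_prod,
    gapLaw, Measure.infinitePi_pi _ (fun i _ => mt' _), Finset.prod_range_succ', mul_comm]

lemma expMeasure_Ioi {s : ℝ} (hs : 0 ≤ s) : expMeasure 1 (Set.Ioi s) = ENNReal.ofReal (Real.exp (-s)) := by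
  have h := cdf_expMeasure_eq one_pos s
  rw [if_pos hs, one_mul, cdf_eq_real] at h
  rw [← Set.compl_Iic, ← ofReal_measureReal, measureReal_compl measurableSet_Iic, h]
  simp

lemma expMeasure_Iic {s : ℝ} (hs : 0 ≤ s) :
    expMeasure 1 (Set.Iic s) = ENNReal.ofReal (1 - Real.exp (-s)) := by
  have h := cdf_expMeasure_eq one_pos s
  rw [if_pos hs, one_mul, cdf_eq_real] at h
  rw [← ofReal_measureReal, h]

/-- Memorylessness of the exponential law. -/
lemma lintegral_expMeasure_shift {s : ℝ} (hs : 0 ≤ s) {g : ℝ → ENNReal} (hg : Measurable g) :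
    ∫⁻ e in Set.Ioi s, g (e - s) ∂(expMeasure 1) =
      expMeasure 1 (Set.Ioi s) * ∫⁻ e, g e ∂(expMeasure 1) := by
  have hE : expMeasure 1 = volume.withDensity (exponentialPDF 1) := rfl
  have hm : Measurable (exponentialPDF 1) := (measurable_exponentialPDFReal 1).ennreal_ofReal
  have hpos : ∀ f : ℝ → ENNReal, Measurable f →
      ∫⁻ e, f e ∂(expMeasure 1) = ∫⁻ e, (Set.Ioi (0 : ℝ)).indicator
        (fun e => ENNReal.ofReal (Real.exp (-e)) * f e) e := by
    intro f hf
    rw [hE, lintegral_withDensity_eq_lintegral_mul _ hm hf]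
    refine lintegral_congr_ae ?_
    -- The density equals 1 at the origin while the indicator of the open half-line vanishes there,
    -- so this null point is discarded.
    have h0 : ∀ᵐ e : ℝ, e ≠ 0 := by simp [ae_iff]
    filter_upwards [h0] with e he
    rcases lt_or_gt_of_ne he with h | h
    · simp [exponentialPDF_of_neg h, h.le]
    · simp [exponentialPDF_of_nonneg h.le, h]
  rw [expMeasure_Ioi hs, ← lintegral_indicator measurableSet_Ioi,
    hpos ((Set.Ioi s).indicator fun e => g (e - s))
      ((hg.comp (measurable_id.sub_const s)).indicator measurableSet_Ioi), hpos _ hg,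
    ← lintegral_add_right_eq_self _ s, ← lintegral_const_mul]
  · refine lintegral_congr fun e => ?_
    by_cases he : 0 < e
    · have : 0 < e + s := by linarith
      simp only [Set.indicator, Set.mem_Ioi, this, he, if_true, lt_add_iff_pos_left, add_sub_cancel_right]
      rw [← mul_assoc, ← ENNReal.ofReal_mul (Real.exp_nonneg _), ← Real.exp_add]
      congr 3; ring
    · simp [Set.indicator, he]
  · exact ((measurable_id.neg.exp.ennreal_ofReal).mul hg).indicator measurableSet_Ioi

/-- The time of the `(k+1)`-st ring of a clock with gaps `η`. -/
def partialSum (η : ℕ → ℝ) (k : ℕ) : ℝ := ∑ j ∈ Finset.range (k + 1), η j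

@[simp] lemma partialSum_zero (η : ℕ → ℝ) : partialSum η 0 = η 0 := by simp [partialSum]

lemma partialSum_succ (η : ℕ → ℝ) (k : ℕ) : partialSum η (k + 1) = partialSum η k + η (k + 1) := by
  simp [partialSum, Finset.sum_range_succ _ (k + 1)]

@[simp] lemma partialSum_seqCons_zero (e : ℝ) (η : ℕ → ℝ) : partialSum (seqCons e η) 0 = e := by
  simp [seqCons]

@[simp] lemma partialSum_seqCons_succ (e : ℝ) (η : ℕ → ℝ) (k : ℕ) :
    partialSum (seqCons e η) (k + 1) = e + partialSum η k := by
  rw [partialSum, Finset.sum_range_succ', add_comm]; rfl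

lemma measurable_partialSum (k : ℕ) : Measurable fun η => partialSum η k :=
  Finset.measurable_sum _ fun j _ => measurable_pi_apply j

/-- The clock with gaps `η` rings exactly `n` times up to time `s`. -/
def RingsBy (s : ℝ) (η : ℕ → ℝ) (n : ℕ) : Prop :=
  (∀ k < n, partialSum η k ≤ s) ∧ s < partialSum η n

lemma measurableSet_ringsBy (s : ℝ) (n : ℕ) : MeasurableSet {η | RingsBy s η n} := by
  have : {η | RingsBy s η n} =
      (⋂ k, ⋂ (_ : k < n), {η | partialSum η k ≤ s}) ∩ {η | s < partialSum η n} := by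
    ext η; simp [RingsBy]
  rw [this]
  exact (MeasurableSet.iInter fun k => MeasurableSet.iInter fun _ =>
    measurableSet_le (measurable_partialSum k) measurable_const).inter
    (measurableSet_lt measurable_const (measurable_partialSum n))

/-- The ring times up to the `n`-th one, the others being replaced by `s + 1`. -/
def pastOf (n : ℕ) (s : ℝ) (η : ℕ → ℝ) : ℕ → ℝ :=
  fun k => if k < n then partialSum η k else s + 1

/-- The gaps of the clock seen from time `s`, when it rings `n` times before. -/
def residualOf (n : ℕ) (s : ℝ) (η : ℕ → ℝ) : ℕ → ℝ :=
  fun k => if k = 0 then partialSum η n - s else η (n + k)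

lemma measurable_pastOf (n : ℕ) (s : ℝ) : Measurable (pastOf n s) := by
  refine measurable_pi_lambda _ fun k => ?_
  unfold pastOf
  split_ifs
  · exact measurable_partialSum k
  · exact measurable_const

lemma measurable_residualOf (n : ℕ) (s : ℝ) : Measurable (residualOf n s) := by
  refine measurable_pi_lambda _ fun k => ?_
  unfold residualOf
  split_ifs
  · exact (measurable_partialSum n).sub_const s
  · exact measurable_pi_apply _

lemma ringsBy_zero_seqCons (s e : ℝ) (η : ℕ → ℝ) : RingsBy s (seqCons e η) 0 ↔ s < e := by
  simp [RingsBy, seqCons]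

lemma ringsBy_succ_seqCons (s e : ℝ) (η : ℕ → ℝ) (n : ℕ) :
    RingsBy s (seqCons e η) (n + 1) ↔ e ≤ s ∧ RingsBy (s - e) η n := by
  simp only [RingsBy, partialSum_seqCons_succ, Nat.forall_lt_succ_left', partialSum_seqCons_zero,
    le_sub_iff_add_le', sub_lt_iff_lt_add', and_assoc]

lemma pastOf_succ_seqCons (n : ℕ) (s e : ℝ) (η : ℕ → ℝ) :
    pastOf (n + 1) s (seqCons e η) = seqCons e fun k => e + pastOf n (s - e) η k := by
  funext k
  cases k with
  | zero => simp [pastOf, seqCons]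
  | succ k =>
    simp only [pastOf, seqCons, partialSum_seqCons_succ, Nat.add_lt_add_iff_right]
    split_ifs
    · rfl
    · ring

lemma residualOf_succ_seqCons (n : ℕ) (s e : ℝ) (η : ℕ → ℝ) :
    residualOf (n + 1) s (seqCons e η) = residualOf n (s - e) η := by
  funext k
  simp only [residualOf, partialSum_seqCons_succ]
  split_ifs
  · ring
  · rw [show n + 1 + k = (n + k) + 1 by ring]; rfl

lemma residualOf_zero_seqCons (s e : ℝ) (η : ℕ → ℝ) :
    residualOf 0 s (seqCons e η) = seqCons (e - s) η := by
  funext k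
  cases k with
  | zero => simp [residualOf, seqCons]
  | succ k => simp [residualOf, seqCons]

lemma gapLaw_apply {S : Set (ℕ → ℝ)} (hS : MeasurableSet S) :
    gapLaw S = ∫⁻ e, gapLaw {η | seqCons e η ∈ S} ∂(expMeasure 1) := by
  conv_lhs => rw [← gapLaw_eq_map_seqCons]
  rw [Measure.map_apply measurable_seqCons hS, Measure.prod_apply (measurable_seqCons hS)]
  rfl

/-- Induction on the number of rings. With no ring before s, the past is constant and the residual
first gap is exponential by memorylessness. Otherwise, conditioning on the first gap e ≤ s reduces
to one ring fewer before time s - e. -/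
lemma gapLaw_ringsBy_past_residual (n : ℕ) {s : ℝ} (hs : 0 ≤ s) {A B : Set (ℕ → ℝ)}
    (hA : MeasurableSet A) (hB : MeasurableSet B) :
    gapLaw {η | RingsBy s η n ∧ pastOf n s η ∈ A ∧ residualOf n s η ∈ B} =
      gapLaw {η | RingsBy s η n ∧ pastOf n s η ∈ A} * gapLaw B := by
  induction n generalizing s A with
  | zero =>
    have hp : ∀ η, pastOf 0 s η = fun _ => s + 1 := fun η => by funext k; simp [pastOf]
    simp only [hp]
    by_cases hsA : (fun _ => s + 1) ∈ A
    · have hR := measurableSet_ringsBy s 0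
      simp only [hsA, true_and, and_true]
      have r1 : {η | RingsBy s η 0 ∧ residualOf 0 s η ∈ B} =
          {η | RingsBy s η 0} ∩ residualOf 0 s ⁻¹' B := rfl
      rw [r1, gapLaw_apply (hR.inter (measurable_residualOf 0 s hB)), gapLaw_apply hR]
      have e1 : ∀ e : ℝ, gapLaw {η | seqCons e η ∈ {η | RingsBy s η 0} ∩ residualOf 0 s ⁻¹' B} =
          (Set.Ioi s).indicator (fun e => gapLaw {η | seqCons (e - s) η ∈ B}) e := by
        intro e
        simp only [Set.mem_inter_iff, Set.mem_ofPred_eq, ringsBy_zero_seqCons, Set.mem_preimage,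
          residualOf_zero_seqCons, Set.indicator, Set.mem_Ioi]
        split_ifs with h <;> simp [h]
      have e2 : ∀ e : ℝ, gapLaw {η | seqCons e η ∈ {η | RingsBy s η 0}} =
          (Set.Ioi s).indicator (fun _ => 1) e := by
        intro e
        simp only [Set.mem_ofPred_eq, ringsBy_zero_seqCons, Set.indicator, Set.mem_Ioi]
        split_ifs with h <;> simp [h]
      have hmB : Measurable fun e => gapLaw {η | seqCons e η ∈ B} :=
        measurable_measure_prodMk_left (measurable_seqCons hB)
      simp_rw [e1, e2]
      rw [lintegral_indicator measurableSet_Ioi, lintegral_indicator measurableSet_Ioi,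
        lintegral_expMeasure_shift hs hmB, ← gapLaw_apply hB]
      simp
    · simp [hsA]
  | succ n ih =>
    have m1 := (measurableSet_ringsBy s (n + 1)).inter (measurable_pastOf (n + 1) s hA)
    have m2 := m1.inter (measurable_residualOf (n + 1) s hB)
    have r1 : {η | RingsBy s η (n + 1) ∧ pastOf (n + 1) s η ∈ A ∧ residualOf (n + 1) s η ∈ B} =
        ({η | RingsBy s η (n + 1)} ∩ pastOf (n + 1) s ⁻¹' A) ∩ residualOf (n + 1) s ⁻¹' B := by
      ext; simp [and_assoc]
    have r2 : {η | RingsBy s η (n + 1) ∧ pastOf (n + 1) s η ∈ A} =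
        {η | RingsBy s η (n + 1)} ∩ pastOf (n + 1) s ⁻¹' A := rfl
    rw [r1, r2, gapLaw_apply m2, gapLaw_apply m1, ← lintegral_mul_const']
    · refine lintegral_congr fun e => ?_
      simp only [Set.mem_inter_iff, Set.mem_ofPred_eq, Set.mem_preimage, ringsBy_succ_seqCons,
        pastOf_succ_seqCons, residualOf_succ_seqCons]
      by_cases he : e ≤ s
      · have hA' : MeasurableSet {a : ℕ → ℝ | (seqCons e fun k => e + a k) ∈ A} := by
          have : Measurable fun a : ℕ → ℝ => seqCons e fun k => e + a k :=
            measurable_seqCons.comp (f := fun a : ℕ → ℝ => (e, fun k => e + a k))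
              (measurable_const.prodMk
              (measurable_pi_lambda _ fun k => measurable_const.add (measurable_pi_apply k)))
          exact this hA
        have := ih (sub_nonneg.2 he) hA'
        simpa only [he, true_and, and_assoc, Set.mem_ofPred_eq] using this
      · simp [he]
    · exact measure_ne_top _ _

/-- A clock with positive gaps that rings infinitely often but finitely often in bounded time. -/
def GoodGaps (η : ℕ → ℝ) : Prop := (∀ k, 0 < η k) ∧ ∀ s, ∃ k, s < partialSum η k

lemma expMeasure_Iic_zero : expMeasure 1 (Set.Iic 0) = 0 := by
  rw [expMeasure_Iic le_rfl]; simp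

/-- Ring times diverge because single gaps are already unbounded: n gaps are all at most m with
probability (1 - exp(-m))^n, which tends to zero. -/
lemma ae_goodGaps : ∀ᵐ η ∂gapLaw, GoodGaps η := by
  have hpos : ∀ᵐ η ∂gapLaw, ∀ k, 0 < η k := by
    rw [ae_all_iff]
    intro k
    have : gapLaw.map (fun η => η k) = expMeasure 1 := Measure.infinitePi_map_eval _ k
    have h0 : ∀ᵐ e ∂(expMeasure 1), 0 < e := by
      rw [ae_iff]
      simpa [Set.Iic] using expMeasure_Iic_zero
    rw [← this] at h0
    exact ae_of_ae_map (measurable_pi_apply k).aemeasurable h0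
  have hunb : ∀ᵐ η ∂gapLaw, ∀ m : ℕ, ∃ k, (m : ℝ) < η k := by
    rw [ae_all_iff]
    intro m
    rw [ae_iff]
    have hlt : ENNReal.ofReal (1 - Real.exp (-(m : ℝ))) < 1 := by
      rw [← ENNReal.ofReal_one, ENNReal.ofReal_lt_ofReal_iff one_pos]
      linarith [Real.exp_pos (-(m : ℝ))]
    have hle : ∀ n : ℕ, gapLaw {η | ¬ ∃ k, (m : ℝ) < η k} ≤
        ENNReal.ofReal (1 - Real.exp (-(m : ℝ))) ^ n := by
      intro n
      have : {η : ℕ → ℝ | ¬ ∃ k, (m : ℝ) < η k} ⊆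
          Set.pi (Finset.range n : Set ℕ) fun _ => Set.Iic (m : ℝ) := by
        intro η h i _
        simp only [not_exists, not_lt, Set.mem_ofPred_eq] at h
        exact h i
      refine (measure_mono this).trans ?_
      rw [gapLaw, Measure.infinitePi_pi _ (fun i _ => measurableSet_Iic), Finset.prod_const,
        Finset.card_range, expMeasure_Iic (Nat.cast_nonneg m)]
    exact le_antisymm (ge_of_tendsto' (ENNReal.tendsto_pow_atTop_nhds_zero_of_lt_one hlt) hle)
      (zero_le)
  filter_upwards [hpos, hunb] with η h1 h2
  refine ⟨h1, fun s => ?_⟩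
  obtain ⟨m, hm⟩ := exists_nat_ge s
  obtain ⟨k, hk⟩ := h2 m
  refine ⟨k, hm.trans_lt (hk.trans_le ?_)⟩
  exact Finset.single_le_sum (f := η) (fun j _ => (h1 j).le) (Finset.self_mem_range_succ k)

/-- The number of rings up to time `s`. -/
def ringCount (s : ℝ) (η : ℕ → ℝ) : ℕ := sInf {k | s < partialSum η k}

lemma RingsBy.ringCount_eq {s : ℝ} {η : ℕ → ℝ} {n : ℕ} (h : RingsBy s η n) :
    ringCount s η = n := by
  refine le_antisymm (Nat.sInf_le h.2) (le_csInf ⟨n, h.2⟩ fun k hk => ?_)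
  by_contra hkn
  exact absurd (h.1 k (not_le.1 hkn)) (not_le.2 hk)

lemma ringsBy_ringCount {s : ℝ} {η : ℕ → ℝ} (h : ∃ k, s < partialSum η k) :
    RingsBy s η (ringCount s η) :=
  ⟨fun _ hk => not_lt.1 (Nat.notMem_of_lt_sInf hk), Nat.sInf_mem h⟩

lemma measurable_ringCount (s : ℝ) : Measurable (ringCount s) := by
  refine measurable_to_countable' fun n => ?_
  -- The second piece accounts for the default value: if no ring comes after s, the infimum of the
  -- empty set is 0.
  have : ringCount s ⁻¹' {n} =
      {η | RingsBy s η n} ∪ ({η | (∀ k, ¬ s < partialSum η k)} ∩ {_η | n = 0}) := by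
    ext η
    simp only [Set.mem_preimage, Set.mem_singleton_iff, Set.mem_union, Set.mem_ofPred_eq,
      Set.mem_inter_iff]
    constructor
    · rintro rfl
      by_cases h : ∃ k, s < partialSum η k
      · exact Or.inl (ringsBy_ringCount h)
      · right
        push Not at h
        refine ⟨fun k => not_lt.2 (h k), ?_⟩
        have : {k | s < partialSum η k} = ∅ := by ext k; simp [h k]
        simp [ringCount, this]
    · rintro (h | ⟨h, rfl⟩)
      · exact h.ringCount_eq
      · have : {k | s < partialSum η k} = ∅ := by ext k; simpa using h k
        simp [ringCount, this]
  rw [this]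
  refine (measurableSet_ringsBy s n).union (MeasurableSet.inter ?_ (MeasurableSet.const _))
  have : {η | (∀ k, ¬ s < partialSum η k)} = ⋂ k, {η | s < partialSum η k}ᶜ := by ext; simp
  rw [this]
  exact MeasurableSet.iInter fun k =>
    (measurableSet_lt measurable_const (measurable_partialSum k)).compl

/-- The rings up to time `s`, later ones being replaced by `s + 1`. -/
def past (s : ℝ) (η : ℕ → ℝ) : ℕ → ℝ := pastOf (ringCount s η) s η

/-- The gaps of the clock restarted at time `s`. -/
def residual (s : ℝ) (η : ℕ → ℝ) : ℕ → ℝ := residualOf (ringCount s η) s η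

lemma measurable_past (s : ℝ) : Measurable (past s) :=
  (measurable_from_prod_countable_right (f := fun q : ℕ × (ℕ → ℝ) => pastOf q.1 s q.2)
    fun n => measurable_pastOf n s).comp ((measurable_ringCount s).prodMk measurable_id)

lemma measurable_residual (s : ℝ) : Measurable (residual s) :=
  (measurable_from_prod_countable_right (f := fun q : ℕ × (ℕ → ℝ) => residualOf q.1 s q.2)
    fun n => measurable_residualOf n s).comp ((measurable_ringCount s).prodMk measurable_id)

/-- The clock restarted at time `s` is a Poisson clock independent of the rings before `s`. -/
lemma gapLaw_past_residual {s : ℝ} (hs : 0 ≤ s) {A B : Set (ℕ → ℝ)}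
    (hA : MeasurableSet A) (hB : MeasurableSet B) :
    gapLaw {η | past s η ∈ A ∧ residual s η ∈ B} = gapLaw {η | past s η ∈ A} * gapLaw B := by
  have key : ∀ S : Set (ℕ → ℝ), MeasurableSet S →
      gapLaw S = ∑' n, gapLaw (S ∩ {η | RingsBy s η n}) := by
    intro S hS
    rw [← measure_iUnion]
    · refine measure_congr ?_
      filter_upwards [ae_goodGaps] with η hη
      refine propext ⟨fun h => ?_, fun h => ?_⟩
      · exact Set.mem_iUnion.2 ⟨_, h, ringsBy_ringCount (hη.2 s)⟩
      · obtain ⟨n, hn⟩ := Set.mem_iUnion.1 h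
        exact hn.1
    · intro n m hnm
      refine Set.disjoint_left.2 fun η h1 h2 => hnm ?_
      rw [← h1.2.ringCount_eq, h2.2.ringCount_eq]
    · exact fun n => hS.inter (measurableSet_ringsBy s n)
  have m1 : MeasurableSet {η | past s η ∈ A} := measurable_past s hA
  have m2 : MeasurableSet {η | past s η ∈ A ∧ residual s η ∈ B} :=
    m1.inter (measurable_residual s hB)
  rw [key _ m2, key _ m1, ← ENNReal.tsum_mul_right]
  refine tsum_congr fun n => ?_
  have e1 : {η | past s η ∈ A ∧ residual s η ∈ B} ∩ {η | RingsBy s η n} =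
      {η | RingsBy s η n ∧ pastOf n s η ∈ A ∧ residualOf n s η ∈ B} := by
    ext η
    simp only [Set.mem_inter_iff, Set.mem_ofPred_eq, past, residual]
    constructor
    · rintro ⟨h1, h2⟩; rw [h2.ringCount_eq] at h1; exact ⟨h2, h1⟩
    · rintro ⟨h2, h1⟩; rw [h2.ringCount_eq]; exact ⟨h1, h2⟩
  have e2 : {η | past s η ∈ A} ∩ {η | RingsBy s η n} =
      {η | RingsBy s η n ∧ pastOf n s η ∈ A} := by
    ext η
    simp only [Set.mem_inter_iff, Set.mem_ofPred_eq, past]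
    constructor
    · rintro ⟨h1, h2⟩; rw [h2.ringCount_eq] at h1; exact ⟨h2, h1⟩
    · rintro ⟨h2, h1⟩; rw [h2.ringCount_eq]; exact ⟨h1, h2⟩
  rw [e1, e2, gapLaw_ringsBy_past_residual n hs hA hB]

/-! ### The family of clocks, restarted at a deterministic time -/

section Clocks

variable {V : Type*}

instance isProbabilityMeasure_clockLaw : IsProbabilityMeasure (clockLaw V) := by
  unfold clockLaw; infer_instance

/-- The rings of all the clocks up to time `s`, later ones being replaced by `s + 1`. -/
def allPast (s : ℝ) (ξ : V → ℕ → ℝ) : V → ℕ → ℝ := fun v => past s (ξ v)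

/-- The gaps of all the clocks restarted at time `s`. -/
def restart (s : ℝ) (ξ : V → ℕ → ℝ) : V → ℕ → ℝ := fun v => residual s (ξ v)

lemma measurable_allPast (s : ℝ) : Measurable (allPast s : (V → ℕ → ℝ) → _) :=
  measurable_pi_lambda _ fun v => (measurable_past s).comp (measurable_pi_apply v)

lemma measurable_restart (s : ℝ) : Measurable (restart s : (V → ℕ → ℝ) → _) :=
  measurable_pi_lambda _ fun v => (measurable_residual s).comp (measurable_pi_apply v)

lemma gapLaw_map_residual {s : ℝ} (hs : 0 ≤ s) : gapLaw.map (residual s) = gapLaw := by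
  ext B hB
  rw [Measure.map_apply (measurable_residual s) hB]
  have := gapLaw_past_residual hs MeasurableSet.univ hB
  simp only [Set.mem_univ, true_and, Set.ofPred_true, measure_univ, one_mul] at this
  exact this

lemma clockLaw_map_restart {s : ℝ} (hs : 0 ≤ s) :
    (clockLaw V).map (restart s) = clockLaw V := by
  have := Measure.infinitePi_map_pi (μ := fun _ : V => gapLaw)
    (f := fun _ => residual s) (fun _ => measurable_residual s)
  simp only [gapLaw_map_residual hs] at this
  exact this

lemma clockLaw_pi (S : Finset V) {t : V → Set (ℕ → ℝ)} (ht : ∀ v, MeasurableSet (t v)) :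
    clockLaw V (Set.pi (S : Set V) t) = ∏ v ∈ S, gapLaw (t v) :=
  Measure.infinitePi_pi _ fun v _ => ht v

/-- Cylinders with measurable sides form a generating π-system, and on them the claim factors over
the vertices into the single-clock statement `gapLaw_past_residual`. -/
lemma indep_allPast_restart {s : ℝ} (hs : 0 ≤ s) :
    IndepFun (allPast s) (restart s) (clockLaw V) := by
  set C : Set (Set (V → ℕ → ℝ)) :=
    squareCylinders fun _ : V => {t : Set (ℕ → ℝ) | MeasurableSet t} with hC
  have hCpi : IsPiSystem C :=
    isPiSystem_squareCylinders (fun _ => MeasurableSpace.isPiSystem_measurableSet)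
      fun _ => Set.mem_ofPred_eq ▸ MeasurableSet.univ
  have hgen : MeasurableSpace.generateFrom C = MeasurableSpace.pi := generateFrom_squareCylinders
  refine IndepSets.indep (p1 := {t | ∃ u ∈ C, allPast s ⁻¹' u = t})
    (p2 := {t | ∃ u ∈ C, restart s ⁻¹' u = t})
    (measurable_allPast s).comap_le (measurable_restart s).comap_le
    (hCpi.comap _) (hCpi.comap _) ?_ ?_ ?_
  · rw [← hgen, MeasurableSpace.comap_generateFrom]; rfl
  · rw [← hgen, MeasurableSpace.comap_generateFrom]; rfl
  rw [IndepSets_iff]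
  rintro _ _ ⟨_, hu, rfl⟩ ⟨_, hu', rfl⟩
  obtain ⟨S₁, a, ha, rfl⟩ := hu
  obtain ⟨S₂, b, hb, rfl⟩ := hu'
  replace ha : ∀ v, MeasurableSet (a v) := fun v => ha v trivial
  replace hb : ∀ v, MeasurableSet (b v) := fun v => hb v trivial
  classical
  -- Both cylinders are padded with full sides so that they are based on the same finite set of
  -- vertices.
  set a' : V → Set (ℕ → ℝ) := fun v => if v ∈ S₁ then a v else Set.univ with ha'
  set b' : V → Set (ℕ → ℝ) := fun v => if v ∈ S₂ then b v else Set.univ with hb'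
  have ma : ∀ v, MeasurableSet (a' v) := fun v => by
    simp only [ha']; split_ifs with h; exacts [ha v, .univ]
  have mb : ∀ v, MeasurableSet (b' v) := fun v => by
    simp only [hb']; split_ifs with h; exacts [hb v, .univ]
  have e1 : allPast s ⁻¹' (Set.pi (S₁ : Set V) a) =
      Set.pi ((S₁ ∪ S₂ : Finset V) : Set V) fun v => past s ⁻¹' a' v := by
    ext ξ
    simp only [Set.mem_preimage, Set.mem_pi, Finset.coe_union, Set.mem_union, Finset.mem_coe, ha',
      allPast]
    constructor
    · intro h v _
      split_ifs with hv
      exacts [h v hv, trivial]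
    · intro h v hv
      simpa [hv] using h v (Or.inl hv)
  have e2 : restart s ⁻¹' (Set.pi (S₂ : Set V) b) =
      Set.pi ((S₁ ∪ S₂ : Finset V) : Set V) fun v => residual s ⁻¹' b' v := by
    ext ξ
    simp only [Set.mem_preimage, Set.mem_pi, Finset.coe_union, Set.mem_union, Finset.mem_coe, hb',
      restart]
    constructor
    · intro h v _
      split_ifs with hv
      exacts [h v hv, trivial]
    · intro h v hv
      simpa [hv] using h v (Or.inr hv)
  rw [e1, e2, ← Set.pi_inter_distrib, clockLaw_pi _ fun v => measurable_past s (ma v),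
    clockLaw_pi _ fun v => measurable_residual s (mb v),
    clockLaw_pi _ fun v => (measurable_past s (ma v)).inter (measurable_residual s (mb v)),
    ← Finset.prod_mul_distrib]
  refine Finset.prod_congr rfl fun v _ => ?_
  have h1 : gapLaw (residual s ⁻¹' b' v) = gapLaw (b' v) := by
    rw [← Measure.map_apply (measurable_residual s) (mb v), gapLaw_map_residual hs]
  rw [h1]
  exact gapLaw_past_residual hs (ma v) (mb v)

/-- Markov property of the clocks: after a deterministic time they restart afresh. -/
lemma clockLaw_allPast_restart {s : ℝ} (hs : 0 ≤ s) {A B : Set (V → ℕ → ℝ)}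
    (hA : MeasurableSet A) (hB : MeasurableSet B) :
    clockLaw V {ξ | allPast s ξ ∈ A ∧ restart s ξ ∈ B} =
      clockLaw V {ξ | allPast s ξ ∈ A} * clockLaw V B := by
  have h := (indep_allPast_restart (V := V) hs).measure_inter_preimage_eq_mul _ _ hA hB
  rw [← Measure.map_apply (measurable_restart s) hB, clockLaw_map_restart hs] at h
  exact h

/-- All the clocks have positive gaps, ring infinitely often, but finitely often in bounded
time. -/
def GoodClocks (ξ : V → ℕ → ℝ) : Prop := ∀ v, GoodGaps (ξ v)

lemma ae_goodClocks [Countable V] : ∀ᵐ ξ ∂(clockLaw V), GoodClocks ξ := by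
  refine ae_all_iff.2 fun v => ?_
  have h : (clockLaw V).map (fun ξ => ξ v) = gapLaw :=
    Measure.infinitePi_map_eval (fun _ : V => gapLaw) v
  have := ae_goodGaps
  rw [← h] at this
  exact ae_of_ae_map (measurable_pi_apply v).aemeasurable this

end Clocks

/-! ### Jump times -/

section Jumps

variable {V : Type*}

/-- The jump times along the trajectory `p`, when the rings at `v` occur at the times `T v k`. -/
def hitTime (T : V → ℕ → ℝ) (p : ℕ → V) : ℕ → ℝ
  | 0 => 0
  | n + 1 => sInf {s : ℝ | hitTime T p n < s ∧ ∃ k, T (p n) k = s}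

lemma jumpTime_eq_hitTime (ξ : V → ℕ → ℝ) (p : ℕ → V) :
    jumpTime ξ p = hitTime (ringTime ξ) p := by
  funext n
  induction n with
  | zero => rfl
  | succ n ih => rw [jumpTime, hitTime, ih]

/-- At time `t`, the walk along `p` has made exactly `n` steps. -/
def IsAt (ξ : V → ℕ → ℝ) (p : ℕ → V) (n : ℕ) (t : ℝ) : Prop :=
  jumpTime ξ p n ≤ t ∧ t < jumpTime ξ p (n + 1)

lemma GoodGaps.strictMono {η : ℕ → ℝ} (h : GoodGaps η) : StrictMono (partialSum η) :=
  strictMono_nat_of_lt_succ fun k => by rw [partialSum_succ]; linarith [h.1 (k + 1)]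

lemma GoodGaps.exists_isLeast {η : ℕ → ℝ} (h : GoodGaps η) (a : ℝ) :
    ∃ m, IsLeast {s : ℝ | a < s ∧ ∃ k, partialSum η k = s} (partialSum η m) := by
  classical
  refine ⟨Nat.find (h.2 a), ⟨Nat.find_spec (h.2 a), _, rfl⟩, ?_⟩
  rintro _ ⟨hk, k, rfl⟩
  exact h.strictMono.monotone (Nat.find_min' _ hk)

/-- Ring times increase strictly to infinity, so the infimum defining a jump time is attained. Jump
times are from here on handled as least elements. -/
lemma GoodClocks.isLeast_jumpTime {ξ : V → ℕ → ℝ} (h : GoodClocks ξ) (p : ℕ → V) (n : ℕ) :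
    IsLeast {s : ℝ | jumpTime ξ p n < s ∧ ∃ k, ringTime ξ (p n) k = s} (jumpTime ξ p (n + 1)) := by
  obtain ⟨m, hm⟩ := (h (p n)).exists_isLeast (jumpTime ξ p n)
  have : jumpTime ξ p (n + 1) = partialSum (ξ (p n)) m := hm.csInf_eq
  rw [this]
  exact hm

lemma GoodClocks.strictMono_jumpTime {ξ : V → ℕ → ℝ} (h : GoodClocks ξ) (p : ℕ → V) :
    StrictMono (jumpTime ξ p) :=
  strictMono_nat_of_lt_succ fun n => (h.isLeast_jumpTime p n).1.1

lemma IsAt.unique {ξ : V → ℕ → ℝ} (h : GoodClocks ξ) {p : ℕ → V} {m n : ℕ} {t : ℝ}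
    (hm : IsAt ξ p m t) (hn : IsAt ξ p n t) : m = n := by
  have hmono := (h.strictMono_jumpTime p).monotone
  rcases lt_trichotomy m n with hlt | rfl | hlt
  · exact absurd ((hmono (Nat.succ_le_of_lt hlt)).trans hn.1) (not_le.2 hm.2)
  · rfl
  · exact absurd ((hmono (Nat.succ_le_of_lt hlt)).trans hm.1) (not_le.2 hn.2)

/-- The step count at s is the first m whose next jump comes after s; the jump n + 1 shows that
there is one. -/
lemma IsAt.exists_le {ξ : V → ℕ → ℝ} {p : ℕ → V} {n : ℕ} {s t : ℝ}
    (hs : 0 ≤ s) (hst : s ≤ t) (hn : IsAt ξ p n t) : ∃ m ≤ n, IsAt ξ p m s := by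
  classical
  have hex : ∃ m, s < jumpTime ξ p (m + 1) := ⟨n, hst.trans_lt hn.2⟩
  refine ⟨Nat.find hex, Nat.find_min' _ (hst.trans_lt hn.2), ?_, Nat.find_spec hex⟩
  rcases hm : Nat.find hex with _ | m
  · exact hs
  · exact not_lt.1 (Nat.find_min hex (m := m) (by omega))

/-! #### Restarting -/

lemma partialSum_residualOf (n : ℕ) (s : ℝ) (η : ℕ → ℝ) (k : ℕ) :
    partialSum (residualOf n s η) k = partialSum η (n + k) - s := by
  induction k with
  | zero => simp [residualOf]
  | succ k ih =>
    rw [partialSum_succ, ih, ← add_assoc, partialSum_succ, residualOf]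
    simp only [Nat.add_eq_zero_iff, one_ne_zero, and_false, if_false]
    rw [← add_assoc]; ring

lemma GoodGaps.residual {η : ℕ → ℝ} (h : GoodGaps η) (s : ℝ) : GoodGaps (residual s η) := by
  have hr := ringsBy_ringCount (h.2 s)
  refine ⟨fun k => ?_, fun a => ?_⟩
  · unfold Fragmentation.residual residualOf
    split_ifs
    · exact sub_pos.2 hr.2
    · exact h.1 _
  · obtain ⟨k, hk⟩ := h.2 (s + a)
    refine ⟨k, ?_⟩
    rw [Fragmentation.residual, partialSum_residualOf]
    have := h.strictMono.monotone (Nat.le_add_left k (ringCount s η))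
    linarith

lemma GoodClocks.restart {ξ : V → ℕ → ℝ} (h : GoodClocks ξ) (s : ℝ) :
    GoodClocks (restart s ξ) := fun v => (h v).residual s

/-- Jump times depend only on the set of ring times at each vertex, and restarting cuts this set at
s and translates it. -/
lemma exists_ringTime_restart {ξ : V → ℕ → ℝ} (h : GoodClocks ξ) (s : ℝ) (v : V) (r : ℝ) :
    (∃ k, ringTime (restart s ξ) v k = r) ↔ 0 < r ∧ ∃ k, ringTime ξ v k = s + r := by
  have hr := ringsBy_ringCount ((h v).2 s)
  have key : ∀ k, ringTime (restart s ξ) v k = ringTime ξ v (ringCount s (ξ v) + k) - s :=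
    fun k => partialSum_residualOf _ s (ξ v) k
  constructor
  · rintro ⟨k, rfl⟩
    rw [key]
    refine ⟨?_, _, (add_sub_cancel _ _).symm⟩
    have h1 : partialSum (ξ v) (ringCount s (ξ v)) ≤ ringTime ξ v (ringCount s (ξ v) + k) :=
      (h v).strictMono.monotone (Nat.le_add_right _ _)
    linarith [hr.2]
  · rintro ⟨hpos, k, hk⟩
    have hle : ringCount s (ξ v) ≤ k := by
      by_contra hlt
      have : ringTime ξ v k ≤ s := hr.1 k (not_le.1 hlt)
      linarith
    refine ⟨k - ringCount s (ξ v), ?_⟩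
    rw [key, Nat.add_sub_cancel' hle, hk]; ring

/-- The walk reached its present vertex at some time before s, but no ring occurs there between that
arrival and s, so waiting from s or from the arrival leads to the same next jump. -/
lemma isAt_restart_jumpTime {ξ : V → ℕ → ℝ} (h : GoodClocks ξ) {p : ℕ → V} {n : ℕ} {s : ℝ}
    (hs : IsAt ξ p n s) (k : ℕ) :
    jumpTime (restart s ξ) (fun i => p (n + i)) (k + 1) = jumpTime ξ p (n + (k + 1)) - s := by
  have hg := h.restart s
  -- Allowing s + a to lie anywhere in the waiting interval covers both the base case, where the
  -- last jump may precede s, and the inductive one, where s + a is exactly a jump time.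
  have step : ∀ (m : ℕ) (a : ℝ), (0 ≤ a) →
      jumpTime (restart s ξ) (fun i => p (n + i)) m = a →
      jumpTime ξ p (n + m) ≤ s + a → s + a < jumpTime ξ p (n + (m + 1)) →
      jumpTime (restart s ξ) (fun i => p (n + i)) (m + 1) = jumpTime ξ p (n + (m + 1)) - s := by
    intro m a ha h1 h2 h3
    have l1 := hg.isLeast_jumpTime (fun i => p (n + i)) m
    have l2 := h.isLeast_jumpTime p (n + m)
    refine l1.unique ⟨⟨by rw [h1]; linarith, ?_⟩, ?_⟩
    · rw [exists_ringTime_restart h]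
      refine ⟨by linarith, ?_⟩
      obtain ⟨k, hk⟩ := l2.1.2
      exact ⟨k, by rw [hk, add_assoc]; ring⟩
    · rintro r ⟨hr1, hr2⟩
      rw [exists_ringTime_restart h] at hr2
      have := l2.2 ⟨show jumpTime ξ p (n + m) < s + r by rw [h1] at hr1; linarith, hr2.2⟩
      rw [add_assoc] at this
      linarith
  induction k with
  | zero => exact step 0 0 le_rfl rfl (by simpa using hs.1) (by simpa using hs.2)
  | succ k ih =>
    have hmono := h.strictMono_jumpTime p
    have hle : jumpTime ξ p (n + 1) ≤ jumpTime ξ p (n + (k + 1)) := hmono.monotone (by omega)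
    refine step (k + 1) _ ?_ ih (by linarith) ?_
    · linarith [hs.2]
    · rw [add_sub_cancel]
      exact hmono (by omega)

lemma isAt_restart_iff {ξ : V → ℕ → ℝ} (h : GoodClocks ξ) {p : ℕ → V} {n : ℕ} {s : ℝ}
    (hs : IsAt ξ p n s) (k : ℕ) {a : ℝ} (ha : 0 ≤ a) :
    IsAt (restart s ξ) (fun i => p (n + i)) k a ↔ IsAt ξ p (n + k) (s + a) := by
  unfold IsAt
  rw [isAt_restart_jumpTime h hs, ← add_assoc]
  cases k with
  | zero =>
    have : jumpTime (restart s ξ) (fun i => p (n + i)) 0 = 0 := rfl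
    rw [this]
    simp only [ha, true_and, add_zero]
    have h1 : jumpTime ξ p n ≤ s + a := by linarith [hs.1]
    simp only [h1, true_and]
    exact lt_sub_iff_add_lt'
  | succ k =>
    rw [isAt_restart_jumpTime h hs]
    exact and_congr sub_le_iff_le_add' lt_sub_iff_add_lt'

/-! #### Dependence on the past only -/

/-- The walk with ring times `T` has made exactly `n` steps at time `t`. -/
def IsAtOf (T : V → ℕ → ℝ) (p : ℕ → V) (n : ℕ) (t : ℝ) : Prop :=
  (∀ i ≤ n, hitTime T p i ≤ t) ∧ t < hitTime T p (n + 1)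

lemma GoodGaps.past_of_le {η : ℕ → ℝ} (h : GoodGaps η) {s : ℝ} {k : ℕ}
    (hk : partialSum η k ≤ s) : past s η k = partialSum η k := by
  have hr := ringsBy_ringCount (h.2 s)
  rw [past, pastOf, if_pos]
  by_contra hlt
  exact absurd ((h.strictMono.monotone (not_lt.1 hlt)).trans hk) (not_le.2 hr.2)

lemma GoodGaps.past_of_lt {η : ℕ → ℝ} (h : GoodGaps η) {s : ℝ} {k : ℕ}
    (hk : s < partialSum η k) : past s η k = s + 1 := by
  have hr := ringsBy_ringCount (h.2 s)
  rw [past, pastOf, if_neg]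
  exact fun hlt => absurd (hr.1 k hlt) (not_le.2 hk)

/-- Each clock rings after s, so s + 1 always appears among the truncated ring times. The next hit
is thus the true one if it is at most s, and s + 1 otherwise. -/
lemma hitTime_past_succ {ξ : V → ℕ → ℝ} (h : GoodClocks ξ) {p : ℕ → V} {n : ℕ} {s : ℝ}
    (h1 : jumpTime ξ p n ≤ s) (h2 : hitTime (allPast s ξ) p n = jumpTime ξ p n) :
    hitTime (allPast s ξ) p (n + 1) =
      if jumpTime ξ p (n + 1) ≤ s then jumpTime ξ p (n + 1) else s + 1 := by
  have l := h.isLeast_jumpTime p n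
  rw [hitTime, h2]
  refine IsLeast.csInf_eq ?_
  split_ifs with hle
  · refine ⟨⟨l.1.1, ?_⟩, ?_⟩
    · obtain ⟨k, hk⟩ := l.1.2
      exact ⟨k, by rw [← hk]; exact (h _).past_of_le (show ringTime ξ (p n) k ≤ s by rwa [hk])⟩
    · rintro _ ⟨hr, k, rfl⟩
      by_cases hk : partialSum (ξ (p n)) k ≤ s
      · have e : allPast s ξ (p n) k = partialSum (ξ (p n)) k := (h _).past_of_le hk
        rw [e] at hr ⊢
        exact l.2 ⟨hr, k, rfl⟩
      · have e : allPast s ξ (p n) k = s + 1 := (h _).past_of_lt (not_le.1 hk)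
        rw [e]; linarith
  · refine ⟨⟨by linarith, ?_⟩, ?_⟩
    · obtain ⟨k, hk⟩ := l.1.2
      refine ⟨k, (h _).past_of_lt ?_⟩
      exact (not_le.1 hle).trans_eq hk.symm
    · rintro _ ⟨hr, k, rfl⟩
      by_cases hk : partialSum (ξ (p n)) k ≤ s
      · have e : allPast s ξ (p n) k = partialSum (ξ (p n)) k := (h _).past_of_le hk
        rw [e] at hr
        exact absurd ((l.2 ⟨hr, k, rfl⟩).trans hk) hle
      · exact ((h _).past_of_lt (not_le.1 hk)).ge

lemma hitTime_past_eq {ξ : V → ℕ → ℝ} (h : GoodClocks ξ) {p : ℕ → V} {s : ℝ} (n : ℕ)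
    (h1 : jumpTime ξ p n ≤ s) : hitTime (allPast s ξ) p n = jumpTime ξ p n := by
  induction n with
  | zero => rfl
  | succ n ih =>
    have h0 : jumpTime ξ p n ≤ s := (h.isLeast_jumpTime p n).1.1.le.trans h1
    rw [hitTime_past_succ h h0 (ih h0), if_pos h1]

/-- Once a truncated hit time equals s + 1, the next one is the infimum of an empty set, that is 0.
Truncated hit times are therefore not monotone, which is why `IsAtOf` constrains all of them up to n
and not only the last. -/
lemma isAt_iff_past {ξ : V → ℕ → ℝ} (h : GoodClocks ξ) (p : ℕ → V) (n : ℕ) {s : ℝ} (hs : 0 ≤ s) :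
    IsAt ξ p n s ↔ IsAtOf (allPast s ξ) p n s := by
  have key : ∀ m, (∀ i ≤ m, hitTime (allPast s ξ) p i ≤ s) → jumpTime ξ p m ≤ s := by
    intro m
    induction m with
    | zero => exact fun _ => hs
    | succ m ih =>
      intro hm
      have h0 := ih fun i hi => hm i (by omega)
      have := hm (m + 1) le_rfl
      rw [hitTime_past_succ h h0 (hitTime_past_eq h m h0)] at this
      split_ifs at this with h'
      · exact h'
      · linarith
  have hmono := (h.strictMono_jumpTime p).monotone
  constructor
  · rintro ⟨h1, h2⟩
    refine ⟨fun i hi => ?_, ?_⟩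
    · have : jumpTime ξ p i ≤ s := (hmono hi).trans h1
      rw [hitTime_past_eq h i this]; exact this
    · rw [hitTime_past_succ h h1 (hitTime_past_eq h n h1), if_neg (not_le.2 h2)]
      linarith
  · rintro ⟨h1, h2⟩
    have h0 := key n h1
    refine ⟨h0, ?_⟩
    rw [hitTime_past_succ h h0 (hitTime_past_eq h n h0)] at h2
    split_ifs at h2 with h'
    · exact absurd h' (not_le.2 h2)
    · exact not_le.1 h'

/-! #### Measurability -/

/-- A countable infimum in `ENNReal` is measurable without boundedness conditions. The defaults
agree: with no ring after a, the real infimum is 0 and so is the real part of `⊤`. -/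
lemma sInf_eq_toReal_iInf {a : ℝ} (ha : 0 ≤ a) (T : ℕ → ℝ) :
    sInf {s : ℝ | a < s ∧ ∃ k, T k = s} =
      (⨅ k, if a < T k then ENNReal.ofReal (T k) else ⊤ : ENNReal).toReal := by
  by_cases hne : ∃ k, a < T k
  · have hS : {s : ℝ | a < s ∧ ∃ k, T k = s} = Set.range fun k : {k // a < T k} => T k := by
      ext s
      constructor
      · rintro ⟨h, k, rfl⟩; exact ⟨⟨k, h⟩, rfl⟩
      · rintro ⟨⟨k, hk⟩, rfl⟩; exact ⟨hk, k, rfl⟩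
    have : (⨅ k, if a < T k then ENNReal.ofReal (T k) else ⊤ : ENNReal) =
        ⨅ k : {k // a < T k}, ENNReal.ofReal (T k) := by
      rw [iInf_subtype]
      refine iInf_congr fun k => ?_
      split_ifs with h <;> simp [h]
    rw [hS, this, ENNReal.toReal_iInf fun _ => ENNReal.ofReal_ne_top]
    rw [iInf]
    congr 1
    ext s
    simp only [Set.mem_range]
    refine exists_congr fun k => ?_
    rw [ENNReal.toReal_ofReal (ha.trans k.2.le)]
  · have hS : {s : ℝ | a < s ∧ ∃ k, T k = s} = ∅ := by
      ext s
      simp only [Set.mem_ofPred_eq, Set.mem_empty_iff_false, iff_false, not_and]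
      rintro h ⟨k, rfl⟩
      exact hne ⟨k, h⟩
    have : ∀ k, (if a < T k then ENNReal.ofReal (T k) else ⊤ : ENNReal) = ⊤ :=
      fun k => if_neg fun h => hne ⟨k, h⟩
    simp [hS, this]

lemma hitTime_nonneg (T : V → ℕ → ℝ) (p : ℕ → V) (n : ℕ) : 0 ≤ hitTime T p n := by
  induction n with
  | zero => exact le_rfl
  | succ n ih => exact Real.sInf_nonneg fun s hs => ih.trans hs.1.le

lemma measurable_ringTime : Measurable (ringTime : (V → ℕ → ℝ) → V → ℕ → ℝ) :=
  measurable_pi_lambda _ fun v => measurable_pi_lambda _ fun k =>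
    (measurable_partialSum k).comp (measurable_pi_apply v)

variable [Countable V] [MeasurableSpace V] [DiscreteMeasurableSpace V]

lemma measurable_hitTime (n : ℕ) :
    Measurable fun x : (V → ℕ → ℝ) × (ℕ → V) => hitTime x.1 x.2 n := by
  induction n with
  | zero => exact measurable_const
  | succ n ih =>
    have : (fun x : (V → ℕ → ℝ) × (ℕ → V) => hitTime x.1 x.2 (n + 1)) = fun x =>
        (⨅ k, if hitTime x.1 x.2 n < x.1 (x.2 n) k then ENNReal.ofReal (x.1 (x.2 n) k)
          else ⊤ : ENNReal).toReal := by
      funext x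
      exact sInf_eq_toReal_iInf (hitTime_nonneg _ _ _) _
    rw [this]
    refine Measurable.ennreal_toReal (Measurable.iInf fun k => ?_)
    have hm : Measurable fun x : (V → ℕ → ℝ) × (ℕ → V) => x.1 (x.2 n) k := by
      have h1 : Measurable fun q : (V → ℕ → ℝ) × V => q.1 q.2 k :=
        measurable_from_prod_countable_left fun v =>
          (measurable_pi_apply k).comp (measurable_pi_apply v)
      exact h1.comp (measurable_fst.prodMk ((measurable_pi_apply n).comp measurable_snd))
    exact Measurable.ite (measurableSet_lt ih hm) hm.ennreal_ofReal measurable_const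

lemma measurable_jumpTime (n : ℕ) :
    Measurable fun x : (V → ℕ → ℝ) × (ℕ → V) => jumpTime x.1 x.2 n := by
  simp_rw [jumpTime_eq_hitTime]
  exact (measurable_hitTime n).comp ((measurable_ringTime.comp measurable_fst).prodMk measurable_snd)

lemma measurableSet_isAt (n : ℕ) (t : ℝ) :
    MeasurableSet {x : (V → ℕ → ℝ) × (ℕ → V) | IsAt x.1 x.2 n t} :=
  (measurableSet_le (measurable_jumpTime n) measurable_const).inter
    (measurableSet_lt measurable_const (measurable_jumpTime (n + 1)))

lemma measurableSet_isAtOf (n : ℕ) (t : ℝ) :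
    MeasurableSet {x : (V → ℕ → ℝ) × (ℕ → V) | IsAtOf x.1 x.2 n t} := by
  have : {x : (V → ℕ → ℝ) × (ℕ → V) | IsAtOf x.1 x.2 n t} =
      (⋂ i, ⋂ (_ : i ≤ n), {x | hitTime x.1 x.2 i ≤ t}) ∩ {x | t < hitTime x.1 x.2 (n + 1)} := by
    ext x; simp [IsAtOf]
  rw [this]
  exact (MeasurableSet.iInter fun i => MeasurableSet.iInter fun _ =>
    measurableSet_le (measurable_hitTime i) measurable_const).inter
    (measurableSet_lt measurable_const (measurable_hitTime (n + 1)))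

end Jumps

/-! ### The fragmentation process as a quenched law -/

section Quenched

variable {V : Type*}

/-- The second alternative is explosion: all jump times are at most t, the supremum of an unbounded
set of naturals is 0, and the position defaults to the starting point. It is kept until
`ae_exists_isAt` shows it to be null. -/
lemma position_eq_iff {ξ : V → ℕ → ℝ} (h : GoodClocks ξ) (p : ℕ → V) {t : ℝ} (ht : 0 ≤ t) (v : V) :
    position ξ p t = v ↔
      (∃ n, IsAt ξ p n t ∧ p n = v) ∨ ((∀ n, ¬ IsAt ξ p n t) ∧ p 0 = v) := by
  have hmono := h.strictMono_jumpTime p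
  by_cases hex : ∃ n, IsAt ξ p n t
  · obtain ⟨n, hn⟩ := hex
    have hset : {m | jumpTime ξ p m ≤ t} = Set.Iic n := by
      ext m
      constructor
      · intro hm
        by_contra hlt
        have h1 : jumpTime ξ p (n + 1) ≤ jumpTime ξ p m :=
          hmono.monotone (Nat.succ_le_of_lt (not_le.1 hlt))
        exact absurd (h1.trans hm) (not_le.2 hn.2)
      · exact fun hm => (hmono.monotone hm).trans hn.1
    rw [position, hset, csSup_Iic]
    constructor
    · exact fun hv => Or.inl ⟨n, hn, hv⟩
    · rintro (⟨m, hm, hv⟩ | ⟨hno, -⟩)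
      · rwa [hn.unique h hm]
      · exact absurd hn (hno n)
  · push Not at hex
    have hall : ∀ m, jumpTime ξ p m ≤ t := by
      intro m
      induction m with
      | zero => exact ht
      | succ m ih => exact not_lt.1 fun hlt => hex m ⟨ih, hlt⟩
    have hset : {m | jumpTime ξ p m ≤ t} = Set.univ := by
      ext m; simp [hall m]
    have h0 : sSup (Set.univ : Set ℕ) = 0 :=
      Nat.sSup_of_not_bddAbove not_bddAbove_univ
    rw [position, hset, h0]
    constructor
    · exact fun hv => Or.inr ⟨hex, hv⟩
    · rintro (⟨m, hm, -⟩ | ⟨-, hv⟩)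
      · exact absurd hm (hex m)
      · exact hv

/-- The event that the walk is at `v` at time `t`. -/
def occ (t : ℝ) (v : V) : Set ((V → ℕ → ℝ) × (ℕ → V)) :=
  {x | (∃ n, IsAt x.1 x.2 n t ∧ x.2 n = v) ∨ ((∀ n, ¬ IsAt x.1 x.2 n t) ∧ x.2 0 = v)}

/-- The event that the walk with given ring times is at `v` at time `t`. -/
def occOf (t : ℝ) (v : V) : Set ((V → ℕ → ℝ) × (ℕ → V)) :=
  {x | (∃ n, IsAtOf x.1 x.2 n t ∧ x.2 n = v) ∨ ((∀ n, ¬ IsAtOf x.1 x.2 n t) ∧ x.2 0 = v)}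

/-- The ring times up to `t`, later ones being replaced by `t + 1`. -/
def stopped (t : ℝ) (ξ : V → ℕ → ℝ) : V → ℕ → ℝ :=
  fun v k => if ringTime ξ v k ≤ t then ringTime ξ v k else t + 1

lemma GoodClocks.stopped_eq {ξ : V → ℕ → ℝ} (h : GoodClocks ξ) (t : ℝ) :
    stopped t ξ = allPast t ξ := by
  funext v k
  unfold stopped
  split_ifs with hk
  · exact ((h v).past_of_le hk).symm
  · exact ((h v).past_of_lt (not_le.1 hk)).symm

lemma occ_unique {ξ : V → ℕ → ℝ} (h : GoodClocks ξ) {p : ℕ → V} {t : ℝ} {v w : V} (ht : 0 ≤ t)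
    (hv : (ξ, p) ∈ occ t v) (hw : (ξ, p) ∈ occ t w) : v = w := by
  rw [← (position_eq_iff h p ht v).2 hv, ← (position_eq_iff h p ht w).2 hw]

lemma mem_occ_iff {ξ : V → ℕ → ℝ} (h : GoodClocks ξ) (p : ℕ → V) {t : ℝ} (ht : 0 ≤ t) (v : V) :
    (ξ, p) ∈ occ t v ↔ (stopped t ξ, p) ∈ occOf t v := by
  simp only [occ, occOf, Set.mem_ofPred_eq, h.stopped_eq, isAt_iff_past h p _ ht]

lemma measurable_stopped (t : ℝ) :
    Measurable[clockSigma V t] fun x : (V → ℕ → ℝ) × (ℕ → V) => stopped t x.1 := by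
  refine @measurable_pi_lambda _ _ _ (clockSigma V t) _ _ fun v =>
    @measurable_pi_lambda _ _ _ (clockSigma V t) _ _ fun k => ?_
  refine @measurable_of_Iic _ _ _ _ _ (clockSigma V t) _ _ _ _ fun c => ?_
  by_cases hc : t + 1 ≤ c
  · have : (fun x : (V → ℕ → ℝ) × (ℕ → V) => stopped t x.1 v k) ⁻¹' Set.Iic c = Set.univ := by
      ext x
      simp only [Set.mem_preimage, Set.mem_Iic, Set.mem_univ, iff_true, stopped]
      split_ifs with h <;> linarith
    rw [this]
    exact @MeasurableSet.univ _ (clockSigma V t)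
  · have : (fun x : (V → ℕ → ℝ) × (ℕ → V) => stopped t x.1 v k) ⁻¹' Set.Iic c =
        {x | ringTime x.1 v k ≤ min c t} := by
      ext x
      simp only [Set.mem_preimage, Set.mem_Iic, Set.mem_ofPred_eq, stopped, le_min_iff]
      split_ifs with h
      · simp [h]
      · simp [h, hc]
    rw [this]
    exact MeasurableSpace.measurableSet_generateFrom ⟨v, k, _, min_le_right _ _, rfl⟩

lemma clockSigma_le_comap (t : ℝ) : clockSigma V t ≤
    MeasurableSpace.comap (Prod.fst : (V → ℕ → ℝ) × (ℕ → V) → V → ℕ → ℝ) inferInstance := by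
  refine MeasurableSpace.generateFrom_le ?_
  rintro _ ⟨v, k, s, -, rfl⟩
  refine ⟨{ξ | ringTime ξ v k ≤ s}, ?_, rfl⟩
  exact measurableSet_le ((measurable_partialSum k).comp (measurable_pi_apply v)) measurable_const

variable [MeasurableSpace V]

lemma clockSigma_le (t : ℝ) : clockSigma V t ≤
    (inferInstance : MeasurableSpace ((V → ℕ → ℝ) × (ℕ → V))) :=
  (clockSigma_le_comap t).trans measurable_fst.comap_le

variable [Countable V] [DiscreteMeasurableSpace V]

instance isProbabilityMeasure_chainLaw (P : V → PMF V) (o : V) :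
    IsProbabilityMeasure (chainLaw P o) := by
  unfold chainLaw; infer_instance

instance isProbabilityMeasure_walkLaw (P : V → PMF V) (o : V) :
    IsProbabilityMeasure (walkLaw P o) := by
  unfold walkLaw; infer_instance

lemma measurableSet_occ (t : ℝ) (v : V) : MeasurableSet (occ t v) := by
  have hp : ∀ n, MeasurableSet {x : (V → ℕ → ℝ) × (ℕ → V) | x.2 n = v} := fun n =>
    measurableSet_eq_fun ((measurable_pi_apply n).comp measurable_snd) measurable_const
  have : occ t v = (⋃ n, {x | IsAt x.1 x.2 n t} ∩ {x | x.2 n = v}) ∪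
      ((⋂ n, {x | IsAt x.1 x.2 n t}ᶜ) ∩ {x | x.2 0 = v}) := by
    ext x; simp [occ]
  rw [this]
  exact (MeasurableSet.iUnion fun n => (measurableSet_isAt n t).inter (hp n)).union
    ((MeasurableSet.iInter fun n => (measurableSet_isAt n t).compl).inter (hp 0))

lemma measurableSet_occOf (t : ℝ) (v : V) : MeasurableSet (occOf t v) := by
  have hp : ∀ n, MeasurableSet {x : (V → ℕ → ℝ) × (ℕ → V) | x.2 n = v} := fun n =>
    measurableSet_eq_fun ((measurable_pi_apply n).comp measurable_snd) measurable_const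
  have : occOf t v = (⋃ n, {x | IsAtOf x.1 x.2 n t} ∩ {x | x.2 n = v}) ∪
      ((⋂ n, {x | IsAtOf x.1 x.2 n t}ᶜ) ∩ {x | x.2 0 = v}) := by
    ext x; simp [occOf]
  rw [this]
  exact (MeasurableSet.iUnion fun n => (measurableSet_isAtOf n t).inter (hp n)).union
    ((MeasurableSet.iInter fun n => (measurableSet_isAtOf n t).compl).inter (hp 0))

/-- The law of the position at time `t` of the walk started at `o`, given the clocks. -/
def quenched (P : V → PMF V) (o : V) (t : ℝ) (v : V) (ξ : V → ℕ → ℝ) : ENNReal :=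
  chainLaw P o {p | (ξ, p) ∈ occ t v}

lemma quenched_ne_top (P : V → PMF V) (o : V) (t : ℝ) (v : V) (ξ : V → ℕ → ℝ) :
    quenched P o t v ξ ≠ ⊤ := measure_ne_top _ _

lemma measurable_quenched (P : V → PMF V) (o : V) (t : ℝ) (v : V) :
    Measurable (quenched P o t v) :=
  measurable_measure_prodMk_left (measurableSet_occ t v)

lemma ae_goodClocks_walkLaw (P : V → PMF V) (o : V) :
    ∀ᵐ x ∂(walkLaw P o), GoodClocks x.1 :=
  Measure.quasiMeasurePreserving_fst.ae (ae_goodClocks (V := V))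

/-- The conditional law given the rings up to time `t` is the law given all the clocks. -/
lemma mass_ae_eq (P : V → PMF V) (o : V) {t : ℝ} (ht : 0 ≤ t) (v : V) :
    mass P o t v =ᵐ[walkLaw P o] fun x => (quenched P o t v x.1).toReal := by
  set M : Set ((V → ℕ → ℝ) × (ℕ → V)) := {x | (stopped t x.1, x.2) ∈ occOf t v} with hM
  have mS : Measurable fun x : (V → ℕ → ℝ) × (ℕ → V) => stopped t x.1 :=
    (measurable_stopped t).mono (clockSigma_le t) le_rfl
  have mM : MeasurableSet M := (mS.prodMk measurable_snd) (measurableSet_occOf t v)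
  have e1 : ({x | position x.1 x.2 t = v} : Set ((V → ℕ → ℝ) × (ℕ → V))).indicator
      (fun _ => (1 : ℝ)) =ᵐ[walkLaw P o] M.indicator fun _ => (1 : ℝ) := by
    filter_upwards [ae_goodClocks_walkLaw P o] with x hx
    have : position x.1 x.2 t = v ↔ x ∈ M :=
      (position_eq_iff hx x.2 ht v).trans (mem_occ_iff hx x.2 ht v)
    by_cases h : x ∈ M
    · simp [Set.indicator, h, this.2 h]
    · simp [Set.indicator, h, mt this.1 h]
  -- The candidate conditional expectation integrates out the trajectory with the stopped ring times
  -- held fixed. It has the right integrals by Fubini, since every event of `clockSigma V t` depends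
  -- on the clocks only.
  set g0 : (V → ℕ → ℝ) → ENNReal := fun T => chainLaw P o {p | (T, p) ∈ occOf t v} with hg0
  have mg0 : Measurable g0 := measurable_measure_prodMk_left (measurableSet_occOf t v)
  have hg1 : ∀ T, g0 T ≤ 1 := fun T => prob_le_one
  have e2 : (fun x : (V → ℕ → ℝ) × (ℕ → V) => (g0 (stopped t x.1)).toReal) =ᵐ[walkLaw P o]
      (walkLaw P o)[M.indicator fun _ => (1 : ℝ) | clockSigma V t] := by
    have mg : Measurable[clockSigma V t]
        fun x : (V → ℕ → ℝ) × (ℕ → V) => (g0 (stopped t x.1)).toReal :=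
      (mg0.ennreal_toReal).comp (measurable_stopped t)
    have hint : Integrable (fun x : (V → ℕ → ℝ) × (ℕ → V) => (g0 (stopped t x.1)).toReal)
        (walkLaw P o) := by
      refine Integrable.of_bound (mg.mono (clockSigma_le t) le_rfl).aestronglyMeasurable 1 ?_
      refine Filter.Eventually.of_forall fun x => ?_
      rw [Real.norm_of_nonneg ENNReal.toReal_nonneg]
      exact ENNReal.toReal_mono ENNReal.one_ne_top (hg1 _)
    refine ae_eq_condExp_of_forall_setIntegral_eq (clockSigma_le t)
      ((integrable_const 1).indicator mM) (fun s _ _ => hint.integrableOn) ?_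
      mg.stronglyMeasurable.aestronglyMeasurable
    intro s hs _
    obtain ⟨s', hs', rfl⟩ := clockSigma_le_comap t _ hs
    have ms : MeasurableSet (Prod.fst ⁻¹' s' : Set ((V → ℕ → ℝ) × (ℕ → V))) := measurable_fst hs'
    rw [integral_indicator mM, Measure.restrict_restrict mM, integral_const, smul_eq_mul, mul_one,
      integral_toReal (f := fun x : (V → ℕ → ℝ) × (ℕ → V) => g0 (stopped t x.1))
        (mg0.comp mS).aemeasurable
        (Filter.Eventually.of_forall fun x => (hg1 _).trans_lt ENNReal.one_lt_top)]
    simp only [Measure.real, Measure.restrict_apply_univ]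
    congr 1
    rw [walkLaw, Measure.prod_apply (mM.inter ms), ← lintegral_indicator ms, lintegral_prod]
    · refine lintegral_congr fun ξ => ?_
      by_cases hξ : ξ ∈ s'
      · have h1 : ∀ p : ℕ → V, ((ξ, p) : (V → ℕ → ℝ) × (ℕ → V)) ∈ Prod.fst ⁻¹' s' := fun p => hξ
        simp only [Set.indicator_of_mem (h1 _), lintegral_const, measure_univ, mul_one]
        refine congrArg (chainLaw P o) ?_
        ext p
        simp [hM, hξ]
      · have h1 : ∀ p : ℕ → V, ((ξ, p) : (V → ℕ → ℝ) × (ℕ → V)) ∉ Prod.fst ⁻¹' s' := fun p => hξ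
        simp only [Set.indicator_of_notMem (h1 _), lintegral_zero]
        symm
        convert measure_empty (μ := chainLaw P o)
        ext p
        simp [hξ]
    · exact ((mg0.comp mS).indicator ms).aemeasurable
  have e3 := condExp_congr_ae (m := clockSigma V t) e1
  unfold mass
  filter_upwards [e3, e2, ae_goodClocks_walkLaw P o] with x h3 h2 hx
  rw [h3, ← h2]
  simp only [hg0, quenched, mem_occ_iff hx _ ht]

/-- Moments of the fragmentation process in terms of the quenched law. -/
lemma moment_eq (P : V → PMF V) (o : V) {t : ℝ} (ht : 0 ≤ t) (d : ℝ) :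
    moment P o t d = ∫⁻ ξ, ∑' v, quenched P o t v ξ ^ d ∂(clockLaw V) := by
  have h1 : ∀ᵐ x ∂(walkLaw P o), ∀ v, mass P o t v x = (quenched P o t v x.1).toReal :=
    ae_all_iff.2 fun v => mass_ae_eq P o ht v
  have h2 : moment P o t d =
      ∫⁻ x, ∑' v, quenched P o t v x.1 ^ d ∂(walkLaw P o) := by
    refine lintegral_congr_ae ?_
    filter_upwards [h1] with x hx
    refine tsum_congr fun v => ?_
    rw [hx v, ENNReal.ofReal_toReal (quenched_ne_top P o t v x.1)]
  have hm : Measurable fun ξ : V → ℕ → ℝ => ∑' v, quenched P o t v ξ ^ d :=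
    Measurable.tsum fun v => (measurable_quenched P o t v).pow_const d
  rw [h2, walkLaw, lintegral_prod (fun x : (V → ℕ → ℝ) × (ℕ → V) => ∑' v, quenched P o t v x.1 ^ d)
    (hm.comp measurable_fst).aemeasurable]
  simp

/-- Joint moments of quenched laws are probabilities that walkers sharing the clocks meet. -/
lemma lintegral_tsum_prod_quenched {ι : Type*} [Fintype ι] [Nonempty ι] (P : V → PMF V)
    (x : ι → V) {t : ℝ} (ht : 0 ≤ t) :
    ∫⁻ ξ, ∑' v, ∏ j, quenched P (x j) t v ξ ∂(clockLaw V) =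
      ∫⁻ Y, clockLaw V {ξ | ∃ v, ∀ j, (ξ, Y j) ∈ occ t v} ∂(Measure.pi fun j => chainLaw P (x j)) := by
  set M : Set ((V → ℕ → ℝ) × (ι → ℕ → V)) := {z | ∃ v, ∀ j, (z.1, z.2 j) ∈ occ t v} with hM
  have mj : ∀ v, MeasurableSet {z : (V → ℕ → ℝ) × (ι → ℕ → V) | ∀ j, (z.1, z.2 j) ∈ occ t v} := by
    intro v
    have : {z : (V → ℕ → ℝ) × (ι → ℕ → V) | ∀ j, (z.1, z.2 j) ∈ occ t v} =
        ⋂ j, {z | (z.1, z.2 j) ∈ occ t v} := by ext; simp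
    rw [this]
    exact MeasurableSet.iInter fun j =>
      (measurable_fst.prodMk ((measurable_pi_apply j).comp measurable_snd)) (measurableSet_occ t v)
  have mM : MeasurableSet M := by
    have : M = ⋃ v, {z : (V → ℕ → ℝ) × (ι → ℕ → V) | ∀ j, (z.1, z.2 j) ∈ occ t v} := by
      ext; simp [hM]
    rw [this]
    exact MeasurableSet.iUnion mj
  have h1 : ∫⁻ ξ, ∑' v, ∏ j, quenched P (x j) t v ξ ∂(clockLaw V) =
      ((clockLaw V).prod (Measure.pi fun j => chainLaw P (x j))) M := by
    rw [Measure.prod_apply mM]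
    refine lintegral_congr_ae ?_
    filter_upwards [ae_goodClocks (V := V)] with ξ hξ
    have e : Prod.mk ξ ⁻¹' M = ⋃ v, {Y : ι → ℕ → V | ∀ j, (ξ, Y j) ∈ occ t v} := by
      ext; simp [hM]
    rw [e, measure_iUnion]
    · refine tsum_congr fun v => ?_
      have : {Y : ι → ℕ → V | ∀ j, (ξ, Y j) ∈ occ t v} =
          Set.pi Set.univ fun _ => {p | (ξ, p) ∈ occ t v} := by ext; simp
      rw [this, Measure.pi_pi]
      rfl
    · intro v w hvw
      refine Set.disjoint_left.2 fun Y hv hw => hvw ?_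
      exact occ_unique hξ ht (hv (Classical.arbitrary ι)) (hw (Classical.arbitrary ι))
    · exact fun v => measurable_prodMk_left (mj v)
  rw [h1, Measure.prod_apply_symm mM]
  rfl

end Quenched

/-! ### Several walkers with prescribed trajectories sharing the clocks -/

section Walkers

variable {V ι : Type*}

/-- The trajectories seen after `n j` steps of the walker `j`. -/
def shiftTraj (y : ι → ℕ → V) (n : ι → ℕ) : ι → ℕ → V := fun j i => y j (n j + i)

/-- The positions after `n j` steps of the walker `j`. -/
def posAt (y : ι → ℕ → V) (n : ι → ℕ) : ι → V := fun j => y j (n j)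

@[simp] lemma posAt_shiftTraj (y : ι → ℕ → V) (n z : ι → ℕ) :
    posAt (shiftTraj y n) z = posAt y (n + z) := rfl

lemma shiftTraj_shiftTraj (y : ι → ℕ → V) (n z : ι → ℕ) :
    shiftTraj (shiftTraj y n) z = shiftTraj y (n + z) := by
  funext j i; simp [shiftTraj, add_assoc]

@[simp] lemma shiftTraj_zero (y : ι → ℕ → V) : shiftTraj y 0 = y := by
  funext j i; simp [shiftTraj]

open Classical in
/-- The increments of the step counts when the slot `s` is chosen: if the walker `s` has the least
label at its location, then all the walkers there make a step; otherwise nobody moves. -/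
def slotStep [LE ι] (x : ι → V) (s : ι) : ι → ℕ :=
  fun j => if x j = x s ∧ ∀ i, x i = x s → s ≤ i then 1 else 0

/-- The law at time `t` of the vector of the step counts of the walkers. -/
def indexLaw (t : ℝ) (y : ι → ℕ → V) (n : ι → ℕ) : ENNReal :=
  clockLaw V {ξ | ∀ j, IsAt ξ (y j) (n j) t}

lemma indexLaw_ne_top (t : ℝ) (y : ι → ℕ → V) (n : ι → ℕ) : indexLaw t y n ≠ ⊤ :=
  measure_ne_top _ _

lemma indexLaw_le_one (t : ℝ) (y : ι → ℕ → V) (n : ι → ℕ) : indexLaw t y n ≤ 1 := prob_le_one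

variable [Countable V] [MeasurableSpace V] [DiscreteMeasurableSpace V]

lemma measurableSet_forall_isAt [Finite ι] (y : ι → ℕ → V) (n : ι → ℕ) (t : ℝ) :
    MeasurableSet {ξ : V → ℕ → ℝ | ∀ j, IsAt ξ (y j) (n j) t} := by
  have : {ξ : V → ℕ → ℝ | ∀ j, IsAt ξ (y j) (n j) t} = ⋂ j, {ξ | IsAt ξ (y j) (n j) t} := by
    ext; simp
  rw [this]
  have : Countable ι := Finite.to_countable
  exact MeasurableSet.iInter fun j => measurable_prodMk_right (measurableSet_isAt (n j) t)

lemma measurableSet_forall_isAtOf [Finite ι] (y : ι → ℕ → V) (n : ι → ℕ) (t : ℝ) :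
    MeasurableSet {T : V → ℕ → ℝ | ∀ j, IsAtOf T (y j) (n j) t} := by
  have : {T : V → ℕ → ℝ | ∀ j, IsAtOf T (y j) (n j) t} = ⋂ j, {T | IsAtOf T (y j) (n j) t} := by
    ext; simp
  rw [this]
  have : Countable ι := Finite.to_countable
  exact MeasurableSet.iInter fun j => measurable_prodMk_right (measurableSet_isAtOf (n j) t)

lemma sum_indexLaw_le_one [Finite ι] (t : ℝ) (y : ι → ℕ → V) (F : Finset (ι → ℕ)) :
    ∑ n ∈ F, indexLaw t y n ≤ 1 := by
  have hd : Set.Pairwise (F : Set (ι → ℕ)) (Function.onFun (AEDisjoint (clockLaw V))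
      fun n => {ξ : V → ℕ → ℝ | ∀ j, IsAt ξ (y j) (n j) t}) := by
    intro n _ m _ hnm
    refine measure_mono_null (t := {ξ | ¬ GoodClocks ξ}) (fun ξ hξ => ?_)
      (ae_iff.1 (ae_goodClocks (V := V)))
    intro hg
    refine hnm ?_
    funext j
    exact (hξ.1 j).unique hg (hξ.2 j)
  unfold indexLaw
  rw [← measure_biUnion_finset₀ hd fun n _ => (measurableSet_forall_isAt y n t).nullMeasurableSet]
  exact prob_le_one

/-- Chapman–Kolmogorov equation for the step counts. -/
lemma indexLaw_add [Fintype ι] [DecidableEq ι] {s a : ℝ} (hs : 0 ≤ s) (ha : 0 ≤ a) (y : ι → ℕ → V) (n : ι → ℕ) :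
    indexLaw (s + a) y n =
      ∑ z ∈ Finset.Iic n, indexLaw s y z * indexLaw a (shiftTraj y z) (n - z) := by
  set E : (ι → ℕ) → Set (V → ℕ → ℝ) := fun z =>
    {ξ | allPast s ξ ∈ {T : V → ℕ → ℝ | ∀ j, IsAtOf T (y j) (z j) s} ∧
      restart s ξ ∈ {ξ : V → ℕ → ℝ | ∀ j, IsAt ξ (shiftTraj y z j) ((n - z) j) a}} with hE
  have mE : ∀ z, MeasurableSet (E z) := fun z =>
    (measurable_allPast s (measurableSet_forall_isAtOf y z s)).inter
      (measurable_restart s (measurableSet_forall_isAt (shiftTraj y z) (n - z) a))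
  have hEz : ∀ z, clockLaw V (E z) = indexLaw s y z * indexLaw a (shiftTraj y z) (n - z) := by
    intro z
    rw [hE, clockLaw_allPast_restart hs (measurableSet_forall_isAtOf y z s)
      (measurableSet_forall_isAt (shiftTraj y z) (n - z) a)]
    congr 1
    refine measure_congr ?_
    filter_upwards [ae_goodClocks (V := V)] with ξ hξ
    refine propext ⟨fun h j => ?_, fun h j => ?_⟩
    · exact (isAt_iff_past hξ (y j) (z j) hs).2 (h j)
    · exact (isAt_iff_past hξ (y j) (z j) hs).1 (h j)
  have hd : Set.Pairwise (Finset.Iic n : Set (ι → ℕ)) (Function.onFun (AEDisjoint (clockLaw V)) E) := by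
    intro z _ w _ hzw
    refine measure_mono_null (t := {ξ | ¬ GoodClocks ξ}) (fun ξ hξ => ?_)
      (ae_iff.1 (ae_goodClocks (V := V)))
    intro hg
    refine hzw ?_
    funext j
    exact ((isAt_iff_past hg (y j) (z j) hs).2 (hξ.1.1 j)).unique hg
      ((isAt_iff_past hg (y j) (w j) hs).2 (hξ.2.1 j))
  rw [← Finset.sum_congr rfl fun z _ => hEz z,
    ← measure_biUnion_finset₀ hd fun z _ => (mE z).nullMeasurableSet]
  refine measure_congr ?_
  filter_upwards [ae_goodClocks (V := V)] with ξ hξ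
  refine propext ⟨fun h => ?_, fun h => ?_⟩
  · have hex : ∀ j, ∃ m ≤ n j, IsAt ξ (y j) m s := fun j =>
      (h j).exists_le hs (le_add_of_nonneg_right ha)
    choose z hz hzs using hex
    -- The events are indexed by the step counts z at the intermediate time s, which are at most n
    -- because jumps are never undone.
    refine Set.mem_iUnion₂.2 ⟨z, Finset.mem_coe.2 (Finset.mem_Iic.2 hz), ?_, ?_⟩
    · exact fun j => (isAt_iff_past hξ (y j) (z j) hs).1 (hzs j)
    · intro j
      refine (isAt_restart_iff hξ (hzs j) _ ha).2 ?_
      have : z j + (n - z) j = n j := Nat.add_sub_cancel' (hz j)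
      rw [this]
      exact h j
  · obtain ⟨z, hz, h1, h2⟩ := Set.mem_iUnion₂.1 h
    have hz' : z ≤ n := Finset.mem_Iic.1 hz
    intro j
    have hzs := (isAt_iff_past hξ (y j) (z j) hs).2 (h1 j)
    have := (isAt_restart_iff hξ hzs _ ha).1 (h2 j)
    have e : z j + (n - z) j = n j := Nat.add_sub_cancel' (hz' j)
    rwa [e] at this

end Walkers

/-! #### Short times -/

section ShortTime

variable {V ι : Type*} [LinearOrder ι]

lemma slotStep_self_eq_one_iff (x : ι → V) (s : ι) :
    slotStep x s s = 1 ↔ ∀ i, x i = x s → s ≤ i := by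
  simp [slotStep]

lemma slotStep_eq_zero_iff (x : ι → V) (s : ι) :
    slotStep x s = 0 ↔ ¬ ∀ i, x i = x s → s ≤ i := by
  constructor
  · intro h
    rw [← slotStep_self_eq_one_iff, h]
    simp
  · intro h
    funext j
    simp [slotStep, h]

/-- Distinct leaders stand at distinct vertices and move disjoint groups of walkers, so effective
choices produce distinct increments. -/
lemma slotStep_inj {x : ι → V} {s s' : ι} (hs : ∀ i, x i = x s → s ≤ i)
    (h : slotStep x s' = slotStep x s) : s' = s := by
  have hs' : ∀ i, x i = x s' → s' ≤ i := by
    by_contra hcon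
    rw [(slotStep_eq_zero_iff x s').2 hcon, eq_comm, slotStep_eq_zero_iff] at h
    exact h hs
  have h1 := congrFun h s'
  rw [(slotStep_self_eq_one_iff x s').2 hs'] at h1
  have : x s' = x s := by
    by_contra hne
    simp [slotStep, hne] at h1
  exact le_antisymm (hs' s this.symm) (hs s' this)

lemma exists_leader [Fintype ι] (x : ι → V) (j : ι) :
    ∃ s, x s = x j ∧ ∀ i, x i = x s → s ≤ i := by
  classical
  have hne : (Finset.univ.filter fun i => x i = x j).Nonempty := ⟨j, by simp⟩
  refine ⟨Finset.min' _ hne, ?_, fun i hi => Finset.min'_le _ _ ?_⟩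
  · simpa using Finset.min'_mem _ hne
  · have := Finset.min'_mem _ hne
    simp only [Finset.mem_filter, Finset.mem_univ, true_and] at this ⊢
    rw [hi, this]

lemma gapLaw_head_gt {h : ℝ} (hh : 0 ≤ h) :
    gapLaw {η | h < η 0} = ENNReal.ofReal (Real.exp (-h)) := by
  rw [← expMeasure_Ioi hh, ← Measure.infinitePi_map_eval (fun _ : ℕ => expMeasure 1) 0,
    Measure.map_apply (measurable_pi_apply 0) measurableSet_Ioi]
  rfl

/-- Bounding the second gap, rather than the second ring time, by h from below gives a smaller event
with a product probability; the loss is only of order h^2. -/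
lemma gapLaw_one_ring {h : ℝ} (hh : 0 ≤ h) :
    gapLaw {η | η 0 ≤ h ∧ h < η 1} =
      ENNReal.ofReal (1 - Real.exp (-h)) * ENNReal.ofReal (Real.exp (-h)) := by
  have : {η : ℕ → ℝ | η 0 ≤ h ∧ h < η 1} =
      Set.pi (Finset.range 2 : Set ℕ) fun i => if i = 0 then Set.Iic h else Set.Ioi h := by
    ext η
    simp only [Set.mem_pi, Finset.coe_range, Set.mem_Iio, Set.mem_ofPred_eq]
    constructor
    · rintro ⟨h0, h1⟩ i hi
      interval_cases i
      · simpa using h0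
      · simpa using h1
    · intro H
      exact ⟨by simpa using H 0 (by norm_num), by simpa using H 1 (by norm_num)⟩
  rw [this, gapLaw, Measure.infinitePi_pi]
  · simp [Finset.prod_range_succ, expMeasure_Iic hh, expMeasure_Ioi hh]
  · intro i _
    split_ifs
    exacts [measurableSet_Iic, measurableSet_Ioi]

lemma measurableSet_head_gt (h : ℝ) : MeasurableSet {η : ℕ → ℝ | h < η 0} :=
  measurableSet_lt measurable_const (measurable_pi_apply 0)

lemma measurableSet_one_ring (h : ℝ) : MeasurableSet {η : ℕ → ℝ | η 0 ≤ h ∧ h < η 1} :=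
  (measurableSet_le (measurable_pi_apply 0) measurable_const).inter
    (measurableSet_lt measurable_const (measurable_pi_apply 1))

lemma GoodClocks.head_le_ringTime {ξ : V → ℕ → ℝ} (hg : GoodClocks ξ) (v : V) (k : ℕ) :
    ξ v 0 ≤ ringTime ξ v k := by
  have := (hg v).strictMono.monotone (Nat.zero_le k)
  rwa [partialSum_zero] at this

lemma GoodClocks.jumpTime_one {ξ : V → ℕ → ℝ} (hg : GoodClocks ξ) (p : ℕ → V) :
    jumpTime ξ p 1 = ξ (p 0) 0 := by
  have l := hg.isLeast_jumpTime p 0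
  refine le_antisymm (l.2 ⟨(hg (p 0)).1 0, 0, by simp [ringTime]⟩) ?_
  obtain ⟨k, hk⟩ := l.1.2
  rw [← hk]
  exact hg.head_le_ringTime _ _

lemma isAt_zero_of_head_gt {ξ : V → ℕ → ℝ} (hg : GoodClocks ξ) {p : ℕ → V} {h : ℝ} (hh : 0 ≤ h)
    (h0 : h < ξ (p 0) 0) : IsAt ξ p 0 h := ⟨hh, by rwa [zero_add, hg.jumpTime_one]⟩

lemma isAt_one_of_one_ring {ξ : V → ℕ → ℝ} (hg : GoodClocks ξ) {p : ℕ → V} {h : ℝ}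
    (h0 : ξ (p 0) 0 ≤ h) (h1 : h < ξ (p 0) 1) (h2 : p 1 ≠ p 0 → h < ξ (p 1) 0) :
    IsAt ξ p 1 h := by
  refine ⟨by rwa [hg.jumpTime_one], ?_⟩
  have l := hg.isLeast_jumpTime p 1
  obtain ⟨hlt, k, hk⟩ := l.1
  rw [hg.jumpTime_one] at hlt
  -- If the step stays at the same vertex, the next jump is at a later ring of the same clock, which
  -- comes after the second gap; otherwise it waits for a clock that is silent until h.
  by_cases he : p 1 = p 0
  · rw [← hk, he] at hlt ⊢
    have hk1 : 1 ≤ k := by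
      rcases Nat.eq_zero_or_pos k with rfl | hk0
      · simp [ringTime] at hlt
      · exact hk0
    have := (hg (p 0)).strictMono.monotone hk1
    rw [partialSum_succ, partialSum_zero] at this
    have hpos := (hg (p 0)).1 0
    calc h < ξ (p 0) 0 + ξ (p 0) (0 + 1) := by simp only [zero_add]; linarith
      _ ≤ _ := this
  · rw [← hk]
    exact (h2 he).trans_le (hg.head_le_ringTime _ _)

variable [Fintype ι]

open Classical in
/-- The first order approximation of `indexLaw h y z` for small `h`. -/
def indexApprox (h : ℝ) (x : ι → V) (z : ι → ℕ) : ℝ :=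
  (if z = 0 then 1 - h * Fintype.card ι else 0) + h * ∑ s, if slotStep x s = z then 1 else 0

open Classical in
lemma indexApprox_zero (h : ℝ) (x : ι → V) :
    indexApprox h x 0 = 1 - h * (Finset.univ.filter fun s : ι => ∀ i, x i = x s → s ≤ i).card := by
  have h1 : ∑ s, (if slotStep x s = 0 then (1 : ℝ) else 0) =
      Fintype.card ι - (Finset.univ.filter fun s : ι => ∀ i, x i = x s → s ≤ i).card := by
    simp only [slotStep_eq_zero_iff]
    rw [Finset.sum_boole, eq_sub_iff_add_eq, ← Nat.cast_add, add_comm,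
      Finset.card_filter_add_card_filter_not, Finset.card_univ]
  rw [indexApprox, h1, if_pos rfl]
  ring

lemma indexApprox_slotStep (h : ℝ) {x : ι → V} {s : ι} (hs : ∀ i, x i = x s → s ≤ i) :
    indexApprox h x (slotStep x s) = h := by
  classical
  have h0 : slotStep x s ≠ 0 := fun e => (slotStep_eq_zero_iff x s).1 e hs
  have : ∀ s', slotStep x s' = slotStep x s ↔ s' = s :=
    fun s' => ⟨slotStep_inj hs, fun e => e ▸ rfl⟩
  simp only [indexApprox, h0, if_false, zero_add, this, Finset.sum_ite_eq', Finset.mem_univ,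
    if_true, mul_one]

lemma indexApprox_other (h : ℝ) {x : ι → V} {z : ι → ℕ} (h0 : z ≠ 0)
    (hz : ∀ s, (∀ i, x i = x s → s ≤ i) → slotStep x s ≠ z) : indexApprox h x z = 0 := by
  classical
  have : ∀ s, ¬ slotStep x s = z := by
    intro s
    by_cases hs : ∀ i, x i = x s → s ≤ i
    · exact hz s hs
    · rw [(slotStep_eq_zero_iff x s).2 hs]
      exact h0.symm
  simp [indexApprox, h0, this]

lemma exp_neg_le_quadratic {h : ℝ} (hh : 0 ≤ h) : Real.exp (-h) ≤ 1 - h + h ^ 2 := by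
  have h1 : 1 + h ≤ Real.exp h := by linarith [Real.add_one_le_exp h]
  have h2 : Real.exp (-h) ≤ (1 + h)⁻¹ := by
    rw [Real.exp_neg]
    exact inv_anti₀ (by linarith) h1
  refine h2.trans ?_
  rw [inv_le_iff_one_le_mul₀ (by linarith)]
  nlinarith [pow_nonneg hh 3]

variable [Countable V]

open Classical in
-- Nobody moves if the clock at every occupied vertex is silent until h, and there are no more
-- occupied vertices than leaders.
lemma indexLaw_zero_ge {h : ℝ} (hh : 0 ≤ h) (y : ι → ℕ → V) :
    ENNReal.ofReal (Real.exp (-(h * (Finset.univ.filter fun s : ι =>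
      ∀ i, y i 0 = y s 0 → s ≤ i).card))) ≤ indexLaw h y 0 := by
  set Ld := Finset.univ.filter fun s : ι => ∀ i, y i 0 = y s 0 → s ≤ i with hLd
  set S : Finset V := Ld.image fun s => y s 0 with hS
  have hbox : clockLaw V (Set.pi (S : Set V) fun _ => {η | h < η 0}) ≤ indexLaw h y 0 := by
    refine measure_mono_ae ?_
    filter_upwards [ae_goodClocks (V := V)] with ξ hg hξ j
    obtain ⟨s, hs, hlead⟩ := exists_leader (fun i => y i 0) j
    refine isAt_zero_of_head_gt hg hh ?_
    refine hξ (y j 0) ?_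
    rw [hS, Finset.coe_image]
    exact ⟨s, by simpa [hLd] using hlead, hs⟩
  refine le_trans ?_ hbox
  rw [clockLaw_pi _ fun _ => measurableSet_head_gt h, gapLaw_head_gt hh, Finset.prod_const,
    ← ENNReal.ofReal_pow (Real.exp_nonneg _), ← Real.exp_nat_mul]
  refine ENNReal.ofReal_le_ofReal (Real.exp_le_exp.2 ?_)
  have : (S.card : ℝ) ≤ Ld.card := by exact_mod_cast Finset.card_image_le
  nlinarith

/-- It suffices that the clock of the leader has a first gap at most h and a second one above h,
while the clocks at all other present and next positions are silent; these are at most 2|ι|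
vertices. -/
lemma indexLaw_slotStep_ge {h : ℝ} (hh : 0 ≤ h) (y : ι → ℕ → V) {s : ι}
    (hs : ∀ i, y i 0 = y s 0 → s ≤ i) :
    ENNReal.ofReal ((1 - Real.exp (-h)) * Real.exp (-(h * (2 * Fintype.card ι + 1)))) ≤
      indexLaw h y (slotStep (fun j => y j 0) s) := by
  classical
  set v := y s 0 with hv
  set U : Finset V := ((Finset.univ.image fun j : ι => y j 0) ∪
    (Finset.univ.image fun j : ι => y j 1)).erase v with hU
  set T : V → Set (ℕ → ℝ) := fun u =>
    if u = v then {η | η 0 ≤ h ∧ h < η 1} else {η | h < η 0} with hT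
  have mT : ∀ u, MeasurableSet (T u) := fun u => by
    simp only [hT]
    split_ifs
    exacts [measurableSet_one_ring h, measurableSet_head_gt h]
  have hvU : v ∉ U := Finset.notMem_erase _ _
  have hbox : clockLaw V (Set.pi ((insert v U : Finset V) : Set V) T) ≤
      indexLaw h y (slotStep (fun j => y j 0) s) := by
    refine measure_mono_ae ?_
    filter_upwards [ae_goodClocks (V := V)] with ξ hg hξ j
    have hξv : ξ v 0 ≤ h ∧ h < ξ v 1 := by
      have := hξ v (by simp)
      simpa [hT] using this
    have hξu : ∀ u ≠ v, (∃ j, y j 0 = u ∨ y j 1 = u) → h < ξ u 0 := by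
      rintro u hu ⟨j, hj⟩
      have : u ∈ (insert v U : Finset V) := by
        rw [Finset.mem_insert, hU, Finset.mem_erase, Finset.mem_union]
        right
        refine ⟨hu, hj.imp (fun e => ?_) fun e => ?_⟩ <;>
          exact Finset.mem_image.2 ⟨j, Finset.mem_univ j, e⟩
      have := hξ u (Finset.mem_coe.2 this)
      simpa [hT, hu] using this
    by_cases hj : y j 0 = v
    · have e : slotStep (fun j => y j 0) s j = 1 := by
        simp only [slotStep]
        rw [if_pos ⟨hj, hs⟩]
      rw [e]
      refine isAt_one_of_one_ring hg ?_ ?_ ?_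
      · rw [hj]; exact hξv.1
      · rw [hj]; exact hξv.2
      · rw [hj]; exact fun hne => hξu _ hne ⟨j, Or.inr rfl⟩
    · have e : slotStep (fun j => y j 0) s j = 0 := by
        simp only [slotStep]
        rw [if_neg fun hcon => hj hcon.1]
      rw [e]
      exact isAt_zero_of_head_gt hg hh (hξu _ hj ⟨j, Or.inl rfl⟩)
  refine le_trans ?_ hbox
  have hU' : ∏ u ∈ U, gapLaw (T u) = ENNReal.ofReal (Real.exp (-h)) ^ U.card := by
    rw [← Finset.prod_const]
    refine Finset.prod_congr rfl fun u hu => ?_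
    have : u ≠ v := fun e => hvU (e ▸ hu)
    simp only [hT, this, if_false]
    exact gapLaw_head_gt hh
  have h1e : 0 ≤ 1 - Real.exp (-h) := by
    rw [sub_nonneg, Real.exp_le_one_iff]; linarith
  have hTv : gapLaw (T v) = ENNReal.ofReal (1 - Real.exp (-h)) * ENNReal.ofReal (Real.exp (-h)) := by
    simp only [hT, if_true]
    exact gapLaw_one_ring hh
  rw [clockLaw_pi _ mT, Finset.prod_insert hvU, hU', hTv,
    ← ENNReal.ofReal_pow (Real.exp_nonneg _), ← Real.exp_nat_mul,
    ← ENNReal.ofReal_mul h1e, ← ENNReal.ofReal_mul (mul_nonneg h1e (Real.exp_nonneg _)), mul_assoc,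
    ← Real.exp_add]
  refine ENNReal.ofReal_le_ofReal (mul_le_mul_of_nonneg_left (Real.exp_le_exp.2 ?_) h1e)
  have hc : U.card ≤ 2 * Fintype.card ι := by
    refine (Finset.card_erase_le).trans ((Finset.card_union_le _ _).trans ?_)
    have h1 := Finset.card_image_le (s := (Finset.univ : Finset ι)) (f := fun j => y j 0)
    have h2 := Finset.card_image_le (s := (Finset.univ : Finset ι)) (f := fun j => y j 1)
    rw [Finset.card_univ] at h1 h2
    omega
  have hc' : (U.card : ℝ) ≤ 2 * Fintype.card ι := by exact_mod_cast hc
  nlinarith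

lemma indexLaw_ge {h : ℝ} (hh : 0 ≤ h) (y : ι → ℕ → V) (z : ι → ℕ) :
    indexApprox h (fun j => y j 0) z - (2 * Fintype.card ι + 2) * h ^ 2 ≤
      (indexLaw h y z).toReal := by
  classical
  have hc : (0 : ℝ) ≤ Fintype.card ι := Nat.cast_nonneg _
  by_cases h0 : z = 0
  · subst h0
    have h1 := indexLaw_zero_ge hh y
    rw [ENNReal.ofReal_le_iff_le_toReal (indexLaw_ne_top _ _ _)] at h1
    rw [indexApprox_zero]
    have h2 := Real.add_one_le_exp (-(h * (Finset.univ.filter fun s : ι =>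
      ∀ i, y i 0 = y s 0 → s ≤ i).card))
    nlinarith [sq_nonneg h]
  by_cases hz : ∃ s, (∀ i, y i 0 = y s 0 → s ≤ i) ∧ slotStep (fun j => y j 0) s = z
  · obtain ⟨s, hs, rfl⟩ := hz
    have h1 := indexLaw_slotStep_ge hh y hs
    rw [ENNReal.ofReal_le_iff_le_toReal (indexLaw_ne_top _ _ _)] at h1
    rw [indexApprox_slotStep h (x := fun j => y j 0) hs]
    refine le_trans ?_ h1
    have h2 := Real.add_one_le_exp (-(h * (2 * Fintype.card ι + 1)))
    have h3 := exp_neg_le_quadratic hh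
    have h4 := Real.add_one_le_exp (-h)
    have h5 : 0 ≤ 1 - Real.exp (-h) := by
      rw [sub_nonneg, Real.exp_le_one_iff]; linarith
    have h6 := mul_le_mul_of_nonneg_left h2 h5
    have h7 : 0 ≤ (h - (1 - Real.exp (-h))) * (h * (2 * Fintype.card ι + 1)) := by
      apply mul_nonneg
      · linarith
      · positivity
    nlinarith
  · push Not at hz
    rw [indexApprox_other h h0 hz]
    have : (0 : ℝ) ≤ (2 * Fintype.card ι + 2) * h ^ 2 := by positivity
    linarith [ENNReal.toReal_nonneg (a := indexLaw h y z)]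

variable [MeasurableSpace V] [DiscreteMeasurableSpace V]

/-- Short time expansion of the law of the step counts. -/
lemma abs_indexLaw_sub_le {h : ℝ} (hh : 0 ≤ h) (y : ι → ℕ → V) (z : ι → ℕ) :
    |(indexLaw h y z).toReal - indexApprox h (fun j => y j 0) z| ≤
      (Fintype.card ι + 2) * (2 * Fintype.card ι + 2) * h ^ 2 := by
  classical
  set x : ι → V := fun j => y j 0
  set C : ℝ := (2 * Fintype.card ι + 2) * h ^ 2 with hC
  have hC0 : 0 ≤ C := by positivity
  have hlow : ∀ z, indexApprox h x z - C ≤ (indexLaw h y z).toReal := indexLaw_ge hh y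
  -- Only lower bounds were proved. The approximations sum to 1 over F while the probabilities sum
  -- to at most 1, so the excess at z is at most the number of points of F times the common error.
  set F : Finset (ι → ℕ) := insert z (insert 0 (Finset.univ.image (slotStep x))) with hF
  have hcard : (F.card : ℝ) ≤ Fintype.card ι + 2 := by
    have h1 : F.card ≤ _ := Finset.card_insert_le z (insert 0 (Finset.univ.image (slotStep x)))
    have h2 := Finset.card_insert_le 0 (Finset.univ.image (slotStep x))
    have h3 := Finset.card_image_le (s := (Finset.univ : Finset ι)) (f := slotStep x)
    rw [Finset.card_univ] at h3
    exact_mod_cast (by omega : F.card ≤ Fintype.card ι + 2)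
  have htot : ∑ w ∈ F, indexApprox h x w = 1 := by
    have h0 : (0 : ι → ℕ) ∈ F := by simp [hF]
    have hs : ∀ s, slotStep x s ∈ F := fun s => by simp [hF]
    simp only [indexApprox]
    rw [Finset.sum_add_distrib, Finset.sum_ite_eq', if_pos h0, ← Finset.mul_sum, Finset.sum_comm]
    simp [hs]
  have hsum : ∑ w ∈ F, (indexLaw h y w).toReal ≤ 1 := by
    rw [← ENNReal.toReal_sum fun w _ => indexLaw_ne_top _ _ _]
    exact ENNReal.toReal_mono ENNReal.one_ne_top (sum_indexLaw_le_one h y F)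
  have hzF : z ∈ F := by simp [hF]
  have hdiff : ∑ w ∈ F, ((indexLaw h y w).toReal - indexApprox h x w + C) ≤ F.card * C := by
    rw [Finset.sum_add_distrib, Finset.sum_sub_distrib, htot, Finset.sum_const, nsmul_eq_mul]
    linarith
  have hone := (Finset.single_le_sum (f := fun w => (indexLaw h y w).toReal - indexApprox h x w + C)
    (fun w _ => by linarith [hlow w]) hzF).trans hdiff
  have h2 : (F.card : ℝ) * C ≤ (Fintype.card ι + 2) * C := mul_le_mul_of_nonneg_right hcard hC0
  have h3 : (Fintype.card ι + 2) * (2 * Fintype.card ι + 2) * h ^ 2 = (Fintype.card ι + 2) * C := by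
    rw [hC]; ring
  have h4 : C ≤ (Fintype.card ι + 2) * C := by
    have : (0 : ℝ) ≤ Fintype.card ι := Nat.cast_nonneg _
    nlinarith
  rw [h3, abs_le]
  have := hlow z
  constructor <;> linarith

end ShortTime

/-! ### Uniformization: choosing slots at the rings of a Poisson process of rate `|ι|` -/

section SlotOp

variable {ι σ : Type*} [Fintype ι]

/-- The sum over the slots of a function of the state reached when that slot is chosen. -/
def slotOp (f : ι → σ → σ) (F : σ → ENNReal) : σ → ENNReal := fun x => ∑ s, F (f s x)

lemma slotOp_iterate_succ (f : ι → σ → σ) (m : ℕ) (F : σ → ENNReal) (x : σ) :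
    (slotOp f)^[m + 1] F x = ∑ s, (slotOp f)^[m] F (f s x) := by
  rw [Function.iterate_succ_apply']; rfl

lemma slotOp_iterate_mono (f : ι → σ → σ) (m : ℕ) {F G : σ → ENNReal} (h : ∀ x, F x ≤ G x) (x : σ) :
    (slotOp f)^[m] F x ≤ (slotOp f)^[m] G x := by
  induction m generalizing x with
  | zero => exact h x
  | succ m ih =>
    simp only [slotOp_iterate_succ]
    exact Finset.sum_le_sum fun s _ => ih _

lemma slotOp_iterate_add (f : ι → σ → σ) (m : ℕ) (F G : σ → ENNReal) (x : σ) :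
    (slotOp f)^[m] (fun x => F x + G x) x = (slotOp f)^[m] F x + (slotOp f)^[m] G x := by
  induction m generalizing x with
  | zero => rfl
  | succ m ih =>
    simp only [slotOp_iterate_succ, ih, Finset.sum_add_distrib]

lemma slotOp_iterate_const_mul (f : ι → σ → σ) (m : ℕ) (c : ENNReal) (F : σ → ENNReal) (x : σ) :
    (slotOp f)^[m] (fun x => c * F x) x = c * (slotOp f)^[m] F x := by
  induction m generalizing x with
  | zero => rfl
  | succ m ih => simp only [slotOp_iterate_succ, ih, Finset.mul_sum]

lemma slotOp_iterate_sum {κ : Type*} (S : Finset κ) (f : ι → σ → σ) (m : ℕ)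
    (F : κ → σ → ENNReal) (x : σ) :
    (slotOp f)^[m] (fun x => ∑ i ∈ S, F i x) x = ∑ i ∈ S, (slotOp f)^[m] (F i) x := by
  induction m generalizing x with
  | zero => rfl
  | succ m ih =>
    simp only [slotOp_iterate_succ, ih]
    exact Finset.sum_comm

lemma slotOp_iterate_tsum {κ : Type*} (f : ι → σ → σ) (m : ℕ) (F : κ → σ → ENNReal) (x : σ) :
    (slotOp f)^[m] (fun x => ∑' i, F i x) x = ∑' i, (slotOp f)^[m] (F i) x := by
  induction m generalizing x with
  | zero => rfl
  | succ m ih =>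
    simp only [slotOp_iterate_succ, ih]
    exact (Summable.tsum_finsetSum fun _ _ => ENNReal.summable).symm

lemma slotOp_iterate_one (f : ι → σ → σ) (m : ℕ) (x : σ) :
    (slotOp f)^[m] (fun _ => 1) x = (Fintype.card ι : ENNReal) ^ m := by
  induction m generalizing x with
  | zero => simp
  | succ m ih =>
    simp only [slotOp_iterate_succ, ih, Finset.sum_const, Finset.card_univ, nsmul_eq_mul]
    ring

lemma slotOp_iterate_comp {τ : Type*} {f : ι → σ → σ} {g : ι → τ → τ} (π : σ → τ)
    (h : ∀ s x, π (f s x) = g s (π x)) (m : ℕ) (F : τ → ENNReal) (x : σ) :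
    (slotOp f)^[m] (fun x => F (π x)) x = (slotOp g)^[m] F (π x) := by
  induction m generalizing x with
  | zero => rfl
  | succ m ih => simp only [slotOp_iterate_succ, ih, h]

end SlotOp

/-- The weights of the uniformization: `exp (-d t) t ^ m / m!`. -/
def unifWeight (d : ℕ) (t : ℝ) (m : ℕ) : ENNReal :=
  ENNReal.ofReal (Real.exp (-(d * t)) * ((m.factorial : ℝ)⁻¹ * t ^ m))

lemma tsum_unifWeight_mul_pow (d : ℕ) {t : ℝ} (ht : 0 ≤ t) {c : ℝ} (hc : 0 ≤ c) :
    ∑' m, unifWeight d t m * ENNReal.ofReal c ^ m =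
      ENNReal.ofReal (Real.exp (-(d * t)) * Real.exp (t * c)) := by
  have h1 := NormedSpace.expSeries_div_hasSum_exp (𝔸 := ℝ) (t * c)
  rw [← Real.exp_eq_exp_ℝ] at h1
  have h2 := h1.mul_left (Real.exp (-(d * t)))
  rw [← h2.tsum_eq, ENNReal.ofReal_tsum_of_nonneg (fun m => by positivity) h2.summable]
  refine tsum_congr fun m => ?_
  rw [unifWeight, ← ENNReal.ofReal_pow hc, ← ENNReal.ofReal_mul (by positivity)]
  congr 1
  rw [mul_pow]
  field_simp

lemma indexLaw_zero_time {V ι : Type*} [Countable V] (y : ι → ℕ → V) (n : ι → ℕ)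
    [Decidable (n = 0)] :
    indexLaw 0 y n = if n = 0 then 1 else 0 := by
  split_ifs with h
  · subst h
    rw [indexLaw, ← measure_univ (μ := clockLaw V)]
    refine measure_congr ?_
    filter_upwards [ae_goodClocks (V := V)] with ξ hξ
    refine propext ⟨fun _ => trivial, fun _ j => ⟨le_rfl, ?_⟩⟩
    exact hξ.strictMono_jumpTime (y j) Nat.zero_lt_one
  · rw [indexLaw, ← measure_empty (μ := clockLaw V)]
    refine measure_congr ?_
    filter_upwards [ae_goodClocks (V := V)] with ξ hξ
    refine propext ⟨fun hat => h ?_, fun hf => hf.elim⟩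
    funext j
    by_contra hj
    exact absurd (hξ.strictMono_jumpTime (y j) (Nat.pos_of_ne_zero hj)) (not_lt.2 (hat j).1)

/-! ### The linear differential equation for the step counts and its exponential solution -/

section Formula

variable {V ι : Type*} [LinearOrder ι]

/-- The step counts after choosing the slot `s`. -/
def stepIdx (y : ι → ℕ → V) (s : ι) (n : ι → ℕ) : ι → ℕ := n + slotStep (posAt y n) s

variable [Fintype ι]

/-- Extension by zero of a function on a box. -/
def boxExt (n : ι → ℕ) (u : Finset.Iic n → ℝ) (m : ι → ℕ) : ℝ :=
  if h : m ∈ Finset.Iic n then u ⟨m, h⟩ else 0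

/-- The real version of `slotOp (stepIdx y)` on functions supported in a box. -/
def boxOp (y : ι → ℕ → V) (n : ι → ℕ) : (Finset.Iic n → ℝ) →L[ℝ] (Finset.Iic n → ℝ) :=
  LinearMap.toContinuousLinearMap
    { toFun := fun u m => ∑ s, boxExt n u (stepIdx y s m)
      map_add' := fun u v => by
        funext m
        simp only [Pi.add_apply, ← Finset.sum_add_distrib]
        refine Finset.sum_congr rfl fun s _ => ?_
        unfold boxExt
        split_ifs <;> simp
      map_smul' := fun c u => by
        funext m
        simp only [Pi.smul_apply, smul_eq_mul, RingHom.id_apply, Finset.mul_sum]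
        refine Finset.sum_congr rfl fun s _ => ?_
        unfold boxExt
        split_ifs <;> simp }

lemma boxOp_apply (y : ι → ℕ → V) (n : ι → ℕ) (u : Finset.Iic n → ℝ) (m : Finset.Iic n) :
    boxOp y n u m = ∑ s, boxExt n u (stepIdx y s m) := rfl

lemma boxExt_boxOp (y : ι → ℕ → V) (n : ι → ℕ) (u : Finset.Iic n → ℝ) (m : ι → ℕ) :
    boxExt n (boxOp y n u) m = ∑ s, boxExt n u (stepIdx y s m) := by
  by_cases h : m ∈ Finset.Iic n
  · rw [boxExt, dif_pos h, boxOp_apply]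
  · rw [boxExt, dif_neg h]
    refine (Finset.sum_eq_zero fun s _ => ?_).symm
    rw [boxExt, dif_neg]
    rw [Finset.mem_Iic] at h ⊢
    exact fun hle => h (le_trans le_self_add hle)

lemma ofReal_boxExt_pow (y : ι → ℕ → V) (n : ι → ℕ) {u : Finset.Iic n → ℝ} (hu : ∀ m, 0 ≤ u m)
    {F : (ι → ℕ) → ENNReal} (hF : ∀ m, ENNReal.ofReal (boxExt n u m) = F m) (k : ℕ) :
    (∀ m, 0 ≤ boxExt n ((boxOp y n ^ k) u) m) ∧
    ∀ m, ENNReal.ofReal (boxExt n ((boxOp y n ^ k) u) m) = (slotOp (stepIdx y))^[k] F m := by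
  induction k with
  | zero =>
    refine ⟨fun m => ?_, hF⟩
    simp only [pow_zero, boxExt]
    split_ifs
    exacts [hu _, le_rfl]
  | succ k ih =>
    have e : ∀ m, boxExt n ((boxOp y n ^ (k + 1)) u) m =
        ∑ s, boxExt n ((boxOp y n ^ k) u) (stepIdx y s m) := by
      intro m
      rw [pow_succ', mul_apply_eq_comp, boxExt_boxOp]
    refine ⟨fun m => ?_, fun m => ?_⟩
    · rw [e]
      exact Finset.sum_nonneg fun s _ => ih.1 _
    · rw [e, ENNReal.ofReal_sum_of_nonneg fun s _ => ih.1 _, slotOp_iterate_succ]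
      exact Finset.sum_congr rfl fun s _ => ih.2 _

/-- The probabilities to reach the step counts `n` from any smaller step counts in time `t`. -/
def boxLaw (t : ℝ) (y : ι → ℕ → V) (n : ι → ℕ) : Finset.Iic n → ℝ :=
  fun m => (indexLaw t (shiftTraj y m) (n - m)).toReal

lemma boxLaw_nonneg (t : ℝ) (y : ι → ℕ → V) (n : ι → ℕ) (m : Finset.Iic n) :
    0 ≤ boxLaw t y n m := ENNReal.toReal_nonneg

lemma boxLaw_le_one (t : ℝ) (y : ι → ℕ → V) (n : ι → ℕ) (m : Finset.Iic n) :
    boxLaw t y n m ≤ 1 := ENNReal.toReal_mono ENNReal.one_ne_top (indexLaw_le_one _ _ _)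

variable [Countable V] [MeasurableSpace V] [DiscreteMeasurableSpace V]

/-- Backward equation: Chapman–Kolmogorov with a short first interval a, into which the first order
expansion is inserted. Counts only increase, so fixing the target n confines everything to a finite
box, with the starting counts m as the variable. -/
lemma abs_boxLaw_sub_le {a t : ℝ} (ha : 0 ≤ a) (ht : 0 ≤ t) (y : ι → ℕ → V) (n : ι → ℕ)
    (m : Finset.Iic n) :
    |boxLaw (a + t) y n m - boxLaw t y n m -
      a * (boxOp y n (boxLaw t y n) m - Fintype.card ι * boxLaw t y n m)| ≤
      (Finset.Iic n).card * ((Fintype.card ι + 2) * (2 * Fintype.card ι + 2)) * a ^ 2 := by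
  classical
  obtain ⟨m, hm⟩ := m
  have hm' : m ≤ n := Finset.mem_Iic.1 hm
  set q : (ι → ℕ) → ℝ := fun z => (indexLaw t (shiftTraj (shiftTraj y m) z) (n - m - z)).toReal with hq
  have hbox : ∀ z, (if z ∈ Finset.Iic (n - m) then q z else 0) = boxExt n (boxLaw t y n) (m + z) := by
    intro z
    have hiff : z ∈ Finset.Iic (n - m) ↔ m + z ∈ Finset.Iic n := by
      rw [Finset.mem_Iic, Finset.mem_Iic]
      refine ⟨fun h j => ?_, fun h j => ?_⟩
      · have h1 : z j ≤ n j - m j := h j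
        have h2 : m j ≤ n j := hm' j
        change m j + z j ≤ n j
        omega
      · have h1 : m j + z j ≤ n j := h j
        change z j ≤ n j - m j
        omega
    unfold boxExt
    by_cases h : z ∈ Finset.Iic (n - m)
    · rw [if_pos h, dif_pos (hiff.1 h), hq, boxLaw]
      simp only [shiftTraj_shiftTraj, tsub_tsub]
    · rw [if_neg h, dif_neg (mt hiff.2 h)]
  have hCK : boxLaw (a + t) y n ⟨m, hm⟩ =
      ∑ z ∈ Finset.Iic (n - m), (indexLaw a (shiftTraj y m) z).toReal * q z := by
    rw [boxLaw, indexLaw_add ha ht, ENNReal.toReal_sum]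
    · exact Finset.sum_congr rfl fun z _ => ENNReal.toReal_mul
    · exact fun z _ => ENNReal.mul_ne_top (indexLaw_ne_top _ _ _) (indexLaw_ne_top _ _ _)
  have hmain : ∑ z ∈ Finset.Iic (n - m), indexApprox a (posAt y m) z * q z =
      boxLaw t y n ⟨m, hm⟩ +
      a * (boxOp y n (boxLaw t y n) ⟨m, hm⟩ - Fintype.card ι * boxLaw t y n ⟨m, hm⟩) := by
    have h0 : boxLaw t y n ⟨m, hm⟩ = q 0 := by
      simp [hq, boxLaw]
    have h00 : (0 : ι → ℕ) ∈ Finset.Iic (n - m) := Finset.mem_Iic.2 (zero_le)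
    have e1 : boxOp y n (boxLaw t y n) ⟨m, hm⟩ =
        ∑ s, if slotStep (posAt y m) s ∈ Finset.Iic (n - m) then q (slotStep (posAt y m) s) else 0 := by
      rw [boxOp_apply]
      exact Finset.sum_congr rfl fun s _ => (hbox _).symm
    have e2 : ∑ z ∈ Finset.Iic (n - m), (a * ∑ s, if slotStep (posAt y m) s = z then (1 : ℝ) else 0) * q z
        = a * ∑ s, if slotStep (posAt y m) s ∈ Finset.Iic (n - m)
          then q (slotStep (posAt y m) s) else 0 := by
      simp only [mul_assoc, Finset.sum_mul]
      rw [← Finset.mul_sum, Finset.sum_comm]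
      congr 1
      refine Finset.sum_congr rfl fun s _ => ?_
      simp only [ite_mul, one_mul, zero_mul]
      rw [Finset.sum_ite_eq]
    simp only [indexApprox, add_mul, Finset.sum_add_distrib, e2, ite_mul, zero_mul]
    rw [Finset.sum_ite_eq', if_pos h00, e1, h0]
    ring
  have hq1 : ∀ z, |q z| ≤ 1 := fun z => by
    rw [abs_of_nonneg ENNReal.toReal_nonneg]
    exact ENNReal.toReal_mono ENNReal.one_ne_top (indexLaw_le_one _ _ _)
  rw [sub_sub, ← hmain, hCK, ← Finset.sum_sub_distrib]
  refine (Finset.abs_sum_le_sum_abs _ _).trans ?_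
  have hterm : ∀ z ∈ Finset.Iic (n - m),
      |(indexLaw a (shiftTraj y m) z).toReal * q z - indexApprox a (posAt y m) z * q z| ≤
      (Fintype.card ι + 2) * (2 * Fintype.card ι + 2) * a ^ 2 := by
    intro z _
    rw [← sub_mul, abs_mul]
    refine (mul_le_of_le_one_right (abs_nonneg _) (hq1 z)).trans ?_
    exact abs_indexLaw_sub_le ha (shiftTraj y m) z
  refine (Finset.sum_le_card_nsmul _ _ _ hterm).trans ?_
  rw [nsmul_eq_mul, mul_assoc ((Finset.Iic n).card : ℝ)]
  refine mul_le_mul_of_nonneg_right ?_ (by positivity)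
  exact_mod_cast Finset.card_le_card (Finset.Iic_subset_Iic.2 tsub_le_self)

lemma norm_boxLaw_sub_le {a t : ℝ} (ha : 0 ≤ a) (ht : 0 ≤ t) (y : ι → ℕ → V) (n : ι → ℕ) :
    ‖boxLaw (a + t) y n - boxLaw t y n -
      a • (boxOp y n (boxLaw t y n) - (Fintype.card ι : ℝ) • boxLaw t y n)‖ ≤
      (Finset.Iic n).card * ((Fintype.card ι + 2) * (2 * Fintype.card ι + 2)) * a ^ 2 :=
  (pi_norm_le_iff_of_nonneg (by positivity)).2 fun m => abs_boxLaw_sub_le ha ht y n m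

/-- The short time expansion applies to positive increments and thus gives right derivatives, which
are all that ODE uniqueness requires. -/
lemma hasDerivWithinAt_boxLaw {t : ℝ} (ht : 0 ≤ t) (y : ι → ℕ → V) (n : ι → ℕ) :
    HasDerivWithinAt (fun t => boxLaw t y n)
      (boxOp y n (boxLaw t y n) - (Fintype.card ι : ℝ) • boxLaw t y n) (Set.Ici t) t := by
  rw [hasDerivWithinAt_iff_isLittleO]
  set C : ℝ := (Finset.Iic n).card * ((Fintype.card ι + 2) * (2 * Fintype.card ι + 2))
  have h1 : (fun s => boxLaw s y n - boxLaw t y n - (s - t) •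
      (boxOp y n (boxLaw t y n) - (Fintype.card ι : ℝ) • boxLaw t y n))
      =O[nhdsWithin t (Set.Ici t)] fun s => (s - t) ^ 2 := by
    refine Asymptotics.IsBigO.of_bound C ?_
    filter_upwards [self_mem_nhdsWithin] with s hs
    have := norm_boxLaw_sub_le (sub_nonneg.2 hs) ht y n
    rw [sub_add_cancel] at this
    rwa [Real.norm_of_nonneg (sq_nonneg _)]
  refine h1.trans_isLittleO ?_
  have h2 : (fun s : ℝ => (s - t) ^ 2) =o[nhds t] fun s => s - t := by
    have := (Asymptotics.isLittleO_pow_id (𝕜 := ℝ) (n := 2) one_lt_two).comp_tendsto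
      (show Filter.Tendsto (fun s : ℝ => s - t) (nhds t) (nhds 0) from
        tendsto_sub_nhds_zero_iff.2 Filter.tendsto_id)
    exact this
  exact h2.mono nhdsWithin_le_nhds

lemma continuousOn_boxLaw (y : ι → ℕ → V) (n : ι → ℕ) :
    ContinuousOn (fun t => boxLaw t y n) (Set.Ici 0) := by
  set C : ℝ := (Finset.Iic n).card * ((Fintype.card ι + 2) * (2 * Fintype.card ι + 2)) with hC
  set B : ℝ := ‖boxOp y n‖ + Fintype.card ι with hB
  have hu : ∀ t, ‖boxLaw t y n‖ ≤ 1 := fun t =>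
    (pi_norm_le_iff_of_nonneg zero_le_one).2 fun m => by
      rw [Real.norm_of_nonneg (boxLaw_nonneg _ _ _ _)]
      exact boxLaw_le_one _ _ _ _
  have key : ∀ s t : ℝ, 0 ≤ s → s ≤ t →
      ‖boxLaw t y n - boxLaw s y n‖ ≤ C * (t - s) ^ 2 + (t - s) * B := by
    intro s t hs hst
    have h1 := norm_boxLaw_sub_le (sub_nonneg.2 hst) hs y n
    rw [sub_add_cancel] at h1
    have h2 : ‖(t - s) • (boxOp y n (boxLaw s y n) - (Fintype.card ι : ℝ) • boxLaw s y n)‖ ≤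
        (t - s) * B := by
      rw [norm_smul, Real.norm_of_nonneg (sub_nonneg.2 hst)]
      refine mul_le_mul_of_nonneg_left ((norm_sub_le _ _).trans (add_le_add ?_ ?_))
        (sub_nonneg.2 hst)
      · exact ((boxOp y n).le_opNorm _).trans (mul_le_of_le_one_right (norm_nonneg _) (hu s))
      · rw [norm_smul, Real.norm_of_nonneg (Nat.cast_nonneg _)]
        exact mul_le_of_le_one_right (Nat.cast_nonneg _) (hu s)
    calc ‖boxLaw t y n - boxLaw s y n‖ ≤ _ := norm_le_norm_sub_add _
          ((t - s) • (boxOp y n (boxLaw s y n) - (Fintype.card ι : ℝ) • boxLaw s y n))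
      _ ≤ _ := add_le_add h1 h2
  intro t ht
  rw [ContinuousWithinAt, tendsto_iff_norm_sub_tendsto_zero]
  have hlim : Filter.Tendsto (fun s => C * |s - t| ^ 2 + |s - t| * B)
      (nhdsWithin t (Set.Ici 0)) (nhds 0) := by
    have : Continuous fun s => C * |s - t| ^ 2 + |s - t| * B := by fun_prop
    have h := (this.tendsto t).mono_left (nhdsWithin_le_nhds (s := Set.Ici (0 : ℝ)))
    simpa using h
  refine squeeze_zero' (Filter.Eventually.of_forall fun _ => norm_nonneg _) ?_ hlim
  filter_upwards [self_mem_nhdsWithin] with s hs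
  rcases le_total s t with hst | hst
  · rw [norm_sub_rev, abs_sub_comm, abs_of_nonneg (sub_nonneg.2 hst)]
    exact key s t hs hst
  · rw [abs_of_nonneg (sub_nonneg.2 hst)]
    exact key t s ht hst

/-- Both sides solve the same linear ODE with generator A - |ι| on a finite-dimensional space and
agree at time 0. -/
lemma boxLaw_eq_exp {t : ℝ} (ht : 0 ≤ t) (y : ι → ℕ → V) (n : ι → ℕ) :
    boxLaw t y n = Real.exp (-(Fintype.card ι * t)) •
      NormedSpace.exp (t • boxOp y n) (boxLaw 0 y n) := by
  set A := boxOp y n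
  set d : ℝ := ((Fintype.card ι : ℕ) : ℝ) with hd
  set L : (Finset.Iic n → ℝ) →L[ℝ] (Finset.Iic n → ℝ) := A - d • ContinuousLinearMap.id ℝ _ with hL
  have hLa : ∀ u, L u = A u - d • u := fun u => by simp [hL]
  set g : ℝ → (Finset.Iic n → ℝ) := fun t =>
    Real.exp (-(d * t)) • NormedSpace.exp (t • A) (boxLaw 0 y n) with hg
  have hgd : ∀ s, HasDerivAt g (L (g s)) s := by
    intro s
    have h1 : HasDerivAt (fun t : ℝ => Real.exp (-(d * t))) (Real.exp (-(d * s)) * (-d)) s := by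
      have := ((hasDerivAt_id s).const_mul d).neg.exp
      simpa using this
    have h2 : HasDerivAt (fun t : ℝ => NormedSpace.exp (t • A) (boxLaw 0 y n))
        (A (NormedSpace.exp (s • A) (boxLaw 0 y n))) s := by
      have h3 := hasDerivAt_exp_smul_const' (𝕂 := ℝ) A s
      have := (ContinuousLinearMap.apply ℝ (Finset.Iic n → ℝ) (boxLaw 0 y n)).hasFDerivAt.comp_hasDerivAt s h3
      exact this
    have h4 := h1.smul h2
    refine h4.congr_deriv ?_
    rw [hLa, hg]
    simp only [map_smul, smul_smul]
    rw [sub_eq_add_neg]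
    congr 1
    rw [← neg_smul]
    congr 1
    ring
  have hlip : ∀ s : ℝ, LipschitzWith ‖L‖₊ ((fun _ => L) s : (Finset.Iic n → ℝ) → _) :=
    fun _ => L.lipschitz
  have hEq := ODE_solution_unique (v := fun _ : ℝ => (L : (Finset.Iic n → ℝ) → _)) (a := 0) (b := t)
    (f := fun t => boxLaw t y n) (g := g) hlip
    ((continuousOn_boxLaw y n).mono Set.Icc_subset_Ici_self)
    (fun s hs => by
      have := hasDerivWithinAt_boxLaw hs.1 y n
      rw [hLa]; exact this)
    (fun s _ => (hgd s).continuousAt.continuousWithinAt)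
    (fun s _ => (hgd s).hasDerivWithinAt) (by simp [hg])
  exact hEq ⟨ht, le_rfl⟩

open Classical in
/-- Uniformization of the law of the step counts. -/
lemma indexLaw_eq_tsum {t : ℝ} (ht : 0 ≤ t) (y : ι → ℕ → V) (n : ι → ℕ) :
    indexLaw t y n = ∑' k, unifWeight (Fintype.card ι) t k *
      (slotOp (stepIdx y))^[k] (fun m => if m = n then 1 else 0) 0 := by
  have h0n : (0 : ι → ℕ) ∈ Finset.Iic n := Finset.mem_Iic.2 zero_le
  have hu0 : ∀ m, ENNReal.ofReal (boxExt n (boxLaw 0 y n) m) = if m = n then 1 else 0 := by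
    intro m
    unfold boxExt
    by_cases hm : m ∈ Finset.Iic n
    · rw [dif_pos hm, boxLaw, ENNReal.ofReal_toReal (indexLaw_ne_top _ _ _), indexLaw_zero_time]
      congr 1
      rw [Finset.mem_Iic] at hm
      refine propext ⟨fun h => le_antisymm hm (tsub_eq_zero_iff_le.1 h), fun h => by simp [h]⟩
    · rw [dif_neg hm, if_neg, ENNReal.ofReal_zero]
      rintro rfl
      exact hm (Finset.mem_Iic.2 le_rfl)
  have hpow := ofReal_boxExt_pow y n (boxLaw_nonneg 0 y n) hu0
  have h1 : HasSum (fun k : ℕ => ((k.factorial : ℝ)⁻¹ • (t • boxOp y n) ^ k) (boxLaw 0 y n) ⟨0, h0n⟩)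
      (NormedSpace.exp (t • boxOp y n) (boxLaw 0 y n) ⟨0, h0n⟩) := by
    have h2 := NormedSpace.exp_series_hasSum_exp' (𝕂 := ℝ) (t • boxOp y n)
    have h3 := (ContinuousLinearMap.apply ℝ (Finset.Iic n → ℝ) (boxLaw 0 y n)).hasSum h2
    exact (ContinuousLinearMap.proj (R := ℝ) (φ := fun _ : Finset.Iic n => ℝ) ⟨0, h0n⟩).hasSum h3
  have h4 := h1.mul_left (Real.exp (-(Fintype.card ι * t)))
  have h5 : indexLaw t y n = ENNReal.ofReal (boxLaw t y n ⟨0, h0n⟩) := by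
    rw [boxLaw, ENNReal.ofReal_toReal (indexLaw_ne_top _ _ _)]
    simp
  have hterm : ∀ k : ℕ, Real.exp (-(Fintype.card ι * t)) *
      ((k.factorial : ℝ)⁻¹ • (t • boxOp y n) ^ k) (boxLaw 0 y n) ⟨0, h0n⟩ =
      Real.exp (-(Fintype.card ι * t)) * ((k.factorial : ℝ)⁻¹ * t ^ k) *
        boxExt n ((boxOp y n ^ k) (boxLaw 0 y n)) 0 := by
    intro k
    rw [smul_pow, boxExt, dif_pos h0n]
    simp only [smul_apply, Pi.smul_apply, smul_eq_mul]
    ring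
  have e : boxLaw t y n ⟨0, h0n⟩ = ∑' k : ℕ, Real.exp (-(Fintype.card ι * t)) *
      ((k.factorial : ℝ)⁻¹ • (t • boxOp y n) ^ k) (boxLaw 0 y n) ⟨0, h0n⟩ := by
    rw [h4.tsum_eq, boxLaw_eq_exp ht]
    simp only [Pi.smul_apply, smul_eq_mul]
  rw [h5, e, ENNReal.ofReal_tsum_of_nonneg _ h4.summable]
  · refine tsum_congr fun k => ?_
    rw [hterm, ENNReal.ofReal_mul (by positivity), (hpow k).2 0]
    rfl
  · intro k
    rw [hterm]
    exact mul_nonneg (by positivity) ((hpow k).1 0)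

/-- Expectation of a function of the step counts. -/
lemma tsum_mul_indexLaw {t : ℝ} (ht : 0 ≤ t) (y : ι → ℕ → V) (F : (ι → ℕ) → ENNReal) :
    ∑' n, F n * indexLaw t y n =
      ∑' k, unifWeight (Fintype.card ι) t k * (slotOp (stepIdx y))^[k] F 0 := by
  classical
  have h1 : F = fun m => ∑' n, F n * if m = n then 1 else 0 := by
    funext m
    rw [tsum_eq_single m (fun n hn => by simp [hn.symm])]
    simp
  conv_rhs =>
    enter [1, k]
    rw [h1, slotOp_iterate_tsum, ← ENNReal.tsum_mul_left]
  rw [ENNReal.tsum_comm]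
  refine tsum_congr fun n => ?_
  rw [indexLaw_eq_tsum ht, ← ENNReal.tsum_mul_left]
  refine tsum_congr fun k => ?_
  rw [slotOp_iterate_const_mul]
  ring

lemma tsum_indexLaw {t : ℝ} (ht : 0 ≤ t) (y : ι → ℕ → V) : ∑' n, indexLaw t y n = 1 := by
  have h := tsum_mul_indexLaw ht y fun _ => 1
  simp only [one_mul, slotOp_iterate_one] at h
  rw [h]
  have h2 := tsum_unifWeight_mul_pow (Fintype.card ι) ht (c := Fintype.card ι) (Nat.cast_nonneg _)
  rw [ENNReal.ofReal_natCast] at h2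
  rw [h2, ← Real.exp_add]
  simp [mul_comm]

end Formula

/-! ### The discrete chain -/

section Chain

variable {V : Type*}

lemma frestrictLe_mem_singleton (n : ℕ) (a : ℕ → V) :
    (Preorder.frestrictLe (π := fun _ : ℕ => V) n) ⁻¹' {Preorder.frestrictLe n a} =
      {p : ℕ → V | ∀ i ≤ n, p i = a i} := by
  ext p
  simp only [Set.mem_preimage, Set.mem_singleton_iff, funext_iff, Set.mem_ofPred_eq]
  constructor
  · exact fun h i hi => h ⟨i, Finset.mem_Iic.2 hi⟩
  · exact fun h i => h i (Finset.mem_Iic.1 i.2)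

variable [MeasurableSpace V]

lemma measurable_shift (k : ℕ) : Measurable fun (p : ℕ → V) i => p (k + i) :=
  measurable_pi_lambda _ fun _ => measurable_pi_apply _

variable [Countable V] [DiscreteMeasurableSpace V]

open Classical in
lemma chainLaw_start (P : V → PMF V) (o a : V) :
    chainLaw P o {p | p 0 = a} = if o = a then 1 else 0 := by
  have h := Kernel.traj_map_frestrictLe_apply (X := fun _ => V) (κ := stepKernel P) 0 0 (fun _ => o)
  rw [Kernel.partialTraj_self, Kernel.id_apply] at h
  have e : {p : ℕ → V | p 0 = a} = Preorder.frestrictLe (π := fun _ : ℕ => V) 0 ⁻¹'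
      {x | x ⟨0, Finset.mem_Iic.2 le_rfl⟩ = a} := rfl
  have mS : MeasurableSet {x : (i : Finset.Iic 0) → V | x ⟨0, Finset.mem_Iic.2 le_rfl⟩ = a} :=
    measurableSet_eq_fun (measurable_pi_apply _) measurable_const
  rw [e, chainLaw, ← Measure.map_apply (Preorder.measurable_frestrictLe 0) mS, h,
    Measure.dirac_apply' _ mS]
  simp [Set.indicator]

lemma chainLaw_cylinder_succ (P : V → PMF V) (o : V) (n : ℕ) (a : ℕ → V) :
    chainLaw P o {p | ∀ i ≤ n + 1, p i = a i} =
      chainLaw P o {p | ∀ i ≤ n, p i = a i} * P (a n) (a (n + 1)) := by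
  have h := Kernel.partialTraj_compProd_eq_map_traj (X := fun _ => V) (κ := stepKernel P)
    (Nat.zero_le n) (x₀ := fun _ => o)
  set S : Set (((i : Finset.Iic n) → V) × V) := {Preorder.frestrictLe n a} ×ˢ {a (n + 1)} with hS
  have mS : MeasurableSet S := (measurableSet_singleton _).prod (measurableSet_singleton _)
  have h1 := congrArg (fun μ => μ S) h
  rw [Measure.map_apply ((Preorder.measurable_frestrictLe n).prodMk (measurable_pi_apply _)) mS,
    Measure.compProd_apply_prod (measurableSet_singleton _) (measurableSet_singleton _),
    Measure.restrict_singleton, lintegral_smul_measure, lintegral_dirac, smul_eq_mul,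
    ← Kernel.traj_map_frestrictLe_apply,
    Measure.map_apply (Preorder.measurable_frestrictLe n) (measurableSet_singleton _),
    frestrictLe_mem_singleton] at h1
  have e : (fun x : ℕ → V => (Preorder.frestrictLe (π := fun _ : ℕ => V) n x, x (n + 1))) ⁻¹' S =
      {p | ∀ i ≤ n + 1, p i = a i} := by
    have e0 := frestrictLe_mem_singleton n a
    ext p
    have e1 := Set.ext_iff.1 e0 p
    simp only [Set.mem_preimage, Set.mem_singleton_iff, Set.mem_ofPred_eq] at e1
    simp only [hS, Set.mem_preimage, Set.mem_prod, Set.mem_singleton_iff, Set.mem_ofPred_eq, e1]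
    constructor
    · rintro ⟨h1, h2⟩ i hi
      rcases Nat.lt_or_ge i (n + 1) with hlt | hge
      · exact h1 i (Nat.lt_succ_iff.1 hlt)
      · rw [le_antisymm hi hge]; exact h2
    · exact fun h => ⟨fun i hi => h i (by omega), h _ le_rfl⟩
  rw [e] at h1
  have hk : stepKernel P n (Preorder.frestrictLe n a) {a (n + 1)} = P (a n) (a (n + 1)) :=
    PMF.toMeasure_apply_singleton _ _ (measurableSet_singleton _)
  rw [hk] at h1
  exact h1.symm

/-- Both measures are projective limits of the same finite-dimensional laws, which are determined by
their values at points since V is countable. -/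
lemma measure_ext_of_cylinder {μ ν : Measure (ℕ → V)} [IsFiniteMeasure ν]
    (h : ∀ (n : ℕ) (a : ℕ → V), μ {p | ∀ i ≤ n, p i = a i} = ν {p | ∀ i ≤ n, p i = a i}) :
    μ = ν := by
  rcases isEmpty_or_nonempty V with hV | hV
  · exact Measure.ext_of_singleton fun p => (hV.false (p 0)).elim
  let Q : ∀ I : Finset ℕ, Measure ((i : I) → (fun _ : ℕ => V) i) := fun I =>
    ν.map (Finset.restrict (π := fun _ : ℕ => V) I)
  have hproj : IsProjectiveMeasureFamily (α := fun _ : ℕ => V) Q := by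
    intro I J hJI
    simp only [Q]
    rw [Measure.map_map (Finset.measurable_restrict₂ hJI) (Finset.measurable_restrict I)]
    rfl
  have hQfin : ∀ I, IsFiniteMeasure (Q I) := fun I => by simp only [Q]; infer_instance
  have hν : IsProjectiveLimit (α := fun _ : ℕ => V) ν Q := fun I => rfl
  refine IsProjectiveLimit.unique (P := Q) ?_ hν
  rw [isProjectiveLimit_nat_iff hproj]
  intro n
  refine Measure.ext_of_singleton fun x => ?_
  obtain ⟨a, rfl⟩ : ∃ a : ℕ → V, Preorder.frestrictLe n a = x :=
    ⟨fun i => if hi : i ≤ n then x ⟨i, Finset.mem_Iic.2 hi⟩ else Classical.arbitrary V, by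
      funext i
      have hi : (i : ℕ) ≤ n := Finset.mem_Iic.1 i.2
      simp [Preorder.frestrictLe, hi]⟩
  rw [Measure.map_apply (Preorder.measurable_frestrictLe n) (measurableSet_singleton _),
    Measure.map_apply (Finset.measurable_restrict _) (measurableSet_singleton _),
    frestrictLe_mem_singleton, h, ← frestrictLe_mem_singleton]
  rfl

lemma measurableSet_cylinder_eq (n : ℕ) (a : ℕ → V) :
    MeasurableSet {p : ℕ → V | ∀ i ≤ n, p i = a i} := by
  rw [← frestrictLe_mem_singleton]
  exact Preorder.measurable_frestrictLe n (measurableSet_singleton _)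

/-- Markov property of the chain after one step. -/
lemma chainLaw_map_shift_one (P : V → PMF V) (o : V) :
    (chainLaw P o).map (fun p i => p (1 + i)) = (chainLaw P o).bind fun p => chainLaw P (p 1) := by
  classical
  have hm1 : Measurable fun p : ℕ → V => chainLaw P (p 1) :=
    (measurable_of_countable fun v => chainLaw P v).comp (measurable_pi_apply 1)
  have hfin : IsFiniteMeasure ((chainLaw P o).bind fun p => chainLaw P (p 1)) := by
    constructor
    rw [Measure.bind_apply MeasurableSet.univ hm1.aemeasurable]
    simp
  refine measure_ext_of_cylinder fun n a => ?_
  rw [Measure.map_apply (measurable_shift 1) (measurableSet_cylinder_eq n a),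
    Measure.bind_apply (measurableSet_cylinder_eq n a) hm1.aemeasurable]
  induction n with
  | zero =>
    have e0 : ∀ v, chainLaw P v {p : ℕ → V | ∀ i ≤ 0, p i = a i} = if v = a 0 then 1 else 0 := by
      intro v
      rw [← chainLaw_start P v (a 0)]
      congr 1
      ext p
      simp
    simp only [e0]
    have e1 : (fun p : ℕ → V => if p 1 = a 0 then (1 : ENNReal) else 0) =
        {p : ℕ → V | p 1 = a 0}.indicator 1 := by
      funext p; simp [Set.indicator]
    rw [e1, lintegral_indicator_one (measurableSet_eq_fun (measurable_pi_apply _) measurable_const)]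
    congr 1
    ext p
    simp
  | succ n ih =>
    -- Splitting over the unknown initial value v turns the shifted event into a disjoint union of
    -- genuine cylinders, to which the one-step formula applies.
    have e1 : (fun (p : ℕ → V) i => p (1 + i)) ⁻¹' {p | ∀ i ≤ n + 1, p i = a i} =
        ⋃ v : V, {p : ℕ → V | ∀ i ≤ n + 2, p i = (fun j => if j = 0 then v else a (j - 1)) i} := by
      ext p
      simp only [Set.mem_preimage, Set.mem_ofPred_eq, Set.mem_iUnion]
      constructor
      · intro h
        refine ⟨p 0, fun i hi => ?_⟩
        rcases i with _ | i
        · simp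
        · have := h i (by omega)
          rw [add_comm] at this
          simpa using this
      · rintro ⟨v, h⟩ i hi
        have := h (1 + i) (by omega)
        simpa [Nat.add_comm 1 i] using this
    have e2 : (fun (p : ℕ → V) i => p (1 + i)) ⁻¹' {p | ∀ i ≤ n, p i = a i} =
        ⋃ v : V, {p : ℕ → V | ∀ i ≤ n + 1, p i = (fun j => if j = 0 then v else a (j - 1)) i} := by
      ext p
      simp only [Set.mem_preimage, Set.mem_ofPred_eq, Set.mem_iUnion]
      constructor
      · intro h
        refine ⟨p 0, fun i hi => ?_⟩
        rcases i with _ | i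
        · simp
        · have := h i (by omega)
          rw [add_comm] at this
          simpa using this
      · rintro ⟨v, h⟩ i hi
        have := h (1 + i) (by omega)
        simpa [Nat.add_comm 1 i] using this
    have hdis : ∀ m, Pairwise (Function.onFun Disjoint fun v : V =>
        {p : ℕ → V | ∀ i ≤ m, p i = (fun j => if j = 0 then v else a (j - 1)) i}) := by
      intro m v w hvw
      refine Set.disjoint_left.2 fun p h1 h2 => hvw ?_
      have h1' := h1 0 (Nat.zero_le _)
      have h2' := h2 0 (Nat.zero_le _)
      simp only [if_true] at h1' h2'
      rw [← h1', h2']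
    rw [e1, measure_iUnion (hdis _) fun v => measurableSet_cylinder_eq _ _]
    rw [e2, measure_iUnion (hdis _) fun v => measurableSet_cylinder_eq _ _] at ih
    have e3 : ∀ v, chainLaw P v {p : ℕ → V | ∀ i ≤ n + 1, p i = a i} =
      chainLaw P v {p | ∀ i ≤ n, p i = a i} * P (a n) (a (n + 1)) := fun v =>
      chainLaw_cylinder_succ P v n a
    simp only [e3]
    rw [lintegral_mul_const' _ _ (PMF.apply_ne_top _ _), ← ih, ← ENNReal.tsum_mul_right]
    exact tsum_congr fun v => chainLaw_cylinder_succ P o (n + 1) _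

/-- Markov property of the chain after at most one step. -/
lemma chainLaw_map_shift (P : V → PMF V) (o : V) {k : ℕ} (hk : k ≤ 1) :
    (chainLaw P o).map (fun p i => p (k + i)) = (chainLaw P o).bind fun p => chainLaw P (p k) := by
  interval_cases k
  · have h1 : (fun (p : ℕ → V) i => p (0 + i)) = id := by funext p i; simp
    have h2 : ∀ᵐ p ∂(chainLaw P o), p 0 = o := by
      have := chainLaw_start P o o
      rw [if_pos rfl] at this
      exact (prob_compl_eq_zero_iff
        (measurableSet_eq_fun (measurable_pi_apply 0) measurable_const)).2 this
    have hm0 : Measurable fun p : ℕ → V => chainLaw P (p 0) :=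
      (measurable_of_countable fun v => chainLaw P v).comp (measurable_pi_apply 0)
    rw [h1, Measure.map_id]
    ext S hS
    rw [Measure.bind_apply hS hm0.aemeasurable]
    have : ∫⁻ p, chainLaw P (p 0) S ∂(chainLaw P o) = ∫⁻ _p, chainLaw P o S ∂(chainLaw P o) := by
      refine lintegral_congr_ae ?_
      filter_upwards [h2] with p hp
      rw [hp]
    rw [this]
    simp
  · exact chainLaw_map_shift_one P o

/-- The law of the position after `n` steps. -/
lemma chainLaw_eval (P : V → PMF V) (n : ℕ) (o v : V) :
    chainLaw P o {p | p n = v} = stepLaw P n o v := by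
  classical
  induction n generalizing o with
  | zero =>
    rw [chainLaw_start, stepLaw, PMF.pure_apply]
    simp [eq_comm]
  | succ n ih =>
    have mS : MeasurableSet {p : ℕ → V | p n = v} :=
      measurableSet_eq_fun (measurable_pi_apply n) measurable_const
    have hm1 : Measurable fun p : ℕ → V => chainLaw P (p 1) :=
      (measurable_of_countable fun v => chainLaw P v).comp (measurable_pi_apply 1)
    have h := congrArg (fun μ => μ {p : ℕ → V | p n = v}) (chainLaw_map_shift_one P o)
    rw [Measure.map_apply (measurable_shift 1) mS, Measure.bind_apply mS hm1.aemeasurable] at h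
    have e : (fun (p : ℕ → V) i => p (1 + i)) ⁻¹' {p | p n = v} = {p | p (n + 1) = v} := by
      ext p; simp [Nat.add_comm 1 n]
    rw [e] at h
    rw [h, stepLaw, PMF.bind_apply]
    simp only [ih]
    have hlaw : ∀ w, (chainLaw P o).map (fun p => p 1) {w} = P o w := by
      intro w
      rw [Measure.map_apply (measurable_pi_apply 1) (measurableSet_singleton w)]
      have e3 : (fun p : ℕ → V => p 1) ⁻¹' {w} =
          ⋃ u : V, {p : ℕ → V | ∀ i ≤ 0 + 1, p i = (fun j => if j = 0 then u else w) i} := by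
        ext p
        simp only [Set.mem_preimage, Set.mem_singleton_iff, Set.mem_iUnion, Set.mem_ofPred_eq]
        constructor
        · intro h
          refine ⟨p 0, fun i hi => ?_⟩
          interval_cases i <;> simp [h]
        · rintro ⟨u, h⟩
          simpa using h 1 le_rfl
      rw [e3, measure_iUnion _ fun u => measurableSet_cylinder_eq _ _]
      · simp_rw [chainLaw_cylinder_succ]
        have e4 : ∀ u : V, chainLaw P o {p : ℕ → V | ∀ i ≤ 0, p i = (fun j => if j = 0 then u else w) i} =
            if o = u then 1 else 0 := by
          intro u
          rw [← chainLaw_start P o u]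
          congr 1
          ext p
          simp
        simp_rw [e4]
        rw [tsum_eq_single o fun u hu => by simp [hu.symm]]
        simp
      · intro u u' huu
        refine Set.disjoint_left.2 fun p h1 h2 => huu ?_
        have h1' := h1 0 (Nat.zero_le _)
        have h2' := h2 0 (Nat.zero_le _)
        simp only [if_true] at h1' h2'
        rw [← h1', h2']
    have hi := lintegral_map (μ := chainLaw P o) (f := fun w => stepLaw P n w v)
      (g := fun p : ℕ → V => p 1) (measurable_of_countable _) (measurable_pi_apply 1)
    rw [← hi, lintegral_countable']
    refine tsum_congr fun w => ?_
    rw [hlaw, mul_comm]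

end Chain

/-! ### Independent chains -/

lemma lintegral_prod_pi {ι Ω : Type*} [Fintype ι] [MeasurableSpace Ω] (μ : ι → Measure Ω)
    [∀ j, IsProbabilityMeasure (μ j)] {f : ι → Ω → ENNReal} (hf : ∀ j, Measurable (f j)) :
    ∫⁻ Y, ∏ j, f j (Y j) ∂(Measure.pi μ) = ∏ j, ∫⁻ p, f j p ∂(μ j) := by
  have hind := iIndepFun_pi (μ := μ) (X := f) fun j => (hf j).aemeasurable
  refine (lintegral_prod_eq_prod_lintegral_of_indepFun Finset.univ
    (fun j (Y : ι → Ω) => f j (Y j)) hind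
    fun j => (hf j).comp (measurable_pi_apply j)).trans ?_
  refine Finset.prod_congr rfl fun j _ => ?_
  exact (measurePreserving_eval μ j).lintegral_comp (hf j)

section Chains

variable {V ι : Type*} [MeasurableSpace V]

lemma measurable_posAt (z : ι → ℕ) : Measurable fun Y : ι → ℕ → V => posAt Y z :=
  measurable_pi_lambda _ fun j => (measurable_pi_apply (z j)).comp (measurable_pi_apply j)

lemma measurable_shiftTraj (z : ι → ℕ) : Measurable fun Y : ι → ℕ → V => shiftTraj Y z :=
  measurable_pi_lambda _ fun j => (measurable_shift (z j)).comp (measurable_pi_apply j)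

variable [Fintype ι] [Countable V] [DiscreteMeasurableSpace V]

/-- The law of independent chains started from the points `x j`. -/
def chainsLaw (P : V → PMF V) (x : ι → V) : Measure (ι → ℕ → V) :=
  Measure.pi fun j => chainLaw P (x j)

instance isProbabilityMeasure_chainsLaw (P : V → PMF V) (x : ι → V) :
    IsProbabilityMeasure (chainsLaw P x) := by
  unfold chainsLaw; infer_instance

/-- Markov property of independent chains when each of them makes at most one step. -/
lemma lintegral_chainsLaw_shiftTraj (P : V → PMF V) (x : ι → V) {z : ι → ℕ} (hz : ∀ j, z j ≤ 1)
    {F : (ι → ℕ → V) → ENNReal} (hF : Measurable F) :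
    ∫⁻ Y, F (shiftTraj Y z) ∂(chainsLaw P x) =
      ∫⁻ Y, ∫⁻ Y', F Y' ∂(chainsLaw P (posAt Y z)) ∂(chainsLaw P x) := by
  have hm : Measurable fun Y : ι → ℕ → V => chainsLaw P (posAt Y z) :=
    (measurable_of_countable fun x => chainsLaw P x).comp (measurable_posAt z)
  have hmj : ∀ j, Measurable fun p : ℕ → V => chainLaw P (p (z j)) := fun j =>
    (measurable_of_countable fun v => chainLaw P v).comp (measurable_pi_apply _)
  have key : (chainsLaw P x).map (fun Y => shiftTraj Y z) =
      (chainsLaw P x).bind fun Y => chainsLaw P (posAt Y z) := by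
    have h1 : (chainsLaw P x).map (fun Y => shiftTraj Y z) =
        Measure.pi fun j => (chainLaw P (x j)).map fun p i => p (z j + i) := by
      have hprob : ∀ j, IsProbabilityMeasure ((chainLaw P (x j)).map fun (p : ℕ → V) i => p (z j + i)) :=
        fun j => Measure.isProbabilityMeasure_map (measurable_shift (z j)).aemeasurable
      exact Measure.pi_map_pi fun j => (measurable_shift (z j)).aemeasurable
    rw [h1]
    have hprob : ∀ j, IsProbabilityMeasure ((chainLaw P (x j)).map fun (p : ℕ → V) i => p (z j + i)) :=
      fun j => Measure.isProbabilityMeasure_map (measurable_shift (z j)).aemeasurable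
    refine Measure.pi_eq fun s hs => ?_
    rw [Measure.bind_apply (MeasurableSet.univ_pi hs) hm.aemeasurable]
    simp only [chainsLaw, Measure.pi_pi]
    have := lintegral_prod_pi (fun j => chainLaw P (x j))
      (f := fun j p => chainLaw P (p (z j)) (s j))
      fun j => (Measure.measurable_coe (hs j)).comp (hmj j)
    refine this.trans (Finset.prod_congr rfl fun j _ => ?_)
    rw [chainLaw_map_shift P (x j) (hz j), Measure.bind_apply (hs j) (hmj j).aemeasurable]
  rw [← lintegral_map hF (measurable_shiftTraj z), key,
    Measure.lintegral_bind hm.aemeasurable hF.aemeasurable]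

lemma ae_chainsLaw_start (P : V → PMF V) (x : ι → V) :
    ∀ᵐ Y ∂(chainsLaw P x), ∀ j, Y j 0 = x j := by
  classical
  refine ae_all_iff.2 fun j => ?_
  have h2 : ∀ᵐ p ∂(chainLaw P (x j)), p 0 = x j := by
    have := chainLaw_start P (x j) (x j)
    rw [if_pos rfl] at this
    exact (prob_compl_eq_zero_iff
      (measurableSet_eq_fun (measurable_pi_apply 0) measurable_const)).2 this
  exact (measurePreserving_eval (fun j => chainLaw P (x j)) j).quasiMeasurePreserving.ae h2

end Chains

/-! ### Averages over the chains and over the chosen slots -/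

section SlotMean

variable {V ι : Type*} [LinearOrder ι] [Fintype ι]

/-- Sum over `m` successive choices of slots of the products of the weights `w` along the moves
of the walkers, with terminal value `g`. -/
def trajSum (w : ι → (ι → V) → ENNReal) (g : (ι → V) → ENNReal) : ℕ → (ι → ℕ → V) → ENNReal
  | 0, Y => g (posAt Y 0)
  | m + 1, Y => ∑ s, w s (posAt Y 0) * trajSum w g m (shiftTraj Y (slotStep (posAt Y 0) s))

lemma slotStep_le_one (x : ι → V) (s j : ι) : slotStep x s j ≤ 1 := by
  unfold slotStep; split_ifs <;> simp

lemma slotOp_stepIdx_eq_trajSum (Y : ι → ℕ → V) (g : (ι → V) → ENNReal) (m : ℕ) (n : ι → ℕ) :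
    (slotOp (stepIdx Y))^[m] (fun n => g (posAt Y n)) n =
      trajSum (fun _ _ => 1) g m (shiftTraj Y n) := by
  induction m generalizing n with
  | zero => simp [trajSum]
  | succ m ih =>
    simp only [slotOp_iterate_succ, ih, trajSum, one_mul, posAt_shiftTraj, add_zero,
      shiftTraj_shiftTraj]
    rfl

/-- The move of the step counts of the walkers and of the numbers of choices of each slot. -/
def countStep (Y : ι → ℕ → V) (s : ι) (z : (ι → ℕ) × (ι → ℕ)) : (ι → ℕ) × (ι → ℕ) :=
  (stepIdx Y s z.1, z.2 + Pi.single s 1)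

/-- Increment of (step count of walker `j`) - (number of choices of slot `j`). -/
def gapIncr (j s : ι) (x : ι → V) : ℝ := (slotStep x s j : ℝ) - if s = j then 1 else 0

/-- The exponential of the gap is a product of the exponentials of its increments. Since each
increment depends only on the slot and the current positions, the choice counts disappear from the
right-hand side. -/
lemma slotOp_countStep_exp (Y : ι → ℕ → V) (l : ℝ) (j : ι) (m : ℕ) (z : (ι → ℕ) × (ι → ℕ)) :
    (slotOp (countStep Y))^[m]
        (fun z => ENNReal.ofReal (Real.exp (l * ((z.1 j : ℝ) - z.2 j)))) z =
      ENNReal.ofReal (Real.exp (l * ((z.1 j : ℝ) - z.2 j))) *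
        trajSum (fun s x => ENNReal.ofReal (Real.exp (l * gapIncr j s x))) (fun _ => 1) m
          (shiftTraj Y z.1) := by
  induction m generalizing z with
  | zero => simp [trajSum]
  | succ m ih =>
    simp only [slotOp_iterate_succ, ih, trajSum, Finset.mul_sum, posAt_shiftTraj, add_zero,
      shiftTraj_shiftTraj]
    refine Finset.sum_congr rfl fun s _ => ?_
    rw [← mul_assoc, ← ENNReal.ofReal_mul (Real.exp_nonneg _), ← Real.exp_add]
    congr 3
    simp only [countStep, stepIdx, gapIncr, Pi.add_apply, Pi.single_apply, eq_comm (a := j)]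
    push_cast
    split_ifs <;> ring_nf

/-- Arithmetic-geometric inequality for weighted sums over the moves. -/
lemma trajSum_exp_le (a b : ι → (ι → V) → ℝ) (m : ℕ) (Y : ι → ℕ → V) (p q : ℝ) :
    2 * ENNReal.ofReal (Real.exp ((p + q) / 2)) *
        trajSum (fun s x => ENNReal.ofReal (Real.exp (a s x))) (fun _ => 1) m Y ≤
      ENNReal.ofReal (Real.exp p) *
          trajSum (fun s x => ENNReal.ofReal (Real.exp (2 * a s x - b s x))) (fun _ => 1) m Y +
        ENNReal.ofReal (Real.exp q) *
          trajSum (fun s x => ENNReal.ofReal (Real.exp (b s x))) (fun _ => 1) m Y := by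
  induction m generalizing Y p q with
  | zero =>
    simp only [trajSum, mul_one]
    rw [← ENNReal.ofReal_add (Real.exp_nonneg _) (Real.exp_nonneg _),
      ← ENNReal.ofReal_ofNat 2, ← ENNReal.ofReal_mul (by norm_num)]
    refine ENNReal.ofReal_le_ofReal ?_
    have h1 : Real.exp p = Real.exp (p / 2) ^ 2 := by rw [← Real.exp_nat_mul]; congr 1; push_cast; ring
    have h2 : Real.exp q = Real.exp (q / 2) ^ 2 := by rw [← Real.exp_nat_mul]; congr 1; push_cast; ring
    have h3 : Real.exp ((p + q) / 2) = Real.exp (p / 2) * Real.exp (q / 2) := by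
      rw [← Real.exp_add]; congr 1; ring
    rw [h1, h2, h3]
    nlinarith [sq_nonneg (Real.exp (p / 2) - Real.exp (q / 2))]
  | succ m ih =>
    simp only [trajSum, Finset.mul_sum]
    rw [← Finset.sum_add_distrib]
    refine Finset.sum_le_sum fun s _ => ?_
    -- The free parameters p and q absorb the weights of the first move.
    have h := ih (shiftTraj Y (slotStep (posAt Y 0) s))
      (p + (2 * a s (posAt Y 0) - b s (posAt Y 0))) (q + b s (posAt Y 0))
    refine le_trans (le_of_eq ?_) (h.trans (le_of_eq ?_))
    · rw [← mul_assoc, mul_assoc 2, ← ENNReal.ofReal_mul (Real.exp_nonneg _), ← Real.exp_add]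
      congr 4
      ring
    · rw [Real.exp_add, Real.exp_add, ENNReal.ofReal_mul (Real.exp_nonneg _),
        ENNReal.ofReal_mul (Real.exp_nonneg _), mul_assoc, mul_assoc]

variable [MeasurableSpace V] [Countable V] [DiscreteMeasurableSpace V]

/-- The one-step operator corresponding to `trajSum`. -/
def slotMean (P : V → PMF V) (w : ι → (ι → V) → ENNReal) (h : (ι → V) → ENNReal) (x : ι → V) :
    ENNReal :=
  ∑ s, w s x * ∫⁻ Y, h (posAt Y (slotStep x s)) ∂(chainsLaw P x)

lemma slotMean_mono (P : V → PMF V) {w w' : ι → (ι → V) → ENNReal} (hw : ∀ s x, w s x ≤ w' s x)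
    {h h' : (ι → V) → ENNReal} (hh : ∀ x, h x ≤ h' x) (x : ι → V) :
    slotMean P w h x ≤ slotMean P w' h' x :=
  Finset.sum_le_sum fun s _ => mul_le_mul' (hw s x) (lintegral_mono fun _ => hh _)

lemma slotMean_const (P : V → PMF V) (w : ι → (ι → V) → ENNReal) (c : ENNReal) (x : ι → V) :
    slotMean P w (fun _ => c) x = (∑ s, w s x) * c := by
  simp [slotMean, Finset.sum_mul]

lemma measurable_trajSum (w : ι → (ι → V) → ENNReal) (g : (ι → V) → ENNReal) (m : ℕ) :
    Measurable (trajSum w g m) := by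
  induction m with
  | zero => exact (measurable_of_countable g).comp (measurable_posAt 0)
  | succ m ih =>
    refine Finset.measurable_sum _ fun s _ => ?_
    refine ((measurable_of_countable (w s)).comp (measurable_posAt 0)).mul ?_
    have h : Measurable fun z : (ι → V) × (ι → ℕ → V) =>
        trajSum w g m (shiftTraj z.2 (slotStep z.1 s)) :=
      measurable_from_prod_countable_right fun x => ih.comp (measurable_shiftTraj (slotStep x s))
    exact h.comp ((measurable_posAt 0).prodMk measurable_id)

lemma lintegral_trajSum (P : V → PMF V) (w : ι → (ι → V) → ENNReal) (g : (ι → V) → ENNReal) (m : ℕ)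
    (x : ι → V) :
    ∫⁻ Y, trajSum w g m Y ∂(chainsLaw P x) = (slotMean P w)^[m] g x := by
  induction m generalizing x with
  | zero =>
    have : ∫⁻ Y, trajSum w g 0 Y ∂(chainsLaw P x) = ∫⁻ _, g x ∂(chainsLaw P x) := by
      refine lintegral_congr_ae ?_
      filter_upwards [ae_chainsLaw_start P x] with Y hY
      have : posAt Y 0 = x := funext hY
      rw [trajSum, this]
    rw [this]
    simp
  | succ m ih =>
    have h1 : ∫⁻ Y, trajSum w g (m + 1) Y ∂(chainsLaw P x) =
        ∫⁻ Y, ∑ s, w s x * trajSum w g m (shiftTraj Y (slotStep x s)) ∂(chainsLaw P x) := by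
      refine lintegral_congr_ae ?_
      filter_upwards [ae_chainsLaw_start P x] with Y hY
      have : posAt Y 0 = x := funext hY
      rw [trajSum, this]
    have hm : ∀ s, Measurable fun Y : ι → ℕ → V => trajSum w g m (shiftTraj Y (slotStep x s)) :=
      fun s => (measurable_trajSum w g m).comp (measurable_shiftTraj _)
    rw [h1, lintegral_finsetSum _ fun s _ => (hm s).const_mul _, Function.iterate_succ_apply',
      slotMean]
    refine Finset.sum_congr rfl fun s _ => ?_
    rw [lintegral_const_mul _ (hm s), lintegral_chainsLaw_shiftTraj P x
      (fun j => slotStep_le_one x s j) (measurable_trajSum w g m)]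
    simp only [ih]

/-- The transition operator of the walkers when the slots are chosen uniformly. -/
def stepMean (P : V → PMF V) (h : (ι → V) → ENNReal) (x : ι → V) : ENNReal :=
  (Fintype.card ι : ENNReal)⁻¹ * ∑ s, ∫⁻ Y, h (posAt Y (slotStep x s)) ∂(chainsLaw P x)

lemma stepMean_mono (P : V → PMF V) {h h' : (ι → V) → ENNReal} (hh : ∀ x, h x ≤ h' x) (x : ι → V) :
    stepMean P h x ≤ stepMean P h' x := by
  refine mul_le_mul' le_rfl ?_
  exact Finset.sum_le_sum fun s _ => lintegral_mono fun Y => hh (posAt Y (slotStep x s))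

lemma stepMean_add (P : V → PMF V) (h h' : (ι → V) → ENNReal) (x : ι → V) :
    stepMean P (fun x => h x + h' x) x = stepMean P h x + stepMean P h' x := by
  simp only [stepMean]
  rw [← mul_add, ← Finset.sum_add_distrib]
  refine congrArg (_ * ·) (Finset.sum_congr rfl fun s _ => ?_)
  exact lintegral_add_left ((measurable_of_countable h).comp (measurable_posAt _)) _

lemma stepMean_const_mul (P : V → PMF V) (c : ENNReal) (h : (ι → V) → ENNReal) (x : ι → V) :
    stepMean P (fun x => c * h x) x = c * stepMean P h x := by
  simp only [stepMean]
  rw [mul_left_comm, Finset.mul_sum (a := c)]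
  congr 1
  refine Finset.sum_congr rfl fun s _ => ?_
  exact lintegral_const_mul _ ((measurable_of_countable h).comp (measurable_posAt _))

lemma stepMean_const [Nonempty ι] (P : V → PMF V) (c : ENNReal) (x : ι → V) :
    stepMean P (fun _ => c) x = c := by
  have h0 : (Fintype.card ι : ENNReal) ≠ 0 := by simp
  simp only [stepMean, lintegral_const, measure_univ, mul_one, Finset.sum_const, Finset.card_univ,
    nsmul_eq_mul]
  rw [← mul_assoc, ENNReal.inv_mul_cancel h0 (ENNReal.natCast_ne_top _), one_mul]

lemma slotMean_eq_stepMean [Nonempty ι] (P : V → PMF V) (w h : (ι → V) → ENNReal) (x : ι → V) :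
    slotMean P (fun _ : ι => w) h x = Fintype.card ι * (w x * stepMean P h x) := by
  have h0 : (Fintype.card ι : ENNReal) ≠ 0 := by simp
  rw [slotMean, ← Finset.mul_sum, stepMean, mul_left_comm (w x), ← mul_assoc,
    ENNReal.mul_inv_cancel h0 (ENNReal.natCast_ne_top _), one_mul]

lemma slotMean_one_iterate [Nonempty ι] (P : V → PMF V) (h : (ι → V) → ENNReal) (m : ℕ)
    (x : ι → V) :
    (slotMean P fun _ _ => 1)^[m] h x = (Fintype.card ι : ENNReal) ^ m * (stepMean P)^[m] h x := by
  induction m generalizing x with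
  | zero => simp
  | succ m ih =>
    rw [Function.iterate_succ_apply', Function.iterate_succ_apply', slotMean_eq_stepMean, one_mul]
    have : (slotMean P fun _ _ => 1)^[m] h =
        fun x => (Fintype.card ι : ENNReal) ^ m * (stepMean P)^[m] h x := funext ih
    rw [this, stepMean_const_mul, pow_succ]
    ring

lemma stepMean_iterate_mono (P : V → PMF V) {h h' : (ι → V) → ENNReal} (hh : ∀ x, h x ≤ h' x)
    (m : ℕ) (x : ι → V) : (stepMean P)^[m] h x ≤ (stepMean P)^[m] h' x := by
  induction m generalizing x with
  | zero => exact hh x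
  | succ m ih =>
    rw [Function.iterate_succ_apply', Function.iterate_succ_apply']
    exact stepMean_mono P ih x

lemma stepMean_iterate_const [Nonempty ι] (P : V → PMF V) (c : ENNReal) (m : ℕ) (x : ι → V) :
    (stepMean P)^[m] (fun _ => c) x = c := by
  induction m generalizing x with
  | zero => rfl
  | succ m ih =>
    rw [Function.iterate_succ_apply', funext ih, stepMean_const]

lemma stepMean_sum {κ : Type*} (P : V → PMF V) (S : Finset κ) (h : κ → (ι → V) → ENNReal)
    (x : ι → V) :
    stepMean P (fun x => ∑ i ∈ S, h i x) x = ∑ i ∈ S, stepMean P (h i) x := by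
  classical
  induction S using Finset.induction_on with
  | empty => simp [stepMean]
  | insert i S hi ih =>
    simp only [Finset.sum_insert hi, stepMean_add, ih]

lemma stepMean_iterate_sum {κ : Type*} (P : V → PMF V) (S : Finset κ) (h : κ → (ι → V) → ENNReal)
    (m : ℕ) (x : ι → V) :
    (stepMean P)^[m] (fun x => ∑ i ∈ S, h i x) x = ∑ i ∈ S, (stepMean P)^[m] (h i) x := by
  induction m generalizing x with
  | zero => rfl
  | succ m ih =>
    simp only [Function.iterate_succ_apply', funext ih, stepMean_sum]

/-- Khasminskii's lemma: multiplicative functionals with small expected additive part are bounded. -/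
lemma slotMean_iterate_le [Nonempty ι] (P : V → PMF V) (c : (ι → V) → ENNReal) (e : ENNReal) {M : ℕ}
    (hU : ∀ x, 2 * e * ∑ l ∈ Finset.range M, (stepMean P)^[l] c x ≤ 1) {m : ℕ} (hm : m ≤ M)
    (x : ι → V) :
    (slotMean P fun _ x => 1 + e * c x)^[m] (fun _ => 1) x ≤
      (Fintype.card ι : ENNReal) ^ m *
        (1 + 2 * e * ∑ l ∈ Finset.range m, (stepMean P)^[l] c x) := by
  induction m generalizing x with
  | zero => simp
  | succ m ih =>
    rw [Function.iterate_succ_apply', slotMean_eq_stepMean]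
    -- The crude bound 2|ι|^m, available while the additive part is small, is used only in the term
    -- carrying a factor e; the other term gets the sharp induction hypothesis.
    have h2 : ∀ x, (slotMean P fun _ x => 1 + e * c x)^[m] (fun _ => 1) x ≤
        (Fintype.card ι : ENNReal) ^ m * 2 := by
      intro x
      refine (ih (by omega) x).trans (mul_le_mul' le_rfl ?_)
      refine le_trans (b := 1 + 1) (add_le_add le_rfl (le_trans (mul_le_mul' le_rfl ?_) (hU x)))
        one_add_one_eq_two.le
      exact Finset.sum_le_sum_of_subset (Finset.range_mono (by omega))
    have h3 := (stepMean_mono P h2 x).trans (stepMean_const P _ x).le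
    have h4 := stepMean_mono P (ih (by omega)) x
    rw [stepMean_const_mul, stepMean_add, stepMean_const, stepMean_const_mul, stepMean_sum] at h4
    rw [add_mul, one_mul, pow_succ', mul_assoc,
      mul_assoc (Fintype.card ι : ENNReal)]
    refine mul_le_mul' le_rfl ((add_le_add h4
      (mul_le_mul' le_rfl (mul_le_mul' le_rfl h3))).trans (le_of_eq ?_))
    rw [Finset.sum_range_succ']
    simp only [Function.iterate_succ_apply', Function.iterate_zero_apply]
    ring

end SlotMean

lemma two_mul_le_rpow_two_add {a b : ENNReal} (ha : a ≠ ⊤) (hb : b ≠ ⊤) :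
    2 * (a * b) ≤ a ^ (2 : ℝ) + b ^ (2 : ℝ) := by
  lift a to NNReal using ha
  lift b to NNReal using hb
  rw [ENNReal.rpow_two, ENNReal.rpow_two, ← mul_assoc]
  exact_mod_cast two_mul_le_add_sq a b

/-! ### Collisions of two walkers -/

section Collision

variable {V ι : Type*} [Fintype ι]

section

variable [Countable V] [MeasurableSpace V] [DiscreteMeasurableSpace V]

lemma tsum_indicator_indexLaw (t : ℝ) (y : ι → ℕ → V) (A : Set (ι → ℕ)) :
    ∑' n, A.indicator 1 n * indexLaw t y n =
      clockLaw V {ξ | ∃ n ∈ A, ∀ j, IsAt ξ (y j) (n j) t} := by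
  set E : (ι → ℕ) → Set (V → ℕ → ℝ) := fun n => {ξ | n ∈ A ∧ ∀ j, IsAt ξ (y j) (n j) t} with hE
  have e : {ξ : V → ℕ → ℝ | ∃ n ∈ A, ∀ j, IsAt ξ (y j) (n j) t} = ⋃ n, E n := by
    ext ξ; simp [hE]
  have mE : ∀ n, MeasurableSet (E n) := fun n =>
    (MeasurableSet.const _).inter (measurableSet_forall_isAt y n t)
  rw [e, measure_iUnion₀ _ fun n => (mE n).nullMeasurableSet]
  · refine tsum_congr fun n => ?_
    by_cases hn : n ∈ A
    · simp [hE, hn, indexLaw]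
    · simp [hE, hn]
  · intro n m hnm
    refine measure_mono_null (t := {ξ | ¬ GoodClocks ξ}) (fun ξ hξ => ?_)
      (ae_iff.1 (ae_goodClocks (V := V)))
    intro hg
    refine hnm ?_
    funext j
    exact (hξ.1.2 j).unique hg (hξ.2.2 j)

open Classical in
/-- Indicator of the event that the walkers `i` and `j` are at the same place. -/
def collide (i j : ι) (x : ι → V) : ENNReal := if x i = x j then 1 else 0

/-- Given the clocks the trajectories are independent, so a collision has conditional probability
equal to a sum of products of quenched masses, and 2ab ≤ a^2 + b^2 reduces it to second moments. -/
lemma lintegral_collide_le (P : V → PMF V) (x : ι → V) {i j : ι} (hij : i ≠ j) {t : ℝ} (ht : 0 ≤ t) :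
    2 * ∫⁻ Y, ∑' n, collide i j (posAt Y n) * indexLaw t Y n ∂(chainsLaw P x) ≤
      moment P (x i) t 2 + moment P (x j) t 2 := by
  classical
  set M : Set ((ι → ℕ → V) × (V → ℕ → ℝ)) :=
    {z | ∃ v, (z.2, z.1 i) ∈ occ t v ∧ (z.2, z.1 j) ∈ occ t v} with hM
  have mM : MeasurableSet M := by
    have e : M = ⋃ v, {z | (z.2, z.1 i) ∈ occ t v} ∩ {z | (z.2, z.1 j) ∈ occ t v} := by
      ext z; simp [hM]
    rw [e]
    refine MeasurableSet.iUnion fun v => ?_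
    exact ((measurable_snd.prodMk ((measurable_pi_apply i).comp measurable_fst))
      (measurableSet_occ t v)).inter
      ((measurable_snd.prodMk ((measurable_pi_apply j).comp measurable_fst))
      (measurableSet_occ t v))
  have h1 : ∀ Y, ∑' n, collide i j (posAt Y n) * indexLaw t Y n ≤ clockLaw V (Prod.mk Y ⁻¹' M) := by
    intro Y
    have e : ∀ n, collide i j (posAt Y n) =
        {n : ι → ℕ | Y i (n i) = Y j (n j)}.indicator 1 n := by
      intro n
      simp only [collide, Set.indicator, posAt, Set.mem_ofPred_eq, Pi.one_apply]
      congr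
    simp only [e, tsum_indicator_indexLaw]
    refine measure_mono fun ξ hξ => ?_
    obtain ⟨n, hn, hat⟩ := hξ
    exact ⟨Y i (n i), Or.inl ⟨n i, hat i, rfl⟩, Or.inl ⟨n j, hat j, hn.symm⟩⟩
  have hind : IndepFun (fun Y : ι → ℕ → V => Y i) (fun Y => Y j) (chainsLaw P x) :=
    (iIndepFun_pi (μ := fun j => chainLaw P (x j)) (X := fun _ p => p)
      fun _ => aemeasurable_id).indepFun hij
  have h2 : ∀ ξ, chainsLaw P x ((fun Y => (Y, ξ)) ⁻¹' M) ≤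
      ∑' v, quenched P (x i) t v ξ * quenched P (x j) t v ξ := by
    intro ξ
    have mA : ∀ v, MeasurableSet {p : ℕ → V | (ξ, p) ∈ occ t v} := fun v =>
      measurable_prodMk_left (measurableSet_occ t v)
    have e : (fun Y : ι → ℕ → V => (Y, ξ)) ⁻¹' M =
        ⋃ v, (fun Y => Y i) ⁻¹' {p | (ξ, p) ∈ occ t v} ∩ (fun Y => Y j) ⁻¹' {p | (ξ, p) ∈ occ t v} := by
      ext Y; simp [hM]
    rw [e]
    refine (measure_iUnion_le _).trans (ENNReal.tsum_le_tsum fun v => ?_)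
    rw [hind.measure_inter_preimage_eq_mul _ _ (mA v) (mA v)]
    have hi := (measurePreserving_eval (fun j => chainLaw P (x j)) i).measure_preimage
      (mA v).nullMeasurableSet
    have hj := (measurePreserving_eval (fun j => chainLaw P (x j)) j).measure_preimage
      (mA v).nullMeasurableSet
    exact (congrArg₂ (· * ·) hi hj).le
  have h3 : ∫⁻ Y, clockLaw V (Prod.mk Y ⁻¹' M) ∂(chainsLaw P x) =
      ∫⁻ ξ, chainsLaw P x ((fun Y => (Y, ξ)) ⁻¹' M) ∂(clockLaw V) := by
    rw [← Measure.prod_apply mM, Measure.prod_apply_symm mM]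
  calc 2 * ∫⁻ Y, ∑' n, collide i j (posAt Y n) * indexLaw t Y n ∂(chainsLaw P x)
      ≤ 2 * ∫⁻ ξ, ∑' v, quenched P (x i) t v ξ * quenched P (x j) t v ξ ∂(clockLaw V) := by
        refine mul_le_mul' le_rfl ((lintegral_mono h1).trans ?_)
        rw [h3]
        exact lintegral_mono h2
    _ = ∫⁻ ξ, ∑' v, 2 * (quenched P (x i) t v ξ * quenched P (x j) t v ξ) ∂(clockLaw V) := by
        rw [← lintegral_const_mul' _ _ (by norm_num)]
        simp only [ENNReal.tsum_mul_left]
    _ ≤ ∫⁻ ξ, ∑' v, (quenched P (x i) t v ξ ^ (2 : ℝ) + quenched P (x j) t v ξ ^ (2 : ℝ))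
          ∂(clockLaw V) := by
        refine lintegral_mono fun ξ => ENNReal.tsum_le_tsum fun v => ?_
        exact two_mul_le_rpow_two_add (quenched_ne_top _ _ _ _ _) (quenched_ne_top _ _ _ _ _)
    _ = moment P (x i) t 2 + moment P (x j) t 2 := by
        simp only [ENNReal.tsum_add]
        rw [lintegral_add_left, moment_eq P _ ht, moment_eq P _ ht]
        exact Measurable.tsum fun v => (measurable_quenched P (x i) t v).pow_const _

variable [LinearOrder ι]

/-- No explosion occurs: the uniformization formula gives the law of the step counts total mass 1.
-/
lemma ae_exists_isAt {t : ℝ} (ht : 0 ≤ t) (y : ι → ℕ → V) :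
    ∀ᵐ ξ ∂(clockLaw V), ∃ n : ι → ℕ, ∀ j, IsAt ξ (y j) (n j) t := by
  have h := tsum_indicator_indexLaw t y Set.univ
  simp only [Set.indicator_univ, Pi.one_apply, one_mul, tsum_indexLaw ht, Set.mem_univ,
    true_and] at h
  have hm : MeasurableSet {ξ : V → ℕ → ℝ | ∃ n : ι → ℕ, ∀ j, IsAt ξ (y j) (n j) t} := by
    have : {ξ : V → ℕ → ℝ | ∃ n : ι → ℕ, ∀ j, IsAt ξ (y j) (n j) t} =
        ⋃ n : ι → ℕ, {ξ | ∀ j, IsAt ξ (y j) (n j) t} := by ext; simp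
    rw [this]
    exact MeasurableSet.iUnion fun n => measurableSet_forall_isAt y n t
  exact (prob_compl_eq_zero_iff hm).2 h.symm

/-- Averaged over the trajectories, the positions form a Markov chain with transition operator
`stepMean` observed at a Poisson time of mean t times the number of walkers. -/
lemma tsum_unifWeight_stepMean [Nonempty ι] (P : V → PMF V) (x : ι → V) {t : ℝ} (ht : 0 ≤ t)
    (g : (ι → V) → ENNReal) :
    ∑' m, unifWeight (Fintype.card ι) t m *
        ((Fintype.card ι : ENNReal) ^ m * (stepMean P)^[m] g x) =
      ∫⁻ Y, ∑' n, g (posAt Y n) * indexLaw t Y n ∂(chainsLaw P x) := by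
  have h1 : ∀ Y : ι → ℕ → V, ∑' n, g (posAt Y n) * indexLaw t Y n =
      ∑' m, unifWeight (Fintype.card ι) t m * trajSum (fun _ _ => 1) g m Y := by
    intro Y
    rw [tsum_mul_indexLaw ht Y fun n => g (posAt Y n)]
    refine tsum_congr fun m => ?_
    rw [slotOp_stepIdx_eq_trajSum, shiftTraj_zero]
  simp only [h1]
  rw [lintegral_tsum fun m => ((measurable_trajSum _ g m).const_mul _).aemeasurable]
  refine tsum_congr fun m => ?_
  rw [lintegral_const_mul _ (measurable_trajSum _ g m), lintegral_trajSum, slotMean_one_iterate]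

end

end Collision

/-! ### Poisson occupation times -/

section Poisson

lemma hasDerivAt_poisson_cdf (d : ℕ) (m : ℕ) (s : ℝ) :
    HasDerivAt (fun s : ℝ => -∑ l ∈ Finset.range (m + 1),
        Real.exp (-(d * s)) * ((l.factorial : ℝ)⁻¹ * (d * s) ^ l))
      (d * (Real.exp (-(d * s)) * ((m.factorial : ℝ)⁻¹ * (d * s) ^ m))) s := by
  have he : HasDerivAt (fun s : ℝ => Real.exp (-(d * s))) (Real.exp (-(d * s)) * (-d)) s := by
    have := ((hasDerivAt_id s).const_mul (d : ℝ)).neg.exp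
    simpa using this
  have hp : ∀ l : ℕ, HasDerivAt (fun s : ℝ => (d * s) ^ l) (l * (d * s) ^ (l - 1) * d) s := by
    intro l
    exact (((hasDerivAt_id s).const_mul (d : ℝ)).fun_pow l).congr_deriv (by simp)
  induction m with
  | zero =>
    have := he.neg
    simp only [zero_add, Finset.range_one, Finset.sum_singleton, Nat.factorial_zero, Nat.cast_one,
      inv_one, pow_zero, mul_one]
    exact this.congr_deriv (by ring)
  | succ m ih =>
    have h := ih.sub (he.mul ((hp (m + 1)).const_mul (((m + 1).factorial : ℝ)⁻¹)))
    have e : (fun s : ℝ => -∑ l ∈ Finset.range (m + 1 + 1),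
        Real.exp (-(d * s)) * ((l.factorial : ℝ)⁻¹ * (d * s) ^ l)) =
        (fun s : ℝ => -∑ l ∈ Finset.range (m + 1),
        Real.exp (-(d * s)) * ((l.factorial : ℝ)⁻¹ * (d * s) ^ l)) -
        ((fun s : ℝ => Real.exp (-(d * s))) * fun s => ((m + 1).factorial : ℝ)⁻¹ * (d * s) ^ (m + 1)) := by
      funext s
      rw [Finset.sum_range_succ]
      simp only [Pi.sub_apply, Pi.mul_apply]
      ring
    rw [e]
    refine h.congr_deriv ?_
    have h1 : ((m + 1).factorial : ℝ) = (m + 1) * m.factorial := by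
      rw [Nat.factorial_succ]; push_cast; ring
    have h2 : (m.factorial : ℝ) ≠ 0 := by positivity
    have h3 : (m + 1 : ℝ) ≠ 0 := by positivity
    rw [h1]
    simp only [Nat.add_sub_cancel]
    push_cast
    field_simp
    ring

/-- Chernoff bound with factor 2: for l ≤ m, u^l ≤ 2^m (u/2)^l. The exponent left is m log 2 - u/2,
which m ≤ u/4 and u ≥ 5 make at most -log 2. -/
lemma poisson_cdf_le {u : ℝ} (hu : 5 ≤ u) {m : ℕ} (hm : (m : ℝ) ≤ u / 4) :
    ∑ l ∈ Finset.range (m + 1), Real.exp (-u) * ((l.factorial : ℝ)⁻¹ * u ^ l) ≤ 1 / 2 := by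
  have h1 : ∑ l ∈ Finset.range (m + 1), Real.exp (-u) * ((l.factorial : ℝ)⁻¹ * u ^ l) ≤
      Real.exp (-u) * (2 ^ m * Real.exp (u / 2)) := by
    rw [← Finset.mul_sum]
    refine mul_le_mul_of_nonneg_left ?_ (Real.exp_nonneg _)
    have h2 : ∀ l ∈ Finset.range (m + 1), (l.factorial : ℝ)⁻¹ * u ^ l ≤
        2 ^ m * ((u / 2) ^ l / l.factorial) := by
      intro l hl
      have h3 : (2 : ℝ) ^ l ≤ 2 ^ m :=
        pow_le_pow_right₀ (by norm_num) (Nat.lt_succ_iff.1 (Finset.mem_range.1 hl))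
      have h4 : (l.factorial : ℝ)⁻¹ * u ^ l = 2 ^ l * ((u / 2) ^ l / l.factorial) := by
        rw [div_pow]; field_simp
      rw [h4]
      exact mul_le_mul_of_nonneg_right h3 (by positivity)
    refine (Finset.sum_le_sum h2).trans ?_
    rw [← Finset.mul_sum]
    exact mul_le_mul_of_nonneg_left (Real.sum_le_exp_of_nonneg (by linarith) _) (by positivity)
  have h5 : (2 : ℝ) ^ m = Real.exp (m * Real.log 2) := by
    rw [mul_comm, ← Real.rpow_natCast, Real.rpow_def_of_pos (by norm_num)]
  have hlog : Real.log 2 < 0.7 := by linarith [Real.log_two_lt_d9]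
  have hlog0 : 0 < Real.log 2 := Real.log_pos (by norm_num)
  have h6 : (1 : ℝ) / 2 = Real.exp (-Real.log 2) := by
    rw [Real.exp_neg, Real.exp_log (by norm_num)]; norm_num
  refine h1.trans ?_
  rw [h5, h6, ← Real.exp_add, ← Real.exp_add]
  refine Real.exp_le_exp.2 ?_
  nlinarith

/-- The integral is the expected time before t that a Poisson process of rate d spends at level m,
that is 1/d times the probability of having passed m by time t. For m at most a quarter of the mean,
this probability is at least 1/2. -/
lemma lintegral_unifWeight_ge {d : ℕ} {t : ℝ} (ht : 0 ≤ t) (hdt : 5 ≤ d * t) {m : ℕ}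
    (hm : (m : ℝ) ≤ d * t / 4) :
    ENNReal.ofReal (1 / (2 * d)) ≤
      ∫⁻ s in Set.Ioc 0 t, unifWeight d s m * (d : ENNReal) ^ m := by
  have hd : (0 : ℝ) < d := by
    rcases Nat.eq_zero_or_pos d with h | h
    · subst h; norm_num at hdt
    · exact_mod_cast h
  set f : ℝ → ℝ := fun s => Real.exp (-(d * s)) * ((m.factorial : ℝ)⁻¹ * (d * s) ^ m) with hf
  have hfc : Continuous f := by fun_prop
  have e : ∀ s ∈ Set.Ioc 0 t, unifWeight d s m * (d : ENNReal) ^ m = ENNReal.ofReal (f s) := by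
    intro s hs
    rw [unifWeight, ← ENNReal.ofReal_natCast, ← ENNReal.ofReal_pow (by positivity),
      ← ENNReal.ofReal_mul (by have := hs.1.le; positivity)]
    simp only [hf, mul_pow]
    congr 1
    ring
  rw [setLIntegral_congr_fun measurableSet_Ioc e, ← ofReal_integral_eq_lintegral_ofReal]
  · refine ENNReal.ofReal_le_ofReal ?_
    rw [← intervalIntegral.integral_of_le ht]
    have h1 := intervalIntegral.integral_eq_sub_of_hasDerivAt
      (fun s _ => hasDerivAt_poisson_cdf d m s) ((hfc.const_mul (d : ℝ)).intervalIntegrable 0 t)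
    have h2 : ∑ l ∈ Finset.range (m + 1), Real.exp (-(d * 0)) *
        ((l.factorial : ℝ)⁻¹ * (d * 0 : ℝ) ^ l) = 1 := by
      rw [Finset.sum_eq_single 0]
      · simp
      · intro l _ hl; simp [hl]
      · simp
    have h3 := poisson_cdf_le hdt hm
    rw [intervalIntegral.integral_const_mul, h2] at h1
    have h4 : 1 / 2 ≤ d * ∫ s in (0)..t, f s := by
      rw [h1]; linarith
    rw [div_le_iff₀ (by positivity)]
    linarith
  · exact (hfc.integrableOn_Icc (a := 0) (b := t)).mono_set Set.Ioc_subset_Icc_self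
  · refine (ae_restrict_iff' measurableSet_Ioc).2 (Filter.Eventually.of_forall fun s hs => ?_)
    have := hs.1.le
    simp only [hf, Pi.zero_apply]
    positivity

end Poisson

/-! ### Expected number of collisions in the uniformized chain -/

section Occupation

variable {V ι : Type*} [Fintype ι] [Countable V] [MeasurableSpace V] [DiscreteMeasurableSpace V]
  [LinearOrder ι] [Nonempty ι]

lemma measurable_unifWeight (d m : ℕ) : Measurable fun s => unifWeight d s m := by
  unfold unifWeight
  fun_prop

/-- Integrating the collision probability over continuous time up to t gives the integral of C
s^(-α), finite because α < 1. Each discrete step below level M contributes at least 1/(2d) to that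
time integral, which transfers the bound to a sum over steps. -/
lemma sum_stepMean_collide_le (P : V → PMF V) {C α t : ℝ} (hα : α < 1) (ht : 0 ≤ t)
    (hmom : ∀ (o : V) (s : ℝ), 0 < s → s ≤ t → moment P o s 2 ≤ ENNReal.ofReal (C * s ^ (-α)))
    (hC : 0 ≤ C) (hdt : 5 ≤ Fintype.card ι * t) {M : ℕ} (hM : (M : ℝ) ≤ Fintype.card ι * t / 4 + 1)
    {i j : ι} (hij : i ≠ j) (x : ι → V) :
    ∑ m ∈ Finset.range M, (stepMean P)^[m] (collide i j) x ≤
      ENNReal.ofReal (2 * Fintype.card ι * (C * (t ^ (1 - α) / (1 - α)))) := by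
  set d := Fintype.card ι with hd
  have hd0 : (0 : ℝ) < d := by exact_mod_cast Fintype.card_pos
  have hcol : ∀ s ∈ Set.Ioc 0 t, ∑' m, unifWeight d s m * ((d : ENNReal) ^ m *
      (stepMean P)^[m] (collide i j) x) ≤ ENNReal.ofReal (C * s ^ (-α)) := by
    intro s hs
    rw [tsum_unifWeight_stepMean P x hs.1.le]
    have h := lintegral_collide_le P x hij hs.1.le
    have h2 : moment P (x i) s 2 + moment P (x j) s 2 ≤ 2 * ENNReal.ofReal (C * s ^ (-α)) := by
      rw [two_mul]
      exact add_le_add (hmom _ s hs.1 hs.2) (hmom _ s hs.1 hs.2)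
    exact (ENNReal.mul_le_mul_iff_right (by norm_num) (by norm_num)).1 (h.trans h2)
  have hint : ∫⁻ s in Set.Ioc 0 t, ENNReal.ofReal (C * s ^ (-α)) =
      ENNReal.ofReal (C * (t ^ (1 - α) / (1 - α))) := by
    have hi : IntervalIntegrable (fun s : ℝ => C * s ^ (-α)) volume 0 t :=
      (intervalIntegral.intervalIntegrable_rpow' (by linarith)).const_mul C
    rw [← ofReal_integral_eq_lintegral_ofReal]
    · rw [← intervalIntegral.integral_of_le ht, intervalIntegral.integral_const_mul,
        integral_rpow (Or.inl (by linarith)), Real.zero_rpow (by linarith)]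
      congr 3
      · rw [sub_zero]; congr 1; ring
      · ring
    · exact (intervalIntegrable_iff_integrableOn_Ioc_of_le ht).1 hi
    · refine (ae_restrict_iff' measurableSet_Ioc).2 (Filter.Eventually.of_forall fun s hs => ?_)
      have := hs.1.le
      simp only [Pi.zero_apply]
      positivity
  have h1 : ENNReal.ofReal (1 / (2 * d)) * ∑ m ∈ Finset.range M, (stepMean P)^[m] (collide i j) x ≤
      ENNReal.ofReal (C * (t ^ (1 - α) / (1 - α))) := by
    rw [← hint]
    refine le_trans ?_ (setLIntegral_mono_ae' measurableSet_Ioc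
      (Filter.Eventually.of_forall hcol))
    rw [lintegral_tsum fun m => ((measurable_unifWeight d m).mul_const _).aemeasurable,
      Finset.mul_sum]
    refine le_trans (Finset.sum_le_sum fun m hm => ?_) (ENNReal.sum_le_tsum (Finset.range M))
    have e : ∀ s, unifWeight d s m * ((d : ENNReal) ^ m * (stepMean P)^[m] (collide i j) x) =
        unifWeight d s m * (d : ENNReal) ^ m * (stepMean P)^[m] (collide i j) x :=
      fun s => (mul_assoc _ _ _).symm
    simp only [e]
    rw [lintegral_mul_const _ ((measurable_unifWeight d m).mul_const _)]
    refine mul_le_mul' (lintegral_unifWeight_ge ht hdt ?_) le_rfl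
    have : m + 1 ≤ M := Finset.mem_range.1 hm
    have : (m : ℝ) + 1 ≤ M := by exact_mod_cast this
    linarith
  have h2 : ∑ m ∈ Finset.range M, (stepMean P)^[m] (collide i j) x =
      ENNReal.ofReal (2 * d) * (ENNReal.ofReal (1 / (2 * d)) *
        ∑ m ∈ Finset.range M, (stepMean P)^[m] (collide i j) x) := by
    rw [← mul_assoc, ← ENNReal.ofReal_mul (by positivity), mul_one_div_cancel (by positivity)]
    simp
  rw [h2, ENNReal.ofReal_mul (p := 2 * (d : ℝ)) (by positivity)]
  exact mul_le_mul' le_rfl h1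

/-- By the Markov property each further block of M steps starts afresh, and the bound U holds from
every starting point. -/
lemma sum_stepMean_iterate_blocks (P : V → PMF V) (g : (ι → V) → ENNReal) {M : ℕ} {U : ENNReal}
    (hU : ∀ x, ∑ m ∈ Finset.range M, (stepMean P)^[m] g x ≤ U) (q : ℕ) (x : ι → V) :
    ∑ m ∈ Finset.range (q * M), (stepMean P)^[m] g x ≤ q * U := by
  induction q with
  | zero => simp
  | succ q ih =>
    rw [Nat.succ_mul, Finset.sum_range_add]
    push_cast
    rw [add_mul, one_mul]
    refine add_le_add ih ?_
    have e : ∀ m, (stepMean P)^[q * M + m] g x = (stepMean P)^[q * M] ((stepMean P)^[m] g) x :=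
      fun m => by rw [Function.iterate_add_apply]
    simp only [e]
    rw [← stepMean_iterate_sum]
    exact (stepMean_iterate_mono P hU _ x).trans (stepMean_iterate_const P U _ x).le

/-- Expected number of steps that the walker `j` spends with walkers of smaller label. -/
lemma sum_stepMean_collide_le_of_horizon (P : V → PMF V) {C α t : ℝ} (hα : α < 1) (ht : 0 ≤ t)
    (hmom : ∀ (o : V) (s : ℝ), 0 < s → s ≤ t → moment P o s 2 ≤ ENNReal.ofReal (C * s ^ (-α)))
    (hC : 0 ≤ C) (hdt : 5 ≤ Fintype.card ι * t) {M : ℕ} (hM : (M : ℝ) ≤ 2 * (Fintype.card ι * t))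
    (S : Finset ι) {j : ι} (hj : j ∉ S) (x : ι → V) :
    ∑ m ∈ Finset.range M, (stepMean P)^[m] (fun x => ∑ i ∈ S, collide i j x) x ≤
      ENNReal.ofReal (18 * Fintype.card ι ^ 2 * (C * (t ^ (1 - α) / (1 - α)))) := by
  set d := Fintype.card ι with hd
  set N := ⌈d * t / 4⌉₊ with hN
  have hN1 : (N : ℝ) ≤ d * t / 4 + 1 := (Nat.ceil_lt_add_one (by positivity)).le
  have hN2 : d * t / 4 ≤ (N : ℝ) := Nat.le_ceil _
  -- Since 2dt is eight times dt/4, nine blocks of length N more than suffice; together with the 2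
  -- of the single-block bound they give the constant 18.
  have hMN : M ≤ 9 * N := by
    have : (M : ℝ) ≤ 9 * N := by linarith
    exact_mod_cast this
  have h1 : ∀ i ∈ S, ∑ m ∈ Finset.range M, (stepMean P)^[m] (collide i j) x ≤
      9 * ENNReal.ofReal (2 * d * (C * (t ^ (1 - α) / (1 - α)))) := by
    intro i hi
    have hij : i ≠ j := fun h => hj (h ▸ hi)
    refine (Finset.sum_le_sum_of_subset (Finset.range_mono hMN)).trans ?_
    exact sum_stepMean_iterate_blocks P (collide i j)
      (fun x => sum_stepMean_collide_le P hα ht hmom hC hdt hN1 hij x) 9 x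
  simp only [stepMean_iterate_sum]
  rw [Finset.sum_comm]
  refine (Finset.sum_le_sum h1).trans ?_
  rw [Finset.sum_const, nsmul_eq_mul]
  have hcard : (S.card : ENNReal) ≤ d := by exact_mod_cast Finset.card_le_univ S
  refine (mul_le_mul' hcard le_rfl).trans (le_of_eq ?_)
  rw [← ENNReal.ofReal_ofNat 9, ← ENNReal.ofReal_natCast d, ← ENNReal.ofReal_mul (by norm_num),
    ← ENNReal.ofReal_mul (by positivity)]
  congr 1
  ring

end Occupation

/-! ### Exponential moments of the gaps between step counts and choices -/

section Gap

variable {V ι : Type*} [LinearOrder ι] [Fintype ι]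

/-- Exactly one slot moves the walker j, namely that of the leader of its vertex. -/
lemma sum_slotStep (x : ι → V) (j : ι) : ∑ s, (slotStep x s j : ℝ) = 1 := by
  classical
  obtain ⟨s, hs, hlead⟩ := exists_leader x j
  rw [Finset.sum_eq_single s]
  · rw [slotStep, if_pos ⟨hs.symm, hlead⟩, Nat.cast_one]
  · intro r _ hr
    rw [slotStep, if_neg, Nat.cast_zero]
    rintro ⟨h1, h2⟩
    exact hr (le_antisymm (h2 s (hs.trans h1)) (hlead r (h1.symm.trans hs.symm)))
  · simp

/-- Whether the walker `j` shares its location with a walker of smaller label. -/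
def follower (j : ι) (x : ι → V) : ℝ := 1 - slotStep x j j

/-- For a leader all increments vanish. For a follower they are +1 at the slot of its leader and -1
at its own, hence of mean zero with sum of squares 2; then exp u ≤ 1 + u + u^2 for |u| ≤ 1. -/
lemma sum_exp_gapIncr_le (x : ι → V) (j : ι) {l : ℝ} (hl : |l| ≤ 1) :
    ∑ s, Real.exp (l * gapIncr j s x) ≤ Fintype.card ι + 2 * l ^ 2 * follower j x := by
  classical
  have h01 : ∀ s, (slotStep x s j : ℝ) ^ 2 = slotStep x s j := by
    intro s; unfold slotStep; split_ifs <;> simp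
  have hexp : ∀ s, Real.exp (l * gapIncr j s x) ≤
      1 + l * gapIncr j s x + l ^ 2 * gapIncr j s x ^ 2 := by
    intro s
    have hg : |gapIncr j s x| ≤ 1 := by
      unfold gapIncr slotStep
      split_ifs <;> simp
    have h1 : |l * gapIncr j s x| ≤ 1 := by
      rw [abs_mul]; exact mul_le_one₀ hl (abs_nonneg _) hg
    have h2 := (abs_le.1 (Real.abs_exp_sub_one_sub_id_le h1)).2
    nlinarith
  have hsq : ∀ s, gapIncr j s x ^ 2 = slotStep x s j + (if s = j then 1 else 0) -
      2 * if s = j then (slotStep x j j : ℝ) else 0 := by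
    intro s
    unfold gapIncr
    split_ifs with h
    · subst h; nlinarith [h01 s]
    · nlinarith [h01 s]
  have hs1 : ∑ s, gapIncr j s x = 0 := by
    simp only [gapIncr, Finset.sum_sub_distrib, sum_slotStep]
    simp
  have hs2 : ∑ s, gapIncr j s x ^ 2 = 2 * follower j x := by
    simp only [hsq, Finset.sum_sub_distrib, Finset.sum_add_distrib, sum_slotStep, ← Finset.mul_sum]
    simp only [Finset.sum_ite_eq', Finset.mem_univ, if_true, follower]
    ring
  refine (Finset.sum_le_sum fun s _ => hexp s).trans (le_of_eq ?_)
  rw [Finset.sum_add_distrib, Finset.sum_add_distrib, ← Finset.mul_sum, ← Finset.mul_sum, hs1, hs2]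
  simp
  ring

/-- A follower has at least one walker of smaller label at its vertex, so collision counts dominate
the quadratic variation of the gap. -/
lemma follower_le (j : ι) (x : ι → V) :
    ENNReal.ofReal (follower j x) ≤ ∑ i ∈ Finset.univ.filter (· < j), collide i j x := by
  classical
  by_cases h : ∀ i, x i = x j → j ≤ i
  · rw [follower, (slotStep_self_eq_one_iff x j).2 h]
    simp
  · push Not at h
    obtain ⟨i, hi, hij⟩ := h
    refine le_trans (b := 1) ?_ ?_
    · rw [← ENNReal.ofReal_one]
      refine ENNReal.ofReal_le_ofReal ?_
      unfold follower
      linarith [(Nat.cast_nonneg (slotStep x j j) : (0 : ℝ) ≤ _)]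
    · refine le_trans (b := collide i j x) (by rw [collide, if_pos hi]) ?_
      exact Finset.single_le_sum (f := fun i => collide i j x) (fun _ _ => zero_le)
        (Finset.mem_filter.2 ⟨Finset.mem_univ i, hij⟩)

lemma follower_mem (j : ι) (x : ι → V) : follower j x = 0 ∨ follower j x = 1 := by
  unfold follower slotStep
  split_ifs <;> simp

variable [Countable V] [MeasurableSpace V] [DiscreteMeasurableSpace V]

lemma slotMean_iterate_mono (P : V → PMF V) {w w' : ι → (ι → V) → ENNReal}
    (hw : ∀ s x, w s x ≤ w' s x) (h : (ι → V) → ENNReal) (m : ℕ) (x : ι → V) :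
    (slotMean P w)^[m] h x ≤ (slotMean P w')^[m] h x := by
  induction m generalizing x with
  | zero => exact le_rfl
  | succ m ih =>
    rw [Function.iterate_succ_apply', Function.iterate_succ_apply']
    exact slotMean_mono P hw ih x

lemma slotMean_iterate_one_le (P : V → PMF V) {w : ι → (ι → V) → ENNReal} {c : ENNReal}
    (hw : ∀ x, ∑ s, w s x ≤ c) (m : ℕ) (x : ι → V) :
    (slotMean P w)^[m] (fun _ => 1) x ≤ c ^ m := by
  induction m generalizing x with
  | zero => simp
  | succ m ih =>
    rw [Function.iterate_succ_apply']
    refine (slotMean_mono P (fun _ _ => le_rfl) ih x).trans ?_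
    rw [slotMean_const, pow_succ']
    exact mul_le_mul' (hw x) le_rfl

/-- The exponential of l times the gap is at most the mean of two factors: the exponential of 2l
times the gap, discounted by the time spent as a follower, and the exponential of that time. The
first is a supermartingale after normalization by |ι|^m; the second is bounded by Khasminskii's
lemma. -/
lemma lintegral_trajSum_gapIncr_le [Nonempty ι] (P : V → PMF V) (j : ι) {l U : ℝ}
    (hl : |2 * l| ≤ 1) (hl2 : 8 * l ^ 2 ≤ Fintype.card ι) {M : ℕ}
    (hU : ∀ x : ι → V, ∑ m ∈ Finset.range M, (stepMean P)^[m]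
      (fun x => ∑ i ∈ Finset.univ.filter (· < j), collide i j x) x ≤ ENNReal.ofReal U)
    (hlU : 32 * l ^ 2 * U ≤ Fintype.card ι) {m : ℕ} (hm : m ≤ M) (x : ι → V) :
    ∫⁻ Y, trajSum (fun s x => ENNReal.ofReal (Real.exp (l * gapIncr j s x))) (fun _ => 1) m Y
      ∂(chainsLaw P x) ≤ 2 * (Fintype.card ι : ENNReal) ^ m := by
  set d := Fintype.card ι with hd
  have hd0 : (0 : ℝ) < d := by exact_mod_cast Fintype.card_pos
  -- Chosen so that d + 2(2l)^2 = d(1 + ψ) ≤ d exp ψ, which is exactly the supermartingale property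
  -- on followers.
  set ψ : ℝ := 8 * l ^ 2 / d with hψ
  have hψ0 : 0 ≤ ψ := by positivity
  have hψ1 : ψ ≤ 1 := by rw [hψ, div_le_one hd0]; exact hl2
  have hψe : Real.exp ψ - 1 ≤ 2 * ψ := by
    have := (abs_le.1 (Real.abs_exp_sub_one_sub_id_le (abs_le.2 ⟨by linarith, hψ1⟩))).2
    nlinarith
  have hψe0 : 0 ≤ Real.exp ψ - 1 := by linarith [Real.add_one_le_exp ψ]
  have hF : ∀ x : ι → V, Real.exp (ψ * follower j x) = 1 + (Real.exp ψ - 1) * follower j x := by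
    intro x
    rcases follower_mem j x with h | h <;> simp [h]
  have h1 := fun Y => trajSum_exp_le (V := V) (fun s x => l * gapIncr j s x)
    (fun (_ : ι) x => ψ * follower j x) m Y 0 0
  simp only [add_zero, zero_div, Real.exp_zero, ENNReal.ofReal_one, mul_one, one_mul] at h1
  have h2 := lintegral_mono (μ := chainsLaw P x) h1
  rw [lintegral_const_mul _ (measurable_trajSum _ _ m), lintegral_add_left (measurable_trajSum _ _ m)] at h2
  have h3 : (slotMean P fun s x => ENNReal.ofReal
      (Real.exp (2 * (l * gapIncr j s x) - ψ * follower j x)))^[m] (fun _ => 1) x ≤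
      (d : ENNReal) ^ m := by
    refine slotMean_iterate_one_le P (fun x => ?_) m x
    rw [← ENNReal.ofReal_sum_of_nonneg fun _ _ => Real.exp_nonneg _, ← ENNReal.ofReal_natCast]
    refine ENNReal.ofReal_le_ofReal ?_
    have e : ∀ s, Real.exp (2 * (l * gapIncr j s x) - ψ * follower j x) =
        Real.exp ((2 * l) * gapIncr j s x) * Real.exp (-(ψ * follower j x)) := by
      intro s; rw [← Real.exp_add]; congr 1; ring
    simp only [e]
    rw [← Finset.sum_mul, Real.exp_neg, ← div_eq_mul_inv, div_le_iff₀ (Real.exp_pos _)]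
    refine (sum_exp_gapIncr_le x j hl).trans ?_
    have h4 : 1 + ψ * follower j x ≤ Real.exp (ψ * follower j x) := by
      linarith [Real.add_one_le_exp (ψ * follower j x)]
    refine le_trans (le_of_eq ?_) (mul_le_mul_of_nonneg_left h4 hd0.le)
    rw [hψ]
    field_simp
    ring
  have h5 : (slotMean P fun _ x => ENNReal.ofReal (Real.exp (ψ * follower j x)))^[m] (fun _ => 1) x ≤
      (d : ENNReal) ^ m * 2 := by
    set c : (ι → V) → ENNReal := fun x => ∑ i ∈ Finset.univ.filter (· < j), collide i j x with hc
    -- This is the smallness condition of Khasminskii's lemma with e = 2ψ ≥ exp ψ - 1; substituting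
    -- ψ produces the constant 32 of `hlU`.
    have hc1 : ∀ x, 2 * ENNReal.ofReal (2 * ψ) * ∑ l ∈ Finset.range M, (stepMean P)^[l] c x ≤ 1 := by
      intro x
      refine (mul_le_mul' le_rfl (hU x)).trans ?_
      rw [← ENNReal.ofReal_ofNat 2, ← ENNReal.ofReal_mul (by norm_num),
        ← ENNReal.ofReal_mul (by positivity), ← ENNReal.ofReal_one]
      refine ENNReal.ofReal_le_ofReal ?_
      rw [hψ, show 2 * (2 * (8 * l ^ 2 / (d : ℝ))) * U = 32 * l ^ 2 * U / d by ring,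
        div_le_one hd0]
      exact hlU
    refine (slotMean_iterate_mono P (w' := fun _ x => 1 + ENNReal.ofReal (2 * ψ) * c x)
      (fun _ x => ?_) _ m x).trans
      ((slotMean_iterate_le P c _ hc1 hm x).trans (mul_le_mul' le_rfl ?_))
    · rw [hF, ENNReal.ofReal_add zero_le_one, ENNReal.ofReal_one, ENNReal.ofReal_mul hψe0]
      · exact add_le_add le_rfl (mul_le_mul' (ENNReal.ofReal_le_ofReal hψe) (follower_le j x))
      · rcases follower_mem j x with h | h <;> simp [h, hψe0]
    · refine le_trans (b := 1 + 1) (add_le_add le_rfl (le_trans (mul_le_mul' le_rfl ?_) (hc1 x)))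
        one_add_one_eq_two.le
      exact Finset.sum_le_sum_of_subset (Finset.range_mono hm)
  have h6 := h2.trans (add_le_add ((lintegral_trajSum P _ _ m x).le.trans h3)
    ((lintegral_trajSum P _ _ m x).le.trans h5))
  refine (ENNReal.mul_le_mul_iff_right (a := 2) (by norm_num) (by norm_num)).1 (h6.trans ?_)
  calc (d : ENNReal) ^ m + (d : ENNReal) ^ m * 2 = (d : ENNReal) ^ m * 3 := by ring
    _ ≤ (d : ENNReal) ^ m * 4 := mul_le_mul' le_rfl (by norm_num)
    _ = 2 * (2 * (d : ENNReal) ^ m) := by ring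

end Gap

/-! ### Union bound over the step counts -/

section ChoiceCounts

variable {ι σ : Type*} [Fintype ι]

lemma slotOp_iterate_mono_of_invariant {f : ι → σ → σ} {S : Set σ} (hS : ∀ s, ∀ z ∈ S, f s z ∈ S)
    {F G : σ → ENNReal} (h : ∀ z ∈ S, F z ≤ G z) (m : ℕ) {z : σ} (hz : z ∈ S) :
    (slotOp f)^[m] F z ≤ (slotOp f)^[m] G z := by
  induction m generalizing z with
  | zero => exact h z hz
  | succ m ih =>
    simp only [slotOp_iterate_succ]
    exact Finset.sum_le_sum fun s _ => ih (hS s z hz)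

lemma measurable_slotOp_iterate {Ω : Type*} [MeasurableSpace Ω] (f : ι → σ → σ)
    {F : Ω → σ → ENNReal} (hF : ∀ z, Measurable fun ω => F ω z) (m : ℕ) (z : σ) :
    Measurable fun ω => (slotOp f)^[m] (F ω) z := by
  induction m generalizing z with
  | zero => exact hF z
  | succ m ih =>
    simp only [slotOp_iterate_succ]
    exact Finset.measurable_sum _ fun s _ => ih _

lemma lintegral_slotOp_iterate_le {Ω : Type*} [MeasurableSpace Ω] (μ : Measure Ω) (f : ι → σ → σ)
    {F : Ω → σ → ENNReal} (hF : ∀ z, Measurable fun ω => F ω z) {B : ENNReal}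
    (hB : ∀ z, ∫⁻ ω, F ω z ∂μ ≤ B) (m : ℕ) (z : σ) :
    ∫⁻ ω, (slotOp f)^[m] (F ω) z ∂μ ≤ (Fintype.card ι : ENNReal) ^ m * B := by
  induction m generalizing z with
  | zero => simpa using hB z
  | succ m ih =>
    simp only [slotOp_iterate_succ]
    rw [lintegral_finsetSum _ fun s _ => measurable_slotOp_iterate f hF m _]
    refine (Finset.sum_le_sum fun s _ => ih _).trans (le_of_eq ?_)
    rw [Finset.sum_const, Finset.card_univ, nsmul_eq_mul, pow_succ', mul_assoc]

lemma slotOp_count_exp [LinearOrder ι] (θ a : ℝ) (j : ι) (m : ℕ) (K : ι → ℕ) :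
    (slotOp fun s (K : ι → ℕ) => K + Pi.single s 1)^[m]
        (fun K => ENNReal.ofReal (Real.exp (θ * ((K j : ℝ) - a)))) K =
      ENNReal.ofReal (Real.exp (θ * ((K j : ℝ) - a))) *
        ENNReal.ofReal (Fintype.card ι - 1 + Real.exp θ) ^ m := by
  have h1 : (1 : ℝ) ≤ Fintype.card ι := by exact_mod_cast Fintype.card_pos_iff.2 ⟨j⟩
  induction m generalizing K with
  | zero => simp
  | succ m ih =>
    simp only [slotOp_iterate_succ, ih, ← Finset.sum_mul]
    rw [pow_succ', ← mul_assoc]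
    congr 1
    rw [← ENNReal.ofReal_sum_of_nonneg fun _ _ => Real.exp_nonneg _,
      ← ENNReal.ofReal_mul (Real.exp_nonneg _)]
    congr 1
    have e : ∀ s, Real.exp (θ * (((K + Pi.single s 1 : ι → ℕ) j : ℝ) - a)) =
        Real.exp (θ * ((K j : ℝ) - a)) * (1 + if s = j then Real.exp θ - 1 else 0) := by
      intro s
      simp only [Pi.add_apply, Pi.single_apply, eq_comm (a := j)]
      split_ifs
      · rw [add_sub_cancel, ← Real.exp_add]
        congr 1
        push_cast
        ring
      · simp
    simp only [e]
    rw [← Finset.mul_sum, Finset.sum_add_distrib]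
    simp
    ring

/-- This is the exponential moment of a Poisson variable of mean t, the number of choices of a fixed
slot. It is used with θ = log 2, a = 2t and with θ = -log 2, a = t/2 to confine that number to [t/2,
2t]. -/
lemma tsum_unifWeight_count_exp [LinearOrder ι] {t : ℝ} (ht : 0 ≤ t) (θ a : ℝ) (j : ι) :
    ∑' m, unifWeight (Fintype.card ι) t m * (slotOp fun s (K : ι → ℕ) => K + Pi.single s 1)^[m]
        (fun K => ENNReal.ofReal (Real.exp (θ * ((K j : ℝ) - a)))) 0 =
      ENNReal.ofReal (Real.exp (t * (Real.exp θ - 1) - θ * a)) := by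
  have h1 : (1 : ℝ) ≤ Fintype.card ι := by exact_mod_cast Fintype.card_pos_iff.2 ⟨j⟩
  simp only [slotOp_count_exp]
  have e : ∀ m, unifWeight (Fintype.card ι) t m *
      (ENNReal.ofReal (Real.exp (θ * (((0 : ι → ℕ) j : ℝ) - a))) *
        ENNReal.ofReal (Fintype.card ι - 1 + Real.exp θ) ^ m) =
      ENNReal.ofReal (Real.exp (θ * (((0 : ι → ℕ) j : ℝ) - a))) *
        (unifWeight (Fintype.card ι) t m * ENNReal.ofReal (Fintype.card ι - 1 + Real.exp θ) ^ m) :=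
    fun m => by ring
  simp only [e]
  rw [ENNReal.tsum_mul_left, tsum_unifWeight_mul_pow _ ht (by linarith [Real.exp_nonneg θ]),
    ← ENNReal.ofReal_mul (Real.exp_nonneg _), ← Real.exp_add, ← Real.exp_add]
  congr 2
  simp
  ring

end ChoiceCounts

/-! ### From meetings to coincidences of trajectories near the choice counts -/

section UnionBound

variable {V ι : Type*}

open Classical in
/-- Indicator of the event that all the walkers are at the same place. -/
def meet (x : ι → V) : ENNReal := if ∃ v, ∀ j, x j = v then 1 else 0

lemma meet_le_one (x : ι → V) : meet x ≤ 1 := by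
  unfold meet; split_ifs <;> simp

variable [LinearOrder ι]

lemma slotStep_bot {b : ι} (hb : ∀ i, b ≤ i) (x : ι → V) (s : ι) :
    slotStep x s b = if s = b then 1 else 0 := by
  unfold slotStep
  by_cases h : s = b
  · subst h
    simp [hb]
  · rw [if_neg h, if_neg]
    rintro ⟨h1, h2⟩
    exact h (le_antisymm (h2 b h1) (hb s))

/-- The walker of least label always leads its vertex, so it steps precisely when its own slot is
chosen. This invariant saves one factor 2R + 1 in the union bound. -/
lemma countStep_bot {b : ι} (hb : ∀ i, b ≤ i) (Y : ι → ℕ → V) (s : ι)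
    (z : (ι → ℕ) × (ι → ℕ)) (hz : z ∈ {z : (ι → ℕ) × (ι → ℕ) | z.1 b = z.2 b}) :
    countStep Y s z ∈ {z : (ι → ℕ) × (ι → ℕ) | z.1 b = z.2 b} := by
  have h : z.1 b = z.2 b := hz
  have : (stepIdx Y s z.1) b = (z.2 + Pi.single s 1 : ι → ℕ) b := by
    simp only [stepIdx, Pi.add_apply, slotStep_bot hb, Pi.single_apply, h, eq_comm (a := b)]
  exact this

variable [Fintype ι]

/-- Step counts within `R` of the numbers of choices `K`, equal to them for the walker `b`. -/
def countBox (b : ι) (R : ℕ) (K : ι → ℕ) : Finset (ι → ℕ) :=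
  Fintype.piFinset fun j => if j = b then {K b} else Finset.Icc (K j - R) (K j + R)

lemma card_countBox_le (b : ι) (R : ℕ) (K : ι → ℕ) :
    (countBox b R K).card ≤ (2 * R + 1) ^ (Fintype.card ι - 1) := by
  rw [countBox, Fintype.card_piFinset, ← Finset.mul_prod_erase _ _ (Finset.mem_univ b), if_pos rfl,
    Finset.card_singleton, one_mul]
  refine (Finset.prod_le_pow_card _ _ (2 * R + 1) fun j hj => ?_).trans (le_of_eq ?_)
  · rw [if_neg (Finset.ne_of_mem_erase hj), Nat.card_Icc]
    omega
  · rw [Finset.card_erase_of_mem (Finset.mem_univ b), Finset.card_univ]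

open Classical in
/-- Number of coincidences of the trajectories near typical numbers of choices. -/
def nearMeet (b : ι) (R : ℕ) (t : ℝ) (Y : ι → ℕ → V) (K : ι → ℕ) : ENNReal :=
  if ∀ j, t / 2 ≤ K j ∧ (K j : ℝ) ≤ 2 * t then ∑ z ∈ countBox b R K, meet (posAt Y z) else 0

lemma one_le_ofReal_exp {u : ℝ} (hu : 0 ≤ u) : 1 ≤ ENNReal.ofReal (Real.exp u) := by
  rw [← ENNReal.ofReal_one]
  exact ENNReal.ofReal_le_ofReal (Real.one_le_exp hu)

/-- A coincidence of the walkers is a coincidence of trajectories near the numbers of choices,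
unless there is a large deviation. -/
lemma meet_le (Y : ι → ℕ → V) (b : ι) (R : ℕ) (t l : ℝ) (hl : 0 ≤ l)
    (z : (ι → ℕ) × (ι → ℕ)) (hz : z.1 b = z.2 b) :
    meet (posAt Y z.1) ≤ nearMeet b R t Y z.2 +
      ((∑ j, ENNReal.ofReal (Real.exp (Real.log 2 * ((z.2 j : ℝ) - 2 * t)))) +
      ((∑ j, ENNReal.ofReal (Real.exp (-Real.log 2 * ((z.2 j : ℝ) - t / 2)))) +
      ENNReal.ofReal (Real.exp (-(l * R))) * ((∑ j, ENNReal.ofReal (Real.exp (l * ((z.1 j : ℝ) - z.2 j)))) +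
        ∑ j, ENNReal.ofReal (Real.exp (-l * ((z.1 j : ℝ) - z.2 j)))))) := by
  have hlog : 0 < Real.log 2 := Real.log_pos (by norm_num)
  -- In each of the four exceptional cases one of the exponentials is at least 1 and dominates the
  -- indicator (Markov's inequality before averaging).
  by_cases h1 : ∃ j, 2 * t < z.2 j
  · obtain ⟨j, hj⟩ := h1
    refine (meet_le_one _).trans (le_trans ?_ (le_add_self.trans' le_self_add))
    refine le_trans ?_ (Finset.single_le_sum (fun _ _ => zero_le) (Finset.mem_univ j))
    exact one_le_ofReal_exp (mul_nonneg hlog.le (by linarith))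
  by_cases h2 : ∃ j, (z.2 j : ℝ) < t / 2
  · obtain ⟨j, hj⟩ := h2
    refine (meet_le_one _).trans (le_trans ?_
      (le_add_self.trans' (le_add_self.trans' le_self_add)))
    refine le_trans ?_ (Finset.single_le_sum (fun _ _ => zero_le) (Finset.mem_univ j))
    exact one_le_ofReal_exp (by nlinarith)
  by_cases h3 : ∃ j, (z.2 j : ℝ) + R < z.1 j
  · obtain ⟨j, hj⟩ := h3
    refine (meet_le_one _).trans (le_trans ?_
      (le_add_self.trans' (le_add_self.trans' (le_add_self.trans' (mul_le_mul' le_rfl le_self_add)))))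
    refine le_trans ?_ (mul_le_mul' le_rfl
      (Finset.single_le_sum (fun _ _ => zero_le) (Finset.mem_univ j)))
    rw [← ENNReal.ofReal_mul (Real.exp_nonneg _), ← Real.exp_add]
    exact one_le_ofReal_exp (by nlinarith)
  by_cases h4 : ∃ j, (z.1 j : ℝ) + R < z.2 j
  · obtain ⟨j, hj⟩ := h4
    refine (meet_le_one _).trans (le_trans ?_
      (le_add_self.trans' (le_add_self.trans' (le_add_self.trans' (mul_le_mul' le_rfl le_add_self)))))
    refine le_trans ?_ (mul_le_mul' le_rfl
      (Finset.single_le_sum (fun _ _ => zero_le) (Finset.mem_univ j)))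
    rw [← ENNReal.ofReal_mul (Real.exp_nonneg _), ← Real.exp_add]
    exact one_le_ofReal_exp (by nlinarith)
  push Not at h1 h2 h3 h4
  refine le_trans ?_ le_self_add
  rw [nearMeet, if_pos fun j => ⟨h2 j, h1 j⟩]
  refine Finset.single_le_sum (f := fun z => meet (posAt Y z)) (fun _ _ => zero_le) ?_
  rw [countBox, Fintype.mem_piFinset]
  intro j
  split_ifs with hj
  · subst hj; simp [hz]
  · have h3' : z.1 j ≤ z.2 j + R := by exact_mod_cast h3 j
    have h4' : z.2 j ≤ z.1 j + R := by exact_mod_cast h4 j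
    rw [Finset.mem_Icc]
    omega

lemma trajSum_meet_eq (Y : ι → ℕ → V) (m : ℕ) :
    trajSum (fun _ _ => 1) meet m Y =
      (slotOp (countStep Y))^[m] (fun z => meet (posAt Y z.1)) (0, 0) := by
  rw [slotOp_iterate_comp (f := countStep Y) (g := stepIdx Y) Prod.fst (fun _ _ => rfl) m
    (fun n => meet (posAt Y n)), slotOp_stepIdx_eq_trajSum, shiftTraj_zero]

lemma trajSum_meet_le_pow (Y : ι → ℕ → V) (m : ℕ) :
    trajSum (fun _ _ => 1) meet m Y ≤ (Fintype.card ι : ENNReal) ^ m := by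
  rw [trajSum_meet_eq, ← slotOp_iterate_one (countStep Y) m (0, 0)]
  exact slotOp_iterate_mono _ _ (fun z => meet_le_one _) _

lemma trajSum_meet_le (Y : ι → ℕ → V) {b : ι} (hb : ∀ i, b ≤ i) (R : ℕ) (t : ℝ) {l : ℝ}
    (hl : 0 ≤ l) (m : ℕ) :
    trajSum (fun _ _ => 1) meet m Y ≤
      (slotOp fun s (K : ι → ℕ) => K + Pi.single s 1)^[m] (nearMeet b R t Y) 0 +
      ((∑ j, (slotOp fun s (K : ι → ℕ) => K + Pi.single s 1)^[m]
        (fun K => ENNReal.ofReal (Real.exp (Real.log 2 * ((K j : ℝ) - 2 * t)))) 0) +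
      ((∑ j, (slotOp fun s (K : ι → ℕ) => K + Pi.single s 1)^[m]
        (fun K => ENNReal.ofReal (Real.exp (-Real.log 2 * ((K j : ℝ) - t / 2)))) 0) +
      ENNReal.ofReal (Real.exp (-(l * R))) *
        ((∑ j, trajSum (fun s x => ENNReal.ofReal (Real.exp (l * gapIncr j s x))) (fun _ => 1) m Y) +
        ∑ j, trajSum (fun s x => ENNReal.ofReal (Real.exp (-l * gapIncr j s x))) (fun _ => 1) m Y))) := by
  have hsnd : ∀ (F : (ι → ℕ) → ENNReal), (slotOp (countStep Y))^[m] (fun z => F z.2) (0, 0) =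
      (slotOp fun s (K : ι → ℕ) => K + Pi.single s 1)^[m] F 0 := fun F =>
    slotOp_iterate_comp Prod.snd (fun _ _ => rfl) m F (0, 0)
  have hgap : ∀ (l : ℝ) (j : ι), (slotOp (countStep Y))^[m]
        (fun z => ENNReal.ofReal (Real.exp (l * ((z.1 j : ℝ) - z.2 j)))) (0, 0) =
      trajSum (fun s x => ENNReal.ofReal (Real.exp (l * gapIncr j s x))) (fun _ => 1) m Y := by
    intro l j
    rw [slotOp_countStep_exp]
    simp
  rw [trajSum_meet_eq]
  refine (slotOp_iterate_mono_of_invariant (countStep_bot hb Y)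
    (fun z hz => meet_le Y b R t l hl z hz) m (z := (0, 0)) rfl).trans (le_of_eq ?_)
  rw [slotOp_iterate_add, slotOp_iterate_add, slotOp_iterate_add, slotOp_iterate_const_mul,
    slotOp_iterate_add, slotOp_iterate_sum, slotOp_iterate_sum, slotOp_iterate_sum,
    slotOp_iterate_sum, hsnd]
  have hK : ∀ (θ a : ℝ) (j : ι), (slotOp (countStep Y))^[m]
        (fun z => ENNReal.ofReal (Real.exp (θ * ((z.2 j : ℝ) - a)))) (0, 0) =
      (slotOp fun s (K : ι → ℕ) => K + Pi.single s 1)^[m]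
        (fun K => ENNReal.ofReal (Real.exp (θ * ((K j : ℝ) - a)))) 0 := fun θ a j =>
    hsnd fun K => ENNReal.ofReal (Real.exp (θ * ((K j : ℝ) - a)))
  simp only [hgap, hK]

variable [Countable V] [MeasurableSpace V] [DiscreteMeasurableSpace V]

lemma measurable_meet (z : ι → ℕ) : Measurable fun Y : ι → ℕ → V => meet (posAt Y z) :=
  (measurable_of_countable meet).comp (measurable_posAt z)

lemma measurable_nearMeet (b : ι) (R : ℕ) (t : ℝ) (K : ι → ℕ) :
    Measurable fun Y : ι → ℕ → V => nearMeet b R t Y K := by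
  unfold nearMeet
  split_ifs
  · exact Finset.measurable_sum _ fun z _ => measurable_meet z
  · exact measurable_const

/-- At a given vertex v every factor but that of b is at most β; the factors of b then sum to 1 over
v. -/
lemma lintegral_meet_le (P : V → PMF V) (x : ι → V) (b : ι) (z : ι → ℕ) {β : ENNReal}
    (hβ : ∀ j, j ≠ b → ∀ u v, stepLaw P (z j) u v ≤ β) :
    ∫⁻ Y, meet (posAt Y z) ∂(chainsLaw P x) ≤ β ^ (Fintype.card ι - 1) := by
  classical
  have h1 : ∫⁻ Y, meet (posAt Y z) ∂(chainsLaw P x) ≤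
      chainsLaw P x (⋃ v, Set.pi Set.univ fun j => {p : ℕ → V | p (z j) = v}) := by
    rw [← lintegral_indicator_one]
    · refine lintegral_mono fun Y => ?_
      unfold meet
      split_ifs with h
      · obtain ⟨v, hv⟩ := h
        rw [Set.indicator_of_mem]
        · rfl
        · exact Set.mem_iUnion.2 ⟨v, fun j _ => hv j⟩
      · exact zero_le
    · exact MeasurableSet.iUnion fun v => MeasurableSet.univ_pi fun j =>
        measurableSet_eq_fun (measurable_pi_apply _) measurable_const
  refine h1.trans ((measure_iUnion_le _).trans ?_)
  have h2 : ∀ v, chainsLaw P x (Set.pi Set.univ fun j => {p : ℕ → V | p (z j) = v}) ≤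
      stepLaw P (z b) (x b) v * β ^ (Fintype.card ι - 1) := by
    intro v
    rw [chainsLaw, Measure.pi_pi]
    simp only [chainLaw_eval]
    rw [← Finset.mul_prod_erase _ _ (Finset.mem_univ b)]
    refine mul_le_mul' le_rfl ((Finset.prod_le_pow_card _ _ β fun j hj => ?_).trans (le_of_eq ?_))
    · exact hβ j (Finset.ne_of_mem_erase hj) _ _
    · rw [Finset.card_erase_of_mem (Finset.mem_univ b), Finset.card_univ]
  refine (ENNReal.tsum_le_tsum h2).trans ?_
  rw [ENNReal.tsum_mul_right, PMF.tsum_coe, one_mul]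

/-- For fixed K this is a union bound over the box. As K lies in [t/2, 2t] and R ≤ t/4, all step
counts lie between t/4 and 3t, where β is valid. -/
lemma lintegral_nearMeet_le (P : V → PMF V) (x : ι → V) (b : ι) {R : ℕ} {t : ℝ} (hR : R ≤ t / 4)
    {β : ENNReal} (hβ : ∀ n : ℕ, t / 4 ≤ n → (n : ℝ) ≤ 3 * t → ∀ u v, stepLaw P n u v ≤ β)
    (K : ι → ℕ) :
    ∫⁻ Y, nearMeet b R t Y K ∂(chainsLaw P x) ≤ ((2 * R + 1) * β) ^ (Fintype.card ι - 1) := by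
  unfold nearMeet
  split_ifs with h
  · rw [lintegral_finsetSum _ fun z _ => measurable_meet z]
    have h1 : ∀ z ∈ countBox b R K, ∫⁻ Y, meet (posAt Y z) ∂(chainsLaw P x) ≤
        β ^ (Fintype.card ι - 1) := by
      intro z hz
      refine lintegral_meet_le P x b z fun j hj => ?_
      rw [countBox, Fintype.mem_piFinset] at hz
      have hzj := hz j
      rw [if_neg hj, Finset.mem_Icc] at hzj
      have h2 : (K j : ℝ) ≤ z j + R := by
        have : K j ≤ z j + R := by omega
        exact_mod_cast this
      have h3 : (z j : ℝ) ≤ K j + R := by exact_mod_cast hzj.2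
      have h4 := h j
      have hR0 : (0 : ℝ) ≤ R := Nat.cast_nonneg R
      exact hβ (z j) (by linarith) (by linarith)
    refine (Finset.sum_le_sum h1).trans ?_
    rw [Finset.sum_const, nsmul_eq_mul, mul_pow]
    refine mul_le_mul' ?_ le_rfl
    exact_mod_cast card_countBox_le b R K
  · simp

/-- Upper bound for the probability that all the walkers are at the same place at time `t`. -/
lemma lintegral_tsum_meet_le [Nonempty ι] (P : V → PMF V) (x : ι → V) {b : ι} (hb : ∀ i, b ≤ i)
    {R : ℕ} {t l : ℝ} (ht : 0 ≤ t) (hl : 0 ≤ l) (hR : R ≤ t / 4) {β : ENNReal}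
    (hβ : ∀ n : ℕ, t / 4 ≤ n → (n : ℝ) ≤ 3 * t → ∀ u v, stepLaw P n u v ≤ β)
    (hgap : ∀ m : ℕ, (m : ℝ) ≤ 2 * (Fintype.card ι * t) → ∀ j : ι, ∀ u : ℝ, u = l ∨ u = -l →
      ∫⁻ Y, trajSum (fun s x => ENNReal.ofReal (Real.exp (u * gapIncr j s x))) (fun _ => 1) m Y
        ∂(chainsLaw P x) ≤ 2 * (Fintype.card ι : ENNReal) ^ m) :
    ∫⁻ Y, ∑' n, meet (posAt Y n) * indexLaw t Y n ∂(chainsLaw P x) ≤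
      ((2 * R + 1) * β) ^ (Fintype.card ι - 1) +
      (Fintype.card ι * ENNReal.ofReal (Real.exp (t * (1 - 2 * Real.log 2))) +
      (Fintype.card ι * ENNReal.ofReal (Real.exp (t * (Real.log 2 / 2 - 1 / 2))) +
      (4 * Fintype.card ι * ENNReal.ofReal (Real.exp (-(l * R))) +
        ENNReal.ofReal (Real.exp (Fintype.card ι * t * (1 - 2 * Real.log 2)))))) := by
  set d := Fintype.card ι with hd
  have hlog : 0 < Real.log 2 := Real.log_pos (by norm_num)
  have he2 : Real.exp (Real.log 2) = 2 := Real.exp_log (by norm_num)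
  set p₁ : ℕ → ENNReal := fun m => ∑ j, (slotOp fun s (K : ι → ℕ) => K + Pi.single s 1)^[m]
        (fun K => ENNReal.ofReal (Real.exp (Real.log 2 * ((K j : ℝ) - 2 * t)))) 0 with hp1
  set p₂ : ℕ → ENNReal := fun m => ∑ j, (slotOp fun s (K : ι → ℕ) => K + Pi.single s 1)^[m]
        (fun K => ENNReal.ofReal (Real.exp (-Real.log 2 * ((K j : ℝ) - t / 2)))) 0 with hp2
  set B : ENNReal := ((2 * R + 1) * β) ^ (d - 1) with hB
  set E : ENNReal := 4 * d * ENNReal.ofReal (Real.exp (-(l * R))) with hE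
  set q : ENNReal := ENNReal.ofReal (Real.exp (-(Real.log 2 * (2 * (d * t))))) with hq
  have hm : ∀ m : ℕ, ∫⁻ Y, trajSum (fun _ _ => 1) meet m Y ∂(chainsLaw P x) ≤
      (d : ENNReal) ^ m * B + (p₁ m + (p₂ m + ((d : ENNReal) ^ m * E +
        q * ENNReal.ofReal (d * 2) ^ m))) := by
    intro m
    -- The gap estimate is available only up to 2dt choices. Beyond that the trivial bound d^m is
    -- multiplied by 2^m exp(-2dt log 2) ≥ 1, whose Poisson average is exponentially small.
    by_cases hmt : (m : ℝ) ≤ 2 * (d * t)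
    · refine (lintegral_mono fun Y => trajSum_meet_le Y hb R t hl m).trans ?_
      rw [lintegral_add_left (measurable_slotOp_iterate _ (measurable_nearMeet b R t) m 0),
        lintegral_add_left measurable_const, lintegral_add_left measurable_const, lintegral_const,
        lintegral_const, measure_univ, mul_one, mul_one]
      have hmeas : ∀ (u : ℝ) (j : ι), Measurable fun Y : ι → ℕ → V => trajSum
          (fun s x => ENNReal.ofReal (Real.exp (u * gapIncr j s x))) (fun _ => 1) m Y :=
        fun u j => measurable_trajSum _ _ m
      have hsum : ∀ u : ℝ, Measurable fun Y : ι → ℕ → V => ∑ j, trajSum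
          (fun s x => ENNReal.ofReal (Real.exp (u * gapIncr j s x))) (fun _ => 1) m Y :=
        fun u => Finset.measurable_sum _ fun j _ => hmeas u j
      rw [lintegral_const_mul' _ _ ENNReal.ofReal_ne_top, lintegral_add_left (hsum l),
        lintegral_finsetSum _ fun j _ => hmeas l j, lintegral_finsetSum _ fun j _ => hmeas (-l) j]
      refine add_le_add ?_ (add_le_add le_rfl (add_le_add le_rfl (le_trans ?_ le_self_add)))
      · exact lintegral_slotOp_iterate_le _ _ (measurable_nearMeet b R t)
          (lintegral_nearMeet_le P x b hR hβ) m 0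
      · refine (mul_le_mul' le_rfl (add_le_add
          (Finset.sum_le_sum fun j _ => hgap m hmt j l (Or.inl rfl))
          (Finset.sum_le_sum fun j _ => hgap m hmt j (-l) (Or.inr rfl)))).trans (le_of_eq ?_)
        rw [Finset.sum_const, Finset.card_univ, nsmul_eq_mul, hE]
        ring
    · refine (lintegral_mono fun Y => trajSum_meet_le_pow Y m).trans ?_
      rw [lintegral_const, measure_univ, mul_one]
      refine le_trans ?_ (le_add_self.trans' (le_add_self.trans' (le_add_self.trans' le_add_self)))
      rw [ENNReal.ofReal_mul (Nat.cast_nonneg d), mul_pow, ENNReal.ofReal_natCast, mul_left_comm, hq]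
      refine le_mul_of_one_le_right zero_le ?_
      have e : ENNReal.ofReal 2 ^ m = ENNReal.ofReal (Real.exp (Real.log 2 * m)) := by
        rw [← ENNReal.ofReal_pow (by norm_num), mul_comm, Real.exp_nat_mul, he2]
      rw [e, ← ENNReal.ofReal_mul (Real.exp_nonneg _), ← Real.exp_add]
      exact one_le_ofReal_exp (by nlinarith)
  have h1 : ∫⁻ Y, ∑' n, meet (posAt Y n) * indexLaw t Y n ∂(chainsLaw P x) =
      ∑' m, unifWeight d t m * ∫⁻ Y, trajSum (fun _ _ => 1) meet m Y ∂(chainsLaw P x) := by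
    rw [← tsum_unifWeight_stepMean P x ht]
    refine tsum_congr fun m => ?_
    rw [lintegral_trajSum, slotMean_one_iterate]
  have hu1 : ∑' m, unifWeight d t m * (d : ENNReal) ^ m = 1 := by
    have := tsum_unifWeight_mul_pow d ht (c := d) (Nat.cast_nonneg _)
    rw [ENNReal.ofReal_natCast] at this
    rw [this, ← Real.exp_add]
    simp [mul_comm]
  rw [h1]
  refine (ENNReal.tsum_le_tsum fun m => mul_le_mul' le_rfl (hm m)).trans (le_of_eq ?_)
  simp only [mul_add, ENNReal.tsum_add, hp1, hp2, Finset.mul_sum]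
  rw [Summable.tsum_finsetSum fun _ _ => ENNReal.summable,
    Summable.tsum_finsetSum fun _ _ => ENNReal.summable]
  simp only [hd, tsum_unifWeight_count_exp ht]
  simp only [← mul_assoc, ENNReal.tsum_mul_right, ← hd, hu1, one_mul]
  rw [Finset.sum_const, Finset.sum_const, Finset.card_univ, nsmul_eq_mul, nsmul_eq_mul, he2,
    Real.exp_neg, he2]
  have e : ∀ m, unifWeight d t m * q * ENNReal.ofReal (d * 2) ^ m =
      q * (unifWeight d t m * ENNReal.ofReal (d * 2) ^ m) := fun m => by ring
  simp only [e]
  rw [ENNReal.tsum_mul_left, tsum_unifWeight_mul_pow d ht (by positivity), hq,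
    ← ENNReal.ofReal_mul (Real.exp_nonneg _), ← Real.exp_add, ← Real.exp_add]
  congr 5
  · ring_nf
  · congr 2
    ring
  · ring_nf

end UnionBound

/-! ### Numerical estimates -/

section Numerics

/-- In exponential form the right-hand power costs 2(k+1) log x ≤ x^3/5, by the bounds on k and log
x, so exp(-x^3) has room to absorb the prefactor. -/
lemma mul_exp_neg_cube_le {x : ℝ} (hx : 4 ≤ x) (hlog : Real.log x ≤ x / 20) {k : ℕ}
    (hk : (k : ℝ) ≤ x ^ 2) : 7 * k * Real.exp (-x ^ 3) ≤ (x⁻¹) ^ (2 * (k + 1)) / 2 := by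
  have hx0 : 0 < x := by linarith
  have h1 : (x⁻¹) ^ (2 * (k + 1)) = Real.exp (-(2 * (k + 1) * Real.log x)) := by
    rw [inv_pow, Real.exp_neg, ← Real.rpow_natCast, Real.rpow_def_of_pos hx0]
    congr 2
    push_cast
    ring
  have h2 : 14 * x ^ 2 ≤ Real.exp (2.8 + 2 * Real.log x) := by
    have e : Real.exp (2 * Real.log x) = x ^ 2 := by
      rw [mul_comm, Real.exp_mul, Real.exp_log hx0]
      norm_num
    -- Since 4 log 2 < 2.8, the exponential exceeds 16.
    have e2 : (14 : ℝ) ≤ Real.exp 2.8 := by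
      have h3 : Real.exp (4 * Real.log 2) = 16 := by
        rw [mul_comm, Real.exp_mul, Real.exp_log (by norm_num)]
        norm_num
      have h4 : Real.exp (4 * Real.log 2) ≤ Real.exp 2.8 := by
        refine Real.exp_le_exp.2 ?_
        linarith [Real.log_two_lt_d9]
      linarith
    rw [Real.exp_add, e]
    exact mul_le_mul_of_nonneg_right e2 (by positivity)
  have hx3 : 16 * x ≤ x ^ 3 := by nlinarith [mul_nonneg hx0.le (sub_nonneg.2 hx)]
  have hl0 : 0 ≤ Real.log x := Real.log_nonneg (by linarith)
  have hx21 : 1 ≤ x ^ 2 := by nlinarith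
  have hkl : 2 * (k + 1) * Real.log x ≤ x ^ 3 / 5 := by
    calc 2 * (k + 1) * Real.log x ≤ 2 * (x ^ 2 + x ^ 2) * (x / 20) := by gcongr
      _ = x ^ 3 / 5 := by ring
  rw [h1, le_div_iff₀ (by norm_num : (0 : ℝ) < 2)]
  calc 7 * k * Real.exp (-x ^ 3) * 2 ≤ 7 * x ^ 2 * Real.exp (-x ^ 3) * 2 := by gcongr
    _ = 14 * x ^ 2 * Real.exp (-x ^ 3) := by ring
    _ ≤ Real.exp (2.8 + 2 * Real.log x) * Real.exp (-x ^ 3) := by gcongr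
    _ ≤ Real.exp (-(2 * (k + 1) * Real.log x)) := by
      rw [← Real.exp_add]
      refine Real.exp_le_exp.2 ?_
      linarith

/-- The inequality 5(k - 1) ≥ 2(k + 1) + 1 holds from k = 3 on; the spare factor 1/x pays for the
division by 2. -/
lemma pow_inv_five_le {x : ℝ} (hx : 4 ≤ x) {k : ℕ} (hk : 3 ≤ k) :
    ((x⁻¹) ^ 5) ^ (k - 1) ≤ (x⁻¹) ^ (2 * (k + 1)) / 2 := by
  have hx0 : 0 < x := by linarith
  have hi : x⁻¹ ≤ 1 / 2 := by
    rw [inv_eq_one_div]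
    exact one_div_le_one_div_of_le (by norm_num) (by linarith)
  have hi0 : 0 < x⁻¹ := inv_pos.2 hx0
  rw [← pow_mul]
  calc (x⁻¹) ^ (5 * (k - 1)) ≤ (x⁻¹) ^ (2 * (k + 1) + 1) :=
        pow_le_pow_of_le_one hi0.le (by linarith) (by omega)
    _ = (x⁻¹) ^ (2 * (k + 1)) * x⁻¹ := pow_succ _ _
    _ ≤ (x⁻¹) ^ (2 * (k + 1)) * (1 / 2) := by gcongr
    _ = _ := by ring

/-- Each of the four exponentials is at most exp(-x^3), with total multiplicity at most k + k + 4k +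
k = 7k. -/
lemma errors_le {x s : ℝ} (hx : 4 ≤ x) (hlog : Real.log x ≤ x / 20) (hxs : x ^ 10 ≤ s) {k R : ℕ}
    (hk : 3 ≤ k) (hkx : (k : ℝ) ≤ x ^ 2) {l : ℝ} (hlR : x ^ 3 ≤ l * R) :
    k * Real.exp (s ^ 2 * (1 - 2 * Real.log 2)) +
      (k * Real.exp (s ^ 2 * (Real.log 2 / 2 - 1 / 2)) + (4 * k * Real.exp (-(l * R)) +
        Real.exp (k * s ^ 2 * (1 - 2 * Real.log 2)))) ≤ (x⁻¹) ^ (2 * (k + 1)) / 2 := by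
  have hk1 : (1 : ℝ) ≤ k := by exact_mod_cast (by omega : 1 ≤ k)
  have h10 : x ^ 3 ≤ s := (pow_le_pow_right₀ (by linarith) (by norm_num)).trans hxs
  have h64 : 64 ≤ x ^ 3 := by
    calc (64 : ℝ) = 4 ^ 3 := by norm_num
      _ ≤ x ^ 3 := by gcongr
  have hs : 64 * x ^ 3 ≤ s ^ 2 := by nlinarith
  have l1 := Real.log_two_gt_d9
  have l2 := Real.log_two_lt_d9
  have hs0 : 0 ≤ s ^ 2 := sq_nonneg s
  have e1 : Real.exp (s ^ 2 * (1 - 2 * Real.log 2)) ≤ Real.exp (-x ^ 3) :=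
    Real.exp_le_exp.2 (by nlinarith)
  have e2 : Real.exp (s ^ 2 * (Real.log 2 / 2 - 1 / 2)) ≤ Real.exp (-x ^ 3) :=
    Real.exp_le_exp.2 (by nlinarith)
  have e3 : Real.exp (-(l * R)) ≤ Real.exp (-x ^ 3) := Real.exp_le_exp.2 (by linarith)
  have e4 : Real.exp (k * s ^ 2 * (1 - 2 * Real.log 2)) ≤ Real.exp (-x ^ 3) := by
    refine le_trans (Real.exp_le_exp.2 ?_) e1
    have : s ^ 2 ≤ k * s ^ 2 := by nlinarith
    nlinarith
  refine le_trans ?_ (mul_exp_neg_cube_le hx hlog hkx)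
  have hp := Real.exp_pos (-x ^ 3)
  calc _ ≤ k * Real.exp (-x ^ 3) + (k * Real.exp (-x ^ 3) + (4 * k * Real.exp (-x ^ 3) +
        k * Real.exp (-x ^ 3))) := by
        gcongr
        nlinarith
    _ = 7 * k * Real.exp (-x ^ 3) := by ring

/-- The number of step counts times the return probability. -/
lemma box_mul_decay_le {x s c C : ℝ} (hx : 1 ≤ x) (hxs : x ^ 10 ≤ s) (hc : 0 < c) (hC : 0 < C)
    (hCx : (4 / c + 6) * C ≤ x) {R : ℕ} (hR : (R : ℝ) ≤ s / (c * x ^ 6) + 1) :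
    (2 * R + 1) * (C * (2 / s)) ≤ (x⁻¹) ^ 5 := by
  have hx0 : 0 < x := by linarith
  have h6 : x ^ 6 ≤ s := (pow_le_pow_right₀ hx (by norm_num)).trans hxs
  have hs0 : 0 < s := lt_of_lt_of_le (by positivity) h6
  have h1 : (2 * R + 1) * (C * (2 / s)) ≤ (2 * (s / (c * x ^ 6) + 1) + 1) * (C * (2 / s)) := by gcongr
  have h2 : (2 * (s / (c * x ^ 6) + 1) + 1) * (C * (2 / s)) = 4 / c * C / x ^ 6 + 6 * C / s := by
    field_simp
    ring
  have h3 : 6 * C / s ≤ 6 * C / x ^ 6 := by gcongr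
  rw [h2] at h1
  refine (h1.trans (add_le_add le_rfl h3)).trans ?_
  rw [← add_div, ← add_mul, inv_pow, div_le_iff₀ (by positivity)]
  refine hCx.trans (le_of_eq ?_)
  field_simp

end Numerics

/-! ### Moments of the fragmentation process -/

/-- On the window from t/4 to 3t, n^(-1/2) is at most 2/√t, and n ≤ |V|^2 because t ≤ |V|^2/3; this
explains the factor 3 in the range of t. -/
lemma stepLaw_le_ofReal {V : Type*} {P : V → PMF V} {C t : ℝ} (hP : SqrtDecay P C) (hC : 0 < C) (ht : 0 < t)
    (htV : Finite V → t ≤ (Nat.card V : ℝ) ^ 2 / 3) (n : ℕ) (hn : t / 4 ≤ n) (hn3 : (n : ℝ) ≤ 3 * t)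
    (u v : V) : stepLaw P n u v ≤ ENNReal.ofReal (C * (2 / √t)) := by
  have hn0 : (0 : ℝ) < n := by linarith
  have hn1 : 1 ≤ n := by exact_mod_cast hn0
  have h1 := hP n hn1 (fun hf => by
    have := htV hf
    have h2 : (n : ℝ) ≤ (Nat.card V : ℝ) ^ 2 := by linarith
    exact_mod_cast h2) u v
  rw [← ENNReal.ofReal_toReal (PMF.apply_ne_top (stepLaw P n u) v)]
  refine ENNReal.ofReal_le_ofReal (h1.trans (mul_le_mul_of_nonneg_left ?_ hC.le))
  rw [Real.rpow_neg hn0.le, ← Real.sqrt_eq_rpow]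
  have h4 : √t / 2 ≤ √n := by
    refine Real.le_sqrt_of_sq_le ?_
    rw [div_pow, Real.sq_sqrt ht.le]
    norm_num
    exact hn
  have hs : 0 < √t := Real.sqrt_pos.2 ht
  rw [← inv_div]
  exact inv_anti₀ (by positivity) h4

section Moments

variable {V : Type*} [Countable V] [MeasurableSpace V] [DiscreteMeasurableSpace V]

lemma quenched_le_one (P : V → PMF V) (o : V) (t : ℝ) (v : V) (ξ : V → ℕ → ℝ) :
    quenched P o t v ξ ≤ 1 := prob_le_one

lemma moment_antitone (P : V → PMF V) (o : V) {t : ℝ} (ht : 0 ≤ t) {d e : ℝ} (hde : d ≤ e) :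
    moment P o t e ≤ moment P o t d := by
  rw [moment_eq P o ht, moment_eq P o ht]
  exact lintegral_mono fun ξ => ENNReal.tsum_le_tsum fun v =>
    ENNReal.rpow_le_rpow_of_exponent_ge (quenched_le_one P o t v ξ) hde

/-- Almost surely there is no explosion, so occupying v means having a well-defined step count whose
position is v. -/
lemma clockLaw_occ_le {ι : Type*} [LinearOrder ι] [Fintype ι] {t : ℝ} (ht : 0 ≤ t)
    (Y : ι → ℕ → V) :
    clockLaw V {ξ | ∃ v, ∀ j, (ξ, Y j) ∈ occ t v} ≤ ∑' n, meet (posAt Y n) * indexLaw t Y n := by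
  classical
  have e : ∀ n, meet (posAt Y n) = {n : ι → ℕ | ∃ v, ∀ j, Y j (n j) = v}.indicator 1 n := by
    intro n
    simp only [meet, Set.indicator, posAt, Set.mem_ofPred_eq, Pi.one_apply]
    congr
  simp only [e, tsum_indicator_indexLaw]
  refine measure_mono_ae ?_
  filter_upwards [ae_goodClocks (V := V), ae_exists_isAt ht Y] with ξ hg hex hocc
  obtain ⟨n, hn⟩ := hex
  obtain ⟨v, hv⟩ := hocc
  refine ⟨n, ⟨v, fun j => ?_⟩, hn⟩
  rcases hv j with ⟨m, hm, hmv⟩ | ⟨hno, -⟩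
  · rw [(hn j).unique hg hm]; exact hmv
  · exact absurd (hn j) (hno (n j))

lemma moment_natCast_le (P : V → PMF V) (o : V) {t : ℝ} (ht : 0 ≤ t) {k : ℕ} [NeZero k] :
    moment P o t k ≤ ∫⁻ Y, ∑' n, meet (posAt Y n) * indexLaw t Y n
      ∂(chainsLaw P fun _ : Fin k => o) := by
  rw [moment_eq P o ht]
  have h := lintegral_tsum_prod_quenched P (fun _ : Fin k => o) ht
  simp only [Finset.prod_const, Finset.card_univ, Fintype.card_fin] at h
  simp only [ENNReal.rpow_natCast, h]
  exact lintegral_mono fun Y => clockLaw_occ_le ht Y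

/-- Here l^2 = c^2 x^18 / t and t^(1-α) = t / x^20. The condition on l^2 times the collision bound
thus reads 576 C₁ c^2 k^2 / ((1-α) x^2) ≤ k with 576 = 32 · 18, and the choice of c reduces it to k
≤ x^2. -/
lemma lintegral_trajSum_gapIncr_le_of_moment {P : V → PMF V} {α C₁ c : ℝ} (hα1 : α < 1)
    (hC₁ : 1 < C₁) (hcC : 576 * C₁ * c ^ 2 = 1 - α) {t x s l : ℝ} (ht : 0 < t)
    (hmom : ∀ (o : V) (s : ℝ), 0 < s → s ≤ t → moment P o s 2 ≤ ENNReal.ofReal (C₁ * s ^ (-α)))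
    (hx0 : 0 < x) (hx20 : x ^ 20 = t ^ α) (hst : s ^ 2 = t) (hl : l = c * x ^ 9 / s)
    (hl2 : l ^ 2 ≤ 1 / 4) {k : ℕ} (hk : 3 ≤ k) (hkx : (k : ℝ) ≤ x ^ 2) (ht2 : 2 ≤ t) (o : V)
    {m : ℕ} (hm : (m : ℝ) ≤ 2 * (Fintype.card (Fin k) * t)) (j : Fin k) {u : ℝ}
    (hu : u = l ∨ u = -l) :
    ∫⁻ Y, trajSum (fun s x => ENNReal.ofReal (Real.exp (u * gapIncr j s x)))
        (fun _ => 1) m Y ∂(chainsLaw P fun _ : Fin k => o) ≤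
      2 * (Fintype.card (Fin k) : ENNReal) ^ m := by
  have : NeZero k := ⟨by omega⟩
  have hk3 : (3 : ℝ) ≤ k := by exact_mod_cast hk
  have hu2 : u ^ 2 = l ^ 2 := by rcases hu with h | h <;> rw [h]; ring
  have hul : |2 * u| ≤ 1 := by
    rw [← sq_le_one_iff_abs_le_one, mul_pow, hu2]
    linarith
  have h8 : 8 * u ^ 2 ≤ Fintype.card (Fin k) := by
    rw [hu2, Fintype.card_fin]
    linarith
  have h5 : 5 ≤ Fintype.card (Fin k) * t := by
    rw [Fintype.card_fin]
    nlinarith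
  have h32 : 32 * u ^ 2 * (18 * (Fintype.card (Fin k) : ℝ) ^ 2 * (C₁ * (t ^ (1 - α) / (1 - α)))) ≤
      Fintype.card (Fin k) := by
    rw [hu2, Fintype.card_fin]
    have h1α : 1 - α ≠ 0 := by linarith
    have hs0 : s ≠ 0 := by rintro rfl; norm_num at hst; linarith
    have e1 : t ^ (1 - α) = s ^ 2 / x ^ 20 := by
      rw [Real.rpow_sub ht, Real.rpow_one, hx20, hst]
    have e2 : 32 * l ^ 2 * (18 * (k : ℝ) ^ 2 * (C₁ * (t ^ (1 - α) / (1 - α)))) =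
        k ^ 2 * (576 * C₁ * c ^ 2 / (1 - α)) / x ^ 2 := by
      rw [e1, hl]
      field_simp
      ring
    rw [e2, hcC, div_self h1α, mul_one, div_le_iff₀ (by positivity), sq]
    exact mul_le_mul_of_nonneg_left hkx (by positivity)
  exact lintegral_trajSum_gapIncr_le P j hul h8 (M := m)
    (fun y => sum_stepMean_collide_le_of_horizon P hα1 ht.le hmom (by linarith) h5 hm _
      (by simp) y) h32 le_rfl _

lemma error_terms_eq_ofReal {k R : ℕ} {b e₁ e₂ e₃ e₄ : ℝ} (hb : 0 ≤ b) (h1 : 0 ≤ e₁) (h2 : 0 ≤ e₂)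
    (h3 : 0 ≤ e₃) (h4 : 0 ≤ e₄) :
    ((2 * R + 1) * ENNReal.ofReal b) ^ (k - 1) + (k * ENNReal.ofReal e₁ + (k * ENNReal.ofReal e₂ +
      (4 * k * ENNReal.ofReal e₃ + ENNReal.ofReal e₄))) =
    ENNReal.ofReal (((2 * R + 1) * b) ^ (k - 1) + (k * e₁ + (k * e₂ + (4 * k * e₃ + e₄)))) := by
  rw [ENNReal.ofReal_add (by positivity) (by positivity),
    ENNReal.ofReal_add (by positivity) (by positivity),
    ENNReal.ofReal_add (by positivity) (by positivity),
    ENNReal.ofReal_add (by positivity) (by positivity),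
    ENNReal.ofReal_pow (by positivity), ENNReal.ofReal_mul (p := 2 * (R : ℝ) + 1) (by positivity),
    ENNReal.ofReal_mul (p := (k : ℝ)) (by positivity),
    ENNReal.ofReal_mul (p := (k : ℝ)) (by positivity),
    ENNReal.ofReal_mul (p := 4 * (k : ℝ)) (by positivity),
    ENNReal.ofReal_add (p := 2 * (R : ℝ)) (by positivity) (by positivity),
    ENNReal.ofReal_mul (p := 2) (by positivity), ENNReal.ofReal_mul (p := 4) (by positivity),
    ENNReal.ofReal_natCast, ENNReal.ofReal_natCast]
  simp

/-- Main estimate, for integer moments. -/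
lemma moment_natCast_le_pow {P : V → PMF V} {α C₀ C₁ c : ℝ} (hα0 : 0 < α) (hα1 : α < 1)
    (hC₀ : 0 < C₀) (hC₁ : 1 < C₁) (hc : 0 < c) (hcC : 576 * C₁ * c ^ 2 = 1 - α)
    (hP : SqrtDecay P C₀) {t x : ℝ} (ht : 0 < t) (htV : Finite V → t ≤ (Nat.card V : ℝ) ^ 2 / 3)
    (hmom : ∀ (o : V) (s : ℝ), 0 < s → s ≤ t → moment P o s 2 ≤ ENNReal.ofReal (C₁ * s ^ (-α)))
    (hxt : x = t ^ (α / 20)) (hx : 4 ≤ x) (hlog : Real.log x ≤ x / 20)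
    (hCx : (4 / c + 6) * C₀ ≤ x) (hcx : 4 / c + 4 ≤ x) {k : ℕ} (hk : 3 ≤ k)
    (hkx : (k : ℝ) ≤ x ^ 2) (o : V) :
    moment P o t k ≤ ENNReal.ofReal ((x⁻¹) ^ (2 * (k + 1))) := by
  have : NeZero k := ⟨by omega⟩
  have hx0 : 0 < x := by linarith
  set s := √t with hs
  have hs0 : 0 < s := Real.sqrt_pos.2 ht
  have hst : s ^ 2 = t := Real.sq_sqrt ht.le
  have hx20 : x ^ 20 = t ^ α := by
    rw [hxt, ← Real.rpow_natCast, ← Real.rpow_mul ht.le]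
    congr 1
    push_cast
    ring
  have ht1 : 1 ≤ t := by
    by_contra h
    push Not at h
    have : x ≤ 1 := by rw [hxt]; exact Real.rpow_le_one ht.le h.le (by positivity)
    linarith
  have hxs : x ^ 10 ≤ s := by
    refine Real.le_sqrt_of_sq_le ?_
    rw [← pow_mul, hx20]
    exact (Real.rpow_le_rpow_of_exponent_le ht1 hα1.le).trans (by rw [Real.rpow_one])
  have hxs' : x ≤ s := by
    refine le_trans ?_ hxs
    calc x = x ^ 1 := (pow_one x).symm
      _ ≤ x ^ 10 := pow_le_pow_right₀ (by linarith) (by norm_num)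
  have hx9s : x ^ 9 ≤ s := (pow_le_pow_right₀ (by linarith) (by norm_num)).trans hxs
  -- This is t^(-(1-α)/2) reduced by a factor of order 1/x, the margin that accommodates all k ≤
  -- x^2.
  set l : ℝ := c * x ^ 9 / s with hl
  have hl0 : 0 < l := by positivity
  -- Because 576 C₁ c^2 = 1 - α < 1; hence l ≤ c ≤ 1/2, as the exponential expansion with 2l
  -- requires.
  have hc24 : c ≤ 1 / 2 := by
    by_contra h
    push Not at h
    nlinarith
  have hlc : l ≤ c := by
    rw [hl, mul_div_assoc]
    exact mul_le_of_le_one_right hc.le ((div_le_one hs0).2 hx9s)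
  -- The radius makes exp(-lR) at most exp(-x^3), yet stays of order √t / x^6, so that R times the
  -- decay rate is a negative power of x.
  set R := ⌈x ^ 3 / l⌉₊ with hR
  have hR1 : (R : ℝ) ≤ s / (c * x ^ 6) + 1 := by
    have h1 := (Nat.ceil_lt_add_one (a := x ^ 3 / l) (by positivity)).le
    have h2 : x ^ 3 / l = s / (c * x ^ 6) := by
      rw [hl]; field_simp
    rw [h2] at h1
    rw [hR, h2]
    exact h1
  have hlR : x ^ 3 ≤ l * R := by
    have := Nat.le_ceil (x ^ 3 / l)
    rw [div_le_iff₀ hl0] at this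
    linarith
  have hR4 : (R : ℝ) ≤ t / 4 := by
    have h1 : s / (c * x ^ 6) ≤ s / c := by
      refine div_le_div_of_nonneg_left hs0.le hc ?_
      exact le_mul_of_one_le_right hc.le (one_le_pow₀ (by linarith))
    have h2 : 4 / c + 4 ≤ s := hcx.trans hxs'
    have h3 : s / c + s ≤ s ^ 2 / 4 := by
      have : s * (4 / c + 4) ≤ s * s := by gcongr
      have e : s * (4 / c + 4) = 4 * (s / c + s) := by ring
      nlinarith
    rw [← hst]
    linarith
  have hl2 : l ^ 2 ≤ 1 / 4 := by nlinarith
  have hgap := fun m hm j u hu => lintegral_trajSum_gapIncr_le_of_moment hα1 hC₁ hcC ht hmom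
    hx0 hx20 hst hl hl2 hk hkx (by nlinarith) o (m := m) hm j (u := u) hu
  have hb : ∀ i : Fin k, (⟨0, by omega⟩ : Fin k) ≤ i := fun i => Nat.zero_le i.1
  have h1 := (moment_natCast_le P o ht.le (k := k)).trans
    (lintegral_tsum_meet_le P (fun _ : Fin k => o) hb ht.le hl0.le hR4
      (stepLaw_le_ofReal hP hC₀ ht htV) hgap)
  refine h1.trans ?_
  have hbox := box_mul_decay_le (by linarith) hxs hc hC₀ hCx hR1
  have herr := errors_le hx hlog hxs hk hkx hlR
  have hbox' := (pow_le_pow_left₀ (by positivity) hbox (k - 1)).trans (pow_inv_five_le hx hk)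
  rw [hst] at herr
  have hsum := ENNReal.ofReal_le_ofReal (add_le_add hbox' herr)
  rw [add_halves] at hsum
  refine le_trans (le_of_eq ?_) hsum
  rw [Fintype.card_fin]
  exact error_terms_eq_ofReal (by positivity) (Real.exp_nonneg _) (Real.exp_nonneg _)
    (Real.exp_nonneg _) (Real.exp_nonneg _)

end Moments

end

end Fragmentation

/-! ### Choice of the threshold and reduction to integer moments -/

theorem mainTheorem11 (α C₀ C₁ : ℝ) (hα0 : 0 < α) (hα1 : α < 1) (hC₀ : 0 < C₀) (hC₁ : 1 < C₁) :
    ∃ t₀ : ℝ, ∀ (V : Type*) [Countable V] [MeasurableSpace V] [DiscreteMeasurableSpace V]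
      (P : V → PMF V),
      Fragmentation.SqrtDecay P C₀ →
      (∀ (o : V) (t : ℝ), 0 < t → (Finite V → t ≤ (Nat.card V : ℝ) ^ 2 / 3) →
        Fragmentation.moment P o t 2 ≤ ENNReal.ofReal (C₁ * t ^ (-α))) →
      ∀ (o : V) (d t : ℝ), 2 ≤ d → max t₀ (d ^ (10 / α)) ≤ t →
        (Finite V → t ≤ (Nat.card V : ℝ) ^ 2 / 3) →
        Fragmentation.moment P o t d ≤ ENNReal.ofReal (t ^ (-(α * d / 10))) := by
  -- Normalization of the exponential parameter for which the Khasminskii condition becomes exactly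
  -- k ≤ x^2.
  set c : ℝ := √((1 - α) / (576 * C₁)) with hc
  have hc0 : 0 < c := Real.sqrt_pos.2 (div_pos (by linarith) (by linarith))
  have hcC : 576 * C₁ * c ^ 2 = 1 - α := by
    rw [hc, Real.sq_sqrt (div_nonneg (by linarith) (by linarith))]
    field_simp
  have hlog : ∀ᶠ x : ℝ in Filter.atTop, Real.log x ≤ x / 20 := by
    have h := Real.isLittleO_log_id_atTop.bound (c := 1 / 20) (by norm_num)
    filter_upwards [h, Filter.eventually_ge_atTop 1] with x hx h1
    have h2 := (le_abs_self _).trans hx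
    rw [id, Real.norm_eq_abs, abs_of_pos (by linarith : 0 < x)] at h2
    linarith
  have hev : ∀ᶠ x : ℝ in Filter.atTop, 4 ≤ x ∧ Real.log x ≤ x / 20 ∧ (4 / c + 6) * C₀ ≤ x ∧
      4 / c + 4 ≤ x ∧ C₁ ≤ x :=
    (Filter.eventually_ge_atTop _).and (hlog.and ((Filter.eventually_ge_atTop _).and
      ((Filter.eventually_ge_atTop _).and (Filter.eventually_ge_atTop _))))
  -- All requirements are lower bounds on x = t^(α/20) in terms of α, C₀ and C₁ only, so the
  -- threshold depends on neither V nor d.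
  obtain ⟨t₀, ht₀⟩ := Filter.eventually_atTop.1 ((tendsto_rpow_atTop
    (by positivity : 0 < α / 20)).eventually hev)
  refine ⟨t₀, fun V _ _ _ P hP hmom o d t hd ht htV => ?_⟩
  obtain ⟨hx, hlogx, hCx, hcx, hC1x⟩ := ht₀ t ((le_max_left _ _).trans ht)
  have hdt : d ^ (10 / α) ≤ t := (le_max_right _ _).trans ht
  have ht0 : 0 < t := lt_of_lt_of_le (Real.rpow_pos_of_pos (by linarith) _) hdt
  set x := t ^ (α / 20) with hxt
  have hx0 : 0 < x := by linarith
  have ht1 : 1 ≤ t := by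
    by_contra h
    push Not at h
    have : x ≤ 1 := Real.rpow_le_one ht0.le h.le (by positivity)
    linarith
  have hmom' : ∀ (o : V) (s : ℝ), 0 < s → s ≤ t →
      Fragmentation.moment P o s 2 ≤ ENNReal.ofReal (C₁ * s ^ (-α)) :=
    fun o s hs hst => hmom o s hs fun hf => hst.trans (htV hf)
  have hpow : ∀ n : ℕ, t ^ (-(α * n / 20)) = (x⁻¹) ^ n := by
    intro n
    rw [inv_pow, Real.rpow_neg ht0.le, hxt, ← Real.rpow_natCast, ← Real.rpow_mul ht0.le]
    congr 2
    ring
  -- This is where t ≥ d^(10/α) enters: x^2 = t^(α/10).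
  have hdx : d ≤ x ^ 2 := by
    have h1 : (d ^ (10 / α)) ^ (α / 10) ≤ t ^ (α / 10) :=
      Real.rpow_le_rpow (Real.rpow_nonneg (by linarith) _) hdt (by positivity)
    rw [← Real.rpow_mul (by linarith), div_mul_div_cancel₀ hα0.ne', div_self (by norm_num),
      Real.rpow_one] at h1
    refine h1.trans (le_of_eq ?_)
    rw [hxt, ← Real.rpow_natCast, ← Real.rpow_mul ht0.le]
    congr 1
    push_cast
    ring
  set k := ⌊d⌋₊ with hk
  have hkd : (k : ℝ) ≤ d := Nat.floor_le (by linarith)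
  have hdk : d < k + 1 := Nat.lt_floor_add_one d
  have hk2 : 2 ≤ k := Nat.le_floor (by exact_mod_cast hd)
  -- The target is x^(-2d), and d < k + 1; rounding d down is paid for by asking for the exponent k
  -- + 1 in the k-th moment.
  have htarget : (x⁻¹) ^ (2 * (k + 1)) ≤ t ^ (-(α * d / 10)) := by
    rw [← hpow]
    refine Real.rpow_le_rpow_of_exponent_le ht1 ?_
    push_cast
    nlinarith
  refine le_trans ?_ (ENNReal.ofReal_le_ofReal htarget)
  rcases hk2.eq_or_lt with h2 | h3
  -- For d < 3 the union bound is too weak, but the hypothesis gives C₁ x^(-20) ≤ x^(-19), well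
  -- below x^(-6).
  · refine (Fragmentation.moment_antitone P o ht0.le hd).trans ((hmom' o t ht0 le_rfl).trans
      (ENNReal.ofReal_le_ofReal ?_))
    have e := hpow 20
    rw [← h2, show -(α * ((20 : ℕ) : ℝ) / 20) = -α by push_cast; ring] at *
    rw [e]
    have hi1 : x⁻¹ ≤ 1 := inv_le_one_of_one_le₀ (by linarith)
    calc C₁ * (x⁻¹) ^ 20 ≤ x * (x⁻¹) ^ 20 := by gcongr
      _ = (x⁻¹) ^ 19 := by field_simp
      _ ≤ (x⁻¹) ^ (2 * (2 + 1)) :=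
        pow_le_pow_of_le_one (inv_nonneg.2 hx0.le) hi1 (by norm_num)
  · refine (Fragmentation.moment_antitone P o ht0.le hkd).trans ?_
    exact Fragmentation.moment_natCast_le_pow hα0 hα1 hC₀ hC₁ hc0 hcC hP ht0 htV hmom' hxt hx hlogx hCx hcx h3
      (hkd.trans hdx) o
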